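/- **Setting.** Let $M,N\ge 1$ be integers with $2N>M$, let $0<r_0\le r_1<r$, $\alpha>0$, $\lambda_I\ge 0$, $\rho_I\ge 0$, and assume $\alpha>2$ if $\rho_I>0$. Put $L(d)=d^\alpha$ for $d>r_0$ and $L(d)=r_0^\alpha$ otherwise. A base station with $M$ antennas at the origin of $\mathbb R^2$ serves $M$ pairs of users with $N$ antennas each; pair $i$ consists of a near user $i$, uniformly distributed in the disc of radius $r_1$ around the origin, and a far user $i'$, uniformly distributed in the ring between the radii $r_1$ and $r$. The fading matrices $\mathbf G_i,\mathbf G_{i'}\in\mathbb C^{N\times M}$ have i.i.d. $\mathrm{CN}(0,1)$ entries, the interferers form a homogeneous Poisson point process $\Psi_I$ of density $\lambda_I$ on $\mathbb R^2$, and the vectors $\mathbf x_i\in\mathbb C^{2N-M}$ (random detection) are uniformly distributed on the sphere $|\mathbf x|^2=2$; all user locations, fading matrices, $\Psi_I$ and all $\mathbf x_i$ are independent. Let $\mathbf U_i$ be a $2N\times(2N-M)$ matrix, depending measurably on $(\mathbf G_i,\mathbf G_{i'})$, whose columns are orthonormal and lie in the null space of $[\mathbf G_i^H\ \ -\mathbf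 G_{i'}^H]$. The detection vectors $\mathbf v_i,\mathbf v_{i'}\in\mathbb C^N$ are the upper and lower half of $\mathbf U_i\mathbf x_i$; put $\mathbf g_i=\mathbf G_i^H\mathbf v_i$ and $\mathbf G=[\mathbf g_1\cdots\mathbf g_M]$. For a pair $m$ let $d_{m'}$ be the distance of user $m'$ from the origin and $$h_{m'}=\frac1{\sqrt{L(d_{m'})\,(\mathbf G^{-1}\mathbf G^{-H})_{m,m}}},\qquad I_{m'}=\sum_{j\in\Psi_I}\frac{\rho_I}{L(d_{I_j,m'})},$$ where $d_{I_j,m'}$ is the distance from user $m'$ to the interferer $j$. Let $\alpha_m,\alpha_{m'}$ be real constants (fixed power allocation) with $\alpha_m^2+\alpha_{m'}^2=1$, let $R_{m'}>0$ and $\epsilon_{m'}=2^{R_{m'}}-1$. For a transmit SNR $\rho>0$ the outage probability of user $m'$ is $$\mathrm P^o_{m'}(\rho)=\mathrm P\Bigl(\log_2\Bigl(1+\frac{\rho|h_{m'}|^2\alpha_{m'}^2}{\rho|h_{m'}|^2\alpha_m^2+|\mathbf v_{m'}|^2+|\mathbf v_{m'}^H\mathbf 1_N|^2I_{m'}}\Bigr)<R_{m'}\Bigr),$$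 where $\mathbf 1_N$ is the all-one vector, and for $\delta\ge0$ the modified outage probability is $$\tilde{\mathrm P}_{m'}(\rho)=\mathrm P\Bigl(\log_2\Bigl(1+\frac{\rho|h_{m'}|^2\alpha_{m'}^2}{\rho|h_{m'}|^2\alpha_m^2+2+2\delta I_{m'}}\Bigr)<R_{m'}\Bigr).$$ An outage probability $\mathrm P(\rho)$ has diversity order $d$ if $\mathrm P(\rho)>0$ for all large $\rho$ and $-\log\mathrm P(\rho)/\log\rho\to d$ as $\rho\to\infty$, all other parameters being fixed. **Corollary.** If $\alpha_{m'}^2>\alpha_m^2\epsilon_{m'}$, then the far user $m'$ achieves diversity order exactly one: $\mathrm P^o_{m'}$ has diversity order $1$, and so has $\tilde{\mathrm P}_{m'}$ for every $\delta\ge0$. -/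

import Mathlib

open MeasureTheory ProbabilityTheory Filter Topology
open scoped ENNReal NNReal Matrix

namespace MimoNoma

noncomputable section

/-- The plane in which users and interferers live; the base station is at the origin. -/
abbrev Plane : Type := EuclideanSpace ℝ (Fin 2)

/-- A channel matrix from a base station with `M` antennas to a user with `N` antennas. -/
abbrev Channel (N M : ℕ) : Type := Matrix (Fin N) (Fin M) ℂ

/-- Matrices carry the product σ-algebra of their entries. -/
instance instMeasurableSpaceMatrix {m n : Type*} : MeasurableSpace (Matrix m n ℂ) :=
  inferInstanceAs (MeasurableSpace (m → n → ℂ))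

/-! ### Laws of the random quantities -/

/-- The circularly symmetric complex Gaussian law `CN(0,1)`: independent real and imaginary
parts, each `N(0,1/2)`. -/
def complexGaussian : Measure ℂ :=
  ((gaussianReal 0 2⁻¹).prod (gaussianReal 0 2⁻¹)).map fun p : ℝ × ℝ => (⟨p.1, p.2⟩ : ℂ)

/-- Rayleigh fading: an `N × M` matrix with i.i.d. `CN(0,1)` entries. -/
def rayleigh (N M : ℕ) : Measure (Channel N M) :=
  Measure.pi fun _ : Fin N => Measure.pi fun _ : Fin M => complexGaussian

/-- Squared Euclidean norm of a complex vector. -/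
def normSq {ι : Type*} [Fintype ι] (v : ι → ℂ) : ℝ := ∑ i, ‖v i‖ ^ 2

/-- The uniform law on the sphere `|x|² = 2` of `ℂᵏ`, as the law of a normalized standard
complex Gaussian vector. -/
def uniformSphere (k : ℕ) : Measure (Fin k → ℂ) :=
  (Measure.pi fun _ : Fin k => complexGaussian).map fun z i =>
    ((√2 / √(normSq z) : ℝ) : ℂ) * z i

/-- The inner disc `D₁`. -/
def innerDisc (r₁ : ℝ) : Set Plane := Metric.closedBall 0 r₁

/-- The ring `D₂ = D \ D₁`. -/
def outerRing (r₁ r : ℝ) : Set Plane := Metric.closedBall 0 r \ Metric.closedBall 0 r₁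

/-- The counting measure of the points of `S`. -/
def points (S : Set Plane) : Measure Plane := Measure.sum fun y : S => Measure.dirac (y : Plane)

/-- `Ψ` is a homogeneous Poisson point process of density `lam` on the plane: the number of points
in a set of finite area `A` is Poisson with mean `lam * A`, and the numbers of points in disjoint
sets are independent. -/
structure IsPoissonProcess {Ω : Type*} [MeasurableSpace Ω] (μ : Measure Ω) (lam : ℝ≥0)
    (Ψ : Ω → Set Plane) : Prop where
  measurable : Measurable fun ω => points (Ψ ω)
  count_law : ∀ B : Set Plane, MeasurableSet B → volume B ≠ ∞ →
    HasLaw (fun ω => points (Ψ ω) B)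
      ((poissonMeasure (lam * (volume B).toNNReal)).map fun n : ℕ => (n : ℝ≥0∞)) μ
  indep : ∀ (n : ℕ) (B : Fin n → Set Plane), (∀ i, MeasurableSet (B i)) →
    (∀ i j, i ≠ j → Disjoint (B i) (B j)) → iIndepFun (fun i ω => points (Ψ ω) (B i)) μ

/-! ### Signal alignment and zero forcing -/

/-- A rule that assigns to the two channel matrices `A = G_m`, `A' = G_{m'}` of a pair a matrix
`U_m` whose `2N - M` columns are orthonormal and lie in the null space of `[Aᴴ  -A'ᴴ]`, i.e. are
right singular vectors of that matrix for the singular value zero. -/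
structure IsAlignment {M N : ℕ}
    (U : Channel N M → Channel N M → Matrix (Fin N ⊕ Fin N) (Fin (2 * N - M)) ℂ) : Prop where
  measurable : Measurable fun q : Channel N M × Channel N M => U q.1 q.2
  orthonormal : ∀ A A', (U A A')ᴴ * U A A' = 1
  null : ∀ A A', Matrix.fromCols Aᴴ (-A'ᴴ) * U A A' = 0

section Scheme

variable {M N : ℕ}
  (U : Fin M → Channel N M → Channel N M → Matrix (Fin N ⊕ Fin N) (Fin (2 * N - M)) ℂ)
  (G G' : Fin M → Channel N M) (x : Fin M → Fin (2 * N - M) → ℂ)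

/-- Detection vector `v_i` of the near user of pair `i`: the upper half of `U_i x_i`. -/
def nearVec (i : Fin M) : Fin N → ℂ := fun n => (U i (G i) (G' i) *ᵥ x i) (Sum.inl n)

/-- Detection vector `v_{i'}` of the far user of pair `i`: the lower half of `U_i x_i`. -/
def farVec (i : Fin M) : Fin N → ℂ := fun n => (U i (G i) (G' i) *ᵥ x i) (Sum.inr n)

/-- The effective channel vector `g_i = G_iᴴ v_i` shared by the two users of pair `i`. -/
def effVec (i : Fin M) : Fin M → ℂ := (G i)ᴴ *ᵥ nearVec U G G' x i

/-- The effective channel matrix `[g_1 ⋯ g_M]`, with columns `g_i`; the zero-forcing precoder is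
`(effMatrix)⁻ᴴ D`. -/
def effMatrix : Matrix (Fin M) (Fin M) ℂ := Matrix.of fun j i => effVec U G G' x i j

/-- `(G⁻¹ G⁻ᴴ)_{m,m}`, a nonnegative real number. -/
def zfDiag (m : Fin M) : ℝ :=
  ((effMatrix U G G' x)⁻¹ * ((effMatrix U G G' x)⁻¹)ᴴ) m m |>.re

end Scheme

/-- Bounded path loss with exponent `α`. -/
def pathLoss (r₀ α d : ℝ) : ℝ := if r₀ < d then d ^ α else r₀ ^ α

/-- The scalar channel gain `h = 1 / √(L(d) (G⁻¹ G⁻ᴴ)_{m,m})`. -/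
def scalarGain (r₀ α d z : ℝ) : ℝ := 1 / √(pathLoss r₀ α d * z)

/-- Interference at the location `p`: the sum of `ρI / L(distance)` over the interferers, as an
extended nonnegative number. -/
def interference (r₀ α ρI : ℝ) (S : Set Plane) (p : Plane) : ℝ≥0∞ :=
  ∑' y : S, ENNReal.ofReal (ρI / pathLoss r₀ α (dist p y))

/-- SINR of the far user, with channel gain `h`, power allocation coefficients `a` (near user) and
`a'` (far user), and noise plus co-channel interference of power `w`. -/
def sinr (a a' ρ h w : ℝ) : ℝ := ρ * |h| ^ 2 * a' ^ 2 / (ρ * |h| ^ 2 * a ^ 2 + w)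

/-! ### The random system and its outage probabilities -/

/-- The random quantities of the downlink: fading matrices `G i`, `G' i`, locations `p i`, `p' i`
(near and far user of pair `i`), the vectors `x i` and the set `Ψ` of interferers. -/
structure Downlink (M N : ℕ) (Ω : Type*) where
  G : Ω → Fin M → Channel N M
  G' : Ω → Fin M → Channel N M
  p : Ω → Fin M → Plane
  p' : Ω → Fin M → Plane
  x : Ω → Fin M → Fin (2 * N - M) → ℂ
  Ψ : Ω → Set Plane

variable {M N : ℕ} {Ω : Type*}

/-- Everything except the interferers. -/
def Downlink.cell (S : Downlink M N Ω) (ω : Ω) :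
    (Fin M → Channel N M) × (Fin M → Channel N M) × (Fin M → Plane) × (Fin M → Plane) ×
      (Fin M → Fin (2 * N - M) → ℂ) :=
  (S.G ω, S.G' ω, S.p ω, S.p' ω, S.x ω)

/-- The distributional assumptions. All quantities are independent; the fading is Rayleigh, the
near users are uniform in `D₁`, the far users are uniform in `D₂`, the vectors `x i` are uniform on
the sphere `|x|² = 2`, and the interferers form a Poisson process. -/
structure Downlink.IsModel [MeasurableSpace Ω] (S : Downlink M N Ω) (μ : Measure Ω)
    (r₁ r : ℝ) (lam : ℝ≥0) : Prop where
  law : HasLaw S.cell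
    ((Measure.pi fun _ => rayleigh N M).prod <|
      (Measure.pi fun _ => rayleigh N M).prod <|
      (Measure.pi fun _ => (volume : Measure Plane)[|innerDisc r₁]).prod <|
      (Measure.pi fun _ => (volume : Measure Plane)[|outerRing r₁ r]).prod <|
      Measure.pi fun _ => uniformSphere (2 * N - M)) μ
  poisson : IsPoissonProcess μ lam S.Ψ
  indep : IndepFun S.cell (fun ω => points (S.Ψ ω)) μ

variable (S : Downlink M N Ω)
  (U : Fin M → Channel N M → Channel N M → Matrix (Fin N ⊕ Fin N) (Fin (2 * N - M)) ℂ)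

/-- The scalar channel `h_{m'}` of the far user of pair `m`. -/
def Downlink.farChannel (r₀ α : ℝ) (m : Fin M) (ω : Ω) : ℝ :=
  scalarGain r₀ α (dist (S.p' ω m) 0) (zfDiag U (S.G ω) (S.G' ω) (S.x ω) m)

/-- The interference `I_{m'}` at the far user of pair `m` (almost surely finite whenever `ρI = 0`
or `2 < α`). -/
def Downlink.farInterference (r₀ α ρI : ℝ) (m : Fin M) (ω : Ω) : ℝ :=
  (interference r₀ α ρI (S.Ψ ω) (S.p' ω m)).toReal

/-- The detection vector `v_{m'}` of the far user of pair `m`. -/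
def Downlink.farDetector (m : Fin M) (ω : Ω) : Fin N → ℂ :=
  farVec U (S.G ω) (S.G' ω) (S.x ω) m

/-- The outage probability `Pᵒ_{m'}` of the far user of pair `m` at transmit SNR `ρ`. -/
def Downlink.farOutage [MeasurableSpace Ω] (μ : Measure Ω) (r₀ α ρI a a' R : ℝ) (m : Fin M)
    (ρ : ℝ) : ℝ :=
  μ.real {ω | Real.logb 2 (1 + sinr a a' ρ (S.farChannel U r₀ α m ω)
    (normSq (S.farDetector U m ω) +
      ‖∑ n, star (S.farDetector U m ω n)‖ ^ 2 * S.farInterference r₀ α ρI m ω)) < R}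

/-- The modified outage probability `P̃_{m'}` with parameter `δ`, in which the noise plus
interference power is `2 + 2 δ I_{m'}`. -/
def Downlink.farOutageMod [MeasurableSpace Ω] (μ : Measure Ω) (r₀ α ρI a a' R δ : ℝ) (m : Fin M)
    (ρ : ℝ) : ℝ :=
  μ.real {ω | Real.logb 2 (1 + sinr a a' ρ (S.farChannel U r₀ α m ω)
    (2 + 2 * δ * S.farInterference r₀ α ρI m ω)) < R}

/-- An outage probability `P(ρ)` has diversity order `d` if it is positive at high SNR and
`- log P(ρ) / log ρ → d` as `ρ → ∞`. -/
def HasDiversityOrder (P : ℝ → ℝ) (d : ℝ) : Prop :=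
  (∀ᶠ ρ in atTop, 0 < P ρ) ∧ Tendsto (fun ρ => -Real.log (P ρ) / Real.log ρ) atTop (𝓝 d)

end

end MimoNoma

namespace MimoNoma

/-! ### The complex Gaussian law -/

section Gaussian

/-! Up to the path loss, which is bounded above and below on the disc of radius r, the channel gain
is 1/Z with Z = (G⁻¹G⁻ᴴ)_{m,m}. By Cramer's rule 1/Z = |c·g_m|²/|c|², where c is row m of adj G.
This row consists of cofactors of column m, so it depends only on the other pairs, and everything
reduces to one pair and a fixed vector c ≠ 0. Near 0 the law of |c·g_m|²/|c|² must behave like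
Lebesgue measure, uniformly in c: its negative moments of every order θ < 1 are bounded, and it
gives mass at least of order s to [0, s].

Let K be the two channel matrices of the pair stacked on top of each other, and T(K) the frame U_m
with the sign of its lower half reversed. The columns of T(K) are orthogonal to those of K, and
c·g_m is the contribution of the first N coordinates (`topDot`) to the vanishing Hermitian product
of b = K c̄ and u = T(K)x. The law of (b, u) is unitarily invariant (`IsNullFrame.isInvariantPair`):
almost surely K has full rank, so two frames differ by a unitary change of x, which the uniform law
of x absorbs. The law therefore does not depend on the frame, and K ↦ V T(VᴴK) is again a frame.

Invariance makes the directions of (b, u) a uniform orthonormal pair, independent of the norms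
(`lintegral_invariant_pair`), so functions of the directions may be averaged in any convenient
model. In `gaussPair`, u and z are independent Gaussian vectors and b is z minus its projection onto
u. Given u, `topDot b u` is then a centred complex Gaussian variable of explicit variance, from
which both estimates follow.

Upper bound: outage forces 1 ≤ (κ/ρ) Z w with w the noise plus interference. Markov's inequality for
the power θ < 1, the independence of Z and the interferers, and Campbell's formula give P ≤ C
ρ^(-θ). Lower bound: noise alone causes outage with probability at least c/ρ. Since the noise power
|v_{m'}|² may itself be small, the small-ball estimate is made relative to it. Letting θ tend to 1
gives order exactly one. -/

theorem measurable_complex_mk : Measurable fun p : ℝ × ℝ => (⟨p.1, p.2⟩ : ℂ) :=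
  Complex.measurableEquivRealProd.symm.measurable

instance isProbabilityMeasure_complexGaussian : IsProbabilityMeasure complexGaussian :=
  Measure.isProbabilityMeasure_map measurable_complex_mk.aemeasurable

/-- Each real part has variance 1/2, whence the factor 1/4. Dependence on the modulus of `t` alone
is the source of unitary invariance. -/
theorem integral_exp_complexGaussian (t : ℂ) :
    ∫ z, Complex.exp (((star t * z).re : ℝ) * Complex.I) ∂complexGaussian =
      Complex.exp (-((‖t‖ ^ 2 : ℝ) : ℂ) / 4) := by
  have hc (s : ℝ) : ∫ x : ℝ, Complex.exp ((s * x : ℝ) * Complex.I) ∂gaussianReal 0 2⁻¹ =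
      Complex.exp (-((s ^ 2 : ℝ) : ℂ) / 4) := by
    have h := charFun_gaussianReal (μ := 0) (v := 2⁻¹) s
    rw [charFun_apply_real] at h
    push_cast at h ⊢
    rw [h]
    congr 1
    simp
    ring
  rw [complexGaussian, integral_map measurable_complex_mk.aemeasurable]
  · have : ∀ p : ℝ × ℝ, Complex.exp (((star t * (⟨p.1, p.2⟩ : ℂ)).re : ℝ) * Complex.I) =
        Complex.exp ((t.re * p.1 : ℝ) * Complex.I) *
          Complex.exp ((t.im * p.2 : ℝ) * Complex.I) := by
      intro p
      rw [← Complex.exp_add]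
      congr 1
      simp
      ring
    simp_rw [this]
    rw [integral_prod_mul (fun x : ℝ => Complex.exp ((t.re * x : ℝ) * Complex.I))
      (fun x : ℝ => Complex.exp ((t.im * x : ℝ) * Complex.I)), hc, hc, ← Complex.exp_add]
    congr 1
    rw [← Complex.normSq_eq_norm_sq, Complex.normSq_apply]
    push_cast
    ring
  · refine Continuous.aestronglyMeasurable ?_
    fun_prop

/-- A matrix with i.i.d. standard complex Gaussian entries. -/
noncomputable def gaussMat (ι κ : Type*) [Fintype ι] [Fintype κ] : Measure (Matrix ι κ ℂ) :=
  Measure.pi fun _ : ι => Measure.pi fun _ : κ => complexGaussian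

/-- A vector with i.i.d. standard complex Gaussian entries. -/
noncomputable def gaussVec (ι : Type*) [Fintype ι] : Measure (ι → ℂ) :=
  Measure.pi fun _ : ι => complexGaussian

variable {ι κ : Type*} [Fintype ι] [Fintype κ]

instance isProbabilityMeasure_gaussMat : IsProbabilityMeasure (gaussMat ι κ) :=
  inferInstanceAs (IsProbabilityMeasure (Measure.pi fun _ : ι => Measure.pi fun _ : κ => _))

instance isProbabilityMeasure_gaussVec : IsProbabilityMeasure (gaussVec ι) :=
  inferInstanceAs (IsProbabilityMeasure (Measure.pi fun _ : ι => _))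

instance borelSpace_matrix : BorelSpace (Matrix ι κ ℂ) :=
  inferInstanceAs (BorelSpace (ι → κ → ℂ))

instance secondCountableTopology_matrix : SecondCountableTopology (Matrix ι κ ℂ) :=
  inferInstanceAs (SecondCountableTopology (ι → κ → ℂ))

/-- The real part of the trace is the real inner product of the entries, so the integral factorizes.
The form tr(TᴴT) shows the invariance under T ↦ VᴴT. -/
theorem integral_exp_gaussMat (T : Matrix ι κ ℂ) :
    ∫ K, Complex.exp ((((Tᴴ * K).trace).re : ℝ) * Complex.I) ∂gaussMat ι κ =
      Complex.exp (-((((Tᴴ * T).trace).re : ℝ) : ℂ) / 4) := by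
  have h (K : Matrix ι κ ℂ) : ((Tᴴ * K).trace).re = ∑ i, ∑ j, (star (T i j) * K i j).re := by
    simp only [Matrix.trace, Matrix.diag, Matrix.mul_apply, Matrix.conjTranspose_apply,
      Complex.re_sum]
    exact Finset.sum_comm
  have hT : ((Tᴴ * T).trace).re = ∑ i, ∑ j, ‖T i j‖ ^ 2 := by
    rw [h]
    refine Finset.sum_congr rfl fun i _ => Finset.sum_congr rfl fun j _ => ?_
    rw [← Complex.normSq_eq_norm_sq, Complex.normSq_apply]
    simp
  rw [hT]
  simp_rw [h]
  have h' (K : Matrix ι κ ℂ) :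
      Complex.exp (((∑ i, ∑ j, (star (T i j) * K i j).re : ℝ) : ℂ) * Complex.I) =
        ∏ i, ∏ j, Complex.exp (((star (T i j) * K i j).re : ℝ) * Complex.I) := by
    simp_rw [← Complex.exp_sum]
    congr 1
    push_cast
    simp_rw [Finset.sum_mul]
  simp_rw [h']
  rw [gaussMat]
  refine (integral_fintype_prod_eq_prod (μ := fun _ : ι => Measure.pi fun _ : κ => complexGaussian)
    (fun i (K : κ → ℂ) => ∏ j, Complex.exp (((star (T i j) * K j).re : ℝ) * Complex.I))).trans ?_
  have h'' (i : ι) := integral_fintype_prod_eq_prod (μ := fun _ : κ => complexGaussian)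
    (fun j (z : ℂ) => Complex.exp (((star (T i j) * z).re : ℝ) * Complex.I))
  simp_rw [integral_exp_complexGaussian] at h''
  rw [Finset.prod_congr rfl fun i _ => h'' i]
  simp_rw [← Complex.exp_sum]
  congr 1
  push_cast
  simp_rw [← Finset.sum_neg_distrib, Finset.sum_div]

/-- Characteristic functions test against real-linear functionals. The real and imaginary parts of
the entries of T are the values of L on the unit matrices and on their multiples by i. -/
theorem exists_trace_eq_dual [DecidableEq ι] [DecidableEq κ] (L : StrongDual ℝ (ι → κ → ℂ)) :
    ∃ T : Matrix ι κ ℂ, ∀ K : Matrix ι κ ℂ, L K = ((Tᴴ * K).trace).re := by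
  refine ⟨Matrix.of fun i j => ⟨L (Pi.single i (Pi.single j 1)),
    L (Pi.single i (Pi.single j Complex.I))⟩, fun K => ?_⟩
  have hK : K = ∑ i, ∑ j, ((K i j).re • (Pi.single i (Pi.single j 1) : ι → κ → ℂ) +
      (K i j).im • (Pi.single i (Pi.single j Complex.I) : ι → κ → ℂ)) := by
    ext i j
    simp only [Finset.sum_apply, Pi.add_apply, Pi.smul_apply]
    rw [Finset.sum_eq_single i, Finset.sum_eq_single j]
    · simp [Complex.re_add_im]
    · intro b _ hb; simp [hb.symm]
    · simp
    · intro b _ hb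
      refine Finset.sum_eq_zero fun c _ => ?_
      simp [hb.symm]
    · simp
  conv_lhs => rw [hK]
  simp only [map_sum, map_add, map_smul, smul_eq_mul, Matrix.trace, Matrix.diag, Matrix.mul_apply,
    Matrix.conjTranspose_apply, Complex.re_sum, Matrix.of_apply]
  rw [Finset.sum_comm]
  refine Finset.sum_congr rfl fun i _ => Finset.sum_congr rfl fun j _ => ?_
  simp
  ring

/-- Left multiplication by a unitary matrix preserves the Gaussian law of a matrix. -/
theorem measurePreserving_unitary_gaussMat [DecidableEq ι] [DecidableEq κ]
    (V : Matrix.unitaryGroup ι ℂ) :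
    MeasurePreserving (fun K : Matrix ι κ ℂ => (V : Matrix ι ι ℂ) * K)
      (gaussMat ι κ) (gaussMat ι κ) := by
  have hm : Measurable (fun K : Matrix ι κ ℂ => (V : Matrix ι ι ℂ) * K) :=
    (by fun_prop : Continuous (fun K : Matrix ι κ ℂ => (V : Matrix ι ι ℂ) * K)).measurable
  refine ⟨hm, ?_⟩
  let P : Measure (ι → κ → ℂ) := Measure.pi fun _ : ι => Measure.pi fun _ : κ => complexGaussian
  let f : (ι → κ → ℂ) → ι → κ → ℂ := fun K => (V : Matrix ι ι ℂ) * Matrix.of K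
  have hf : Measurable f := hm
  have hP : IsProbabilityMeasure P := inferInstance
  have := Measure.isProbabilityMeasure_map (μ := P) hf.aemeasurable
  have key : P.map f = P := by
    refine Measure.ext_of_charFunDual ?_
    ext L
    obtain ⟨T, hT⟩ := exists_trace_eq_dual L
    rw [charFunDual_apply, charFunDual_apply, integral_map hf.aemeasurable (by fun_prop)]
    have e1 : ∫ K, Complex.exp (((L K : ℝ) : ℂ) * Complex.I) ∂P =
        Complex.exp (-((((Tᴴ * T).trace).re : ℝ) : ℂ) / 4) := by
      rw [← integral_exp_gaussMat T]
      exact integral_congr_ae (ae_of_all _ fun K =>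
        congrArg (fun r : ℝ => Complex.exp (r * Complex.I)) (hT K))
    rw [e1]
    -- Testing V K against T amounts to testing K against VᴴT, and (VᴴT)ᴴ(VᴴT) = TᴴT.
    have h := integral_exp_gaussMat ((V : Matrix ι ι ℂ)ᴴ * T)
    have hV : (V : Matrix ι ι ℂ) * (V : Matrix ι ι ℂ)ᴴ = 1 := Matrix.mem_unitaryGroup_iff.1 V.2
    rw [Matrix.conjTranspose_mul, Matrix.conjTranspose_conjTranspose, Matrix.mul_assoc,
      ← Matrix.mul_assoc (V : Matrix ι ι ℂ), hV, Matrix.one_mul] at h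
    rw [← h]
    refine integral_congr_ae (ae_of_all _ fun K =>
      congrArg (fun r : ℝ => Complex.exp (r * Complex.I)) ((hT _).trans ?_))
    rw [← Matrix.mul_assoc]
    rfl
  exact key

theorem measurePreserving_col_gaussMat (j : κ) :
    MeasurePreserving (fun (K : Matrix ι κ ℂ) i => K i j) (gaussMat ι κ) (gaussVec ι) :=
  measurePreserving_pi (fun _ : ι => Measure.pi fun _ : κ => complexGaussian) _
    fun _ => measurePreserving_eval (fun _ : κ => complexGaussian) j

theorem measurePreserving_unitary_gaussVec [DecidableEq ι] (V : Matrix.unitaryGroup ι ℂ) :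
    MeasurePreserving (fun z : ι → ℂ => (V : Matrix ι ι ℂ) *ᵥ z) (gaussVec ι) (gaussVec ι) := by
  have h := measurePreserving_col_gaussMat (ι := ι) (κ := Unit) ()
  have h2 := h.comp (measurePreserving_unitary_gaussMat (κ := Unit) V)
  refine ⟨(by fun_prop : Continuous (fun z : ι → ℂ => (V : Matrix ι ι ℂ) *ᵥ z)).measurable, ?_⟩
  conv_lhs => rw [← h.map_eq]
  rw [Measure.map_map (by fun_prop : Continuous (fun z : ι → ℂ => (V : Matrix ι ι ℂ) *ᵥ z)).measurable
    h.measurable]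
  exact h2.map_eq

/-- The density is bounded and |x|^(-θ) is integrable near 0 for θ < 1; outside [-1, 1] the
integrand is at most 1. -/
theorem lintegral_abs_rpow_neg_gaussianReal_lt_top {θ : ℝ} (h0 : 0 < θ) (h1 : θ < 1) :
    ∫⁻ x, ENNReal.ofReal |x| ^ (-θ) ∂gaussianReal 0 2⁻¹ < ∞ := by
  have hmeas : Measurable fun x : ℝ => ENNReal.ofReal |x| ^ (-θ) := by fun_prop
  have hIoc : ∫⁻ x in Set.Ioc (0 : ℝ) 1, ENNReal.ofReal |x| ^ (-θ) < ∞ := by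
    have hi : IntegrableOn (fun x : ℝ => x ^ (-θ)) (Set.Ioc 0 1) := by
      have := intervalIntegral.intervalIntegrable_rpow' (a := 0) (b := 1) (r := -θ) (by linarith)
      rwa [intervalIntegrable_iff_integrableOn_Ioc_of_le zero_le_one] at this
    refine lt_of_le_of_lt (le_of_eq ?_) hi.lintegral_lt_top
    refine setLIntegral_congr_fun measurableSet_Ioc fun x hx => ?_
    rw [abs_of_pos hx.1, ENNReal.ofReal_rpow_of_pos hx.1]
  have hIco : ∫⁻ x in Set.Ico (-1 : ℝ) 0, ENNReal.ofReal |x| ^ (-θ) < ∞ := by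
    have := (Measure.measurePreserving_neg (volume : Measure ℝ)).setLIntegral_comp_preimage
      (s := Set.Ioc 0 1) measurableSet_Ioc hmeas
    rw [show Neg.neg ⁻¹' Set.Ioc (0 : ℝ) 1 = Set.Ico (-1) 0 by ext x; simp] at this
    simp only [abs_neg] at this
    rwa [this]
  have hIcc : ∫⁻ x in Set.Icc (-1 : ℝ) 1, ENNReal.ofReal |x| ^ (-θ) < ∞ := by
    -- The origin, where the integrand is ∞, is split off as a null set.
    have hsub : Set.Icc (-1 : ℝ) 1 ⊆ (Set.Ico (-1) 0 ∪ Set.Ioc 0 1) ∪ {0} := by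
      intro x hx
      rcases lt_trichotomy x 0 with h | h | h
      · exact Or.inl (Or.inl ⟨hx.1, h⟩)
      · exact Or.inr h
      · exact Or.inl (Or.inr ⟨h, hx.2⟩)
    calc _ ≤ _ := lintegral_mono_set hsub
      _ ≤ _ := lintegral_union_le _ _ _
      _ ≤ _ := add_le_add_left (lintegral_union_le _ _ _) _
      _ < ∞ := by simp [hIoc, hIco]
  have hv : (2⁻¹ : ℝ≥0) ≠ 0 := by simp
  set c : ℝ := (√(2 * Real.pi * (2⁻¹ : ℝ≥0)))⁻¹ with hc
  have hpdf (x : ℝ) : gaussianPDF 0 2⁻¹ x ≤ ENNReal.ofReal c := by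
    refine ENNReal.ofReal_le_ofReal ?_
    rw [gaussianPDFReal]
    refine mul_le_of_le_one_right (by positivity) (Real.exp_le_one_iff.2 ?_)
    have : 0 ≤ (x - 0) ^ 2 / (2 * ((2⁻¹ : ℝ≥0) : ℝ)) := by positivity
    rw [neg_div]
    linarith
  have hle (x : ℝ) : ENNReal.ofReal |x| ^ (-θ) ≤
      1 + (Set.Icc (-1) 1).indicator (fun x : ℝ => ENNReal.ofReal |x| ^ (-θ)) x := by
    by_cases hx : x ∈ Set.Icc (-1 : ℝ) 1
    · rw [Set.indicator_of_mem hx]; exact le_add_self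
    · rw [Set.indicator_of_notMem hx, add_zero]
      refine ENNReal.rpow_le_one_of_one_le_of_neg ?_ (by linarith)
      rw [ENNReal.one_le_ofReal]
      by_contra h
      exact hx (abs_le.1 (not_le.1 h).le)
  calc _ ≤ _ := lintegral_mono hle
    _ = 1 + ∫⁻ x in Set.Icc (-1) 1, ENNReal.ofReal |x| ^ (-θ) ∂gaussianReal 0 2⁻¹ := by
      rw [lintegral_add_left measurable_const, lintegral_indicator measurableSet_Icc]; simp
    _ ≤ 1 + ENNReal.ofReal c * ∫⁻ x in Set.Icc (-1) 1, ENNReal.ofReal |x| ^ (-θ) := by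
      gcongr
      rw [gaussianReal_of_var_ne_zero _ hv, restrict_withDensity measurableSet_Icc,
        lintegral_withDensity_eq_lintegral_mul _ (measurable_gaussianPDF _ _) hmeas,
        ← lintegral_const_mul _ hmeas]
      exact lintegral_mono fun x => mul_le_mul_left (hpdf x) _
    _ < ∞ := by
      refine ENNReal.add_lt_top.2 ⟨by simp, ENNReal.mul_lt_top (by simp) hIcc⟩

/-- Negative moments of a standard complex Gaussian variable. -/
theorem lintegral_norm_sq_rpow_neg_complexGaussian_lt_top {θ : ℝ} (h0 : 0 < θ) (h1 : θ < 1) :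
    ∫⁻ z, ENNReal.ofReal (‖z‖ ^ 2) ^ (-θ) ∂complexGaussian < ∞ := by
  rw [complexGaussian, lintegral_map (by fun_prop) measurable_complex_mk]
  -- Since |z|² ≥ |Re z| |Im z|, the plane integral is dominated by a product of two integrals over
  -- the line with the same exponent θ.
  have hle (p : ℝ × ℝ) : ENNReal.ofReal (‖(⟨p.1, p.2⟩ : ℂ)‖ ^ 2) ^ (-θ) ≤
      ENNReal.ofReal |p.1| ^ (-θ) * ENNReal.ofReal |p.2| ^ (-θ) := by
    rw [← ENNReal.mul_rpow_of_ne_top ENNReal.ofReal_ne_top ENNReal.ofReal_ne_top,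
      ← ENNReal.ofReal_mul (abs_nonneg _), ENNReal.rpow_neg, ENNReal.rpow_neg]
    refine ENNReal.inv_le_inv.2 (ENNReal.rpow_le_rpow (ENNReal.ofReal_le_ofReal ?_) h0.le)
    rw [← Complex.normSq_eq_norm_sq, Complex.normSq_apply]
    simp only
    nlinarith [sq_nonneg (|p.1| - |p.2|), sq_abs p.1, sq_abs p.2, abs_nonneg p.1, abs_nonneg p.2,
      mul_nonneg (abs_nonneg p.1) (abs_nonneg p.2)]
  refine lt_of_le_of_lt (lintegral_mono hle) ?_
  rw [lintegral_prod_mul (f := fun x : ℝ => ENNReal.ofReal |x| ^ (-θ))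
    (g := fun x : ℝ => ENNReal.ofReal |x| ^ (-θ)) (by fun_prop) (by fun_prop)]
  have := lintegral_abs_rpow_neg_gaussianReal_lt_top h0 h1
  exact ENNReal.mul_lt_top this this

/-- On [-1, 1] the density is at least its value at 0 times exp(-1). -/
theorem exists_le_gaussianReal_Ioo :
    ∃ c : ℝ, 0 < c ∧ ∀ t : ℝ, 0 < t → t ≤ 1 →
      ENNReal.ofReal (c * t) ≤ gaussianReal 0 2⁻¹ (Set.Ioo (-t) t) := by
  have hv : (2⁻¹ : ℝ≥0) ≠ 0 := by simp
  have hπ : (0 : ℝ) < √(2 * Real.pi * (2⁻¹ : ℝ≥0)) := by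
    have := Real.pi_pos
    positivity
  refine ⟨(√(2 * Real.pi * (2⁻¹ : ℝ≥0)))⁻¹ * Real.exp (-1), by positivity, fun t ht0 ht1 => ?_⟩
  rw [gaussianReal_apply _ hv]
  calc _ ≤ ENNReal.ofReal ((√(2 * Real.pi * (2⁻¹ : ℝ≥0)))⁻¹ * Real.exp (-1)) *
        volume (Set.Ioo (-t) t) := by
        rw [Real.volume_Ioo, ← ENNReal.ofReal_mul (by positivity)]
        refine ENNReal.ofReal_le_ofReal (mul_le_mul_of_nonneg_left (by linarith) (by positivity))
    _ = ∫⁻ _ in Set.Ioo (-t) t,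
        ENNReal.ofReal ((√(2 * Real.pi * (2⁻¹ : ℝ≥0)))⁻¹ * Real.exp (-1)) := by
        rw [setLIntegral_const]
    _ ≤ _ := by
        refine setLIntegral_mono (measurable_gaussianPDF _ _) fun x hx => ?_
        refine ENNReal.ofReal_le_ofReal ?_
        rw [gaussianPDFReal]
        gcongr
        have : x ^ 2 ≤ 1 := by
          have := abs_lt.2 hx
          rw [← sq_abs]
          nlinarith [abs_nonneg x]
        simp only [sub_zero, NNReal.coe_inv, NNReal.coe_ofNat]
        linarith

/-- Small discs have probability at least linear in their area. -/
theorem exists_le_complexGaussian_norm_sq_lt :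
    ∃ c : ℝ, 0 < c ∧ ∀ s : ℝ, 0 < s → s ≤ 1 →
      ENNReal.ofReal (c * s) ≤ complexGaussian {z | ‖z‖ ^ 2 < s} := by
  obtain ⟨c, hc, h⟩ := exists_le_gaussianReal_Ioo
  refine ⟨c ^ 2 / 4, by positivity, fun s hs hs1 => ?_⟩
  have hs2 : √s ^ 2 = s := Real.sq_sqrt hs.le
  have hsp : 0 < √s := Real.sqrt_pos.2 hs
  have hs1' : √s ≤ 1 := Real.sqrt_le_one.2 hs1
  -- The square with half-side √s/2 lies in the disc, and its probability is a product; this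
  -- produces the constant c²/4.
  have ht := h (√s / 2) (by positivity) (by linarith)
  rw [complexGaussian, Measure.map_apply measurable_complex_mk
    (measurableSet_lt (by fun_prop) measurable_const)]
  calc _ = ENNReal.ofReal (c * (√s / 2)) * ENNReal.ofReal (c * (√s / 2)) := by
        rw [← ENNReal.ofReal_mul (by positivity)]
        congr 1
        linear_combination (-(c ^ 2) / 4) * hs2
    _ ≤ _ := mul_le_mul' ht ht
    _ = _ := (Measure.prod_prod _ _).symm
    _ ≤ _ := by
        refine measure_mono fun p hp => ?_
        have h1 := abs_lt.2 hp.1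
        have h2 := abs_lt.2 hp.2
        simp only [Set.mem_preimage, Set.mem_ofPred_eq]
        rw [← Complex.normSq_eq_norm_sq, Complex.normSq_apply]
        simp only
        nlinarith [sq_abs p.1, sq_abs p.2, abs_nonneg p.1, abs_nonneg p.2]

theorem complexGaussian_one_le_norm_sq_pos : 0 < complexGaussian {z | 1 ≤ ‖z‖ ^ 2} := by
  have hv : (2⁻¹ : ℝ≥0) ≠ 0 := by simp
  have h1 : gaussianReal 0 2⁻¹ (Set.Ioo 1 2) ≠ 0 := by
    intro h
    have := gaussianReal_absolutelyContinuous' 0 hv h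
    norm_num [Real.volume_Ioo] at this
  rw [complexGaussian, Measure.map_apply measurable_complex_mk
    (measurableSet_le measurable_const (by fun_prop))]
  refine lt_of_lt_of_le (pos_iff_ne_zero.2 ?_) (measure_mono (s := Set.Ioo 1 2 ×ˢ Set.univ) ?_)
  · rw [Measure.prod_prod]
    simp [h1]
  · intro p hp
    simp only [Set.mem_preimage, Set.mem_ofPred_eq]
    rw [← Complex.normSq_eq_norm_sq, Complex.normSq_apply]
    have := hp.1.1
    simp only
    nlinarith [mul_self_nonneg p.2]

end Gaussian

/-! ### Hermitian geometry of complex vectors -/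

section Hermitian

variable {ι κ : Type*} [Fintype ι] [Fintype κ]

theorem normSq_nonneg (v : ι → ℂ) : 0 ≤ normSq v :=
  Finset.sum_nonneg fun _ _ => sq_nonneg _

theorem normSq_eq_zero {v : ι → ℂ} : normSq v = 0 ↔ v = 0 := by
  rw [normSq, Finset.sum_eq_zero_iff_of_nonneg fun _ _ => sq_nonneg _]
  simp [funext_iff]

theorem normSq_pos {v : ι → ℂ} (h : v ≠ 0) : 0 < normSq v :=
  (normSq_nonneg v).lt_of_ne fun h0 => h (normSq_eq_zero.1 h0.symm)

theorem norm_sq_le_normSq (v : ι → ℂ) (i : ι) : ‖v i‖ ^ 2 ≤ normSq v :=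
  Finset.single_le_sum (f := fun i => ‖v i‖ ^ 2) (fun _ _ => sq_nonneg _) (Finset.mem_univ i)

theorem star_dotProduct_self (v : ι → ℂ) : star v ⬝ᵥ v = (normSq v : ℂ) := by
  rw [normSq, dotProduct]
  push_cast
  exact Finset.sum_congr rfl fun i _ => Complex.conj_mul' (v i)

theorem star_dotProduct_comm (v w : ι → ℂ) : star v ⬝ᵥ w = star (star w ⬝ᵥ v) := by
  rw [Matrix.star_dotProduct]

theorem normSq_smul (c : ℂ) (v : ι → ℂ) : normSq (c • v) = ‖c‖ ^ 2 * normSq v := by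
  simp [normSq, mul_pow, Finset.mul_sum]

theorem normSq_star (v : ι → ℂ) : normSq (star v) = normSq v := by
  simp [normSq]

/-- The Cauchy–Schwarz inequality. -/
theorem norm_sq_star_dotProduct_le (v w : ι → ℂ) :
    ‖star v ⬝ᵥ w‖ ^ 2 ≤ normSq v * normSq w := by
  have h := Finset.sum_mul_sq_le_sq_mul_sq Finset.univ (fun i => ‖v i‖) (fun i => ‖w i‖)
  refine le_trans ?_ h
  gcongr
  refine (norm_sum_le _ _).trans (Finset.sum_le_sum fun i _ => ?_)
  simp

theorem star_mulVec_dotProduct_mulVec [DecidableEq κ] {T : Matrix ι κ ℂ} (hT : Tᴴ * T = 1)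
    (x y : κ → ℂ) : star (T *ᵥ x) ⬝ᵥ (T *ᵥ y) = star x ⬝ᵥ y := by
  rw [Matrix.star_mulVec, ← Matrix.dotProduct_mulVec, Matrix.mulVec_mulVec, hT, Matrix.one_mulVec]

theorem normSq_mulVec [DecidableEq κ] {T : Matrix ι κ ℂ} (hT : Tᴴ * T = 1) (x : κ → ℂ) :
    normSq (T *ᵥ x) = normSq x := by
  have := star_mulVec_dotProduct_mulVec hT x x
  rw [star_dotProduct_self, star_dotProduct_self] at this
  exact_mod_cast this

theorem unitary_conjTranspose_mul [DecidableEq ι] (V : Matrix.unitaryGroup ι ℂ) :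
    (V : Matrix ι ι ℂ)ᴴ * (V : Matrix ι ι ℂ) = 1 := Matrix.mem_unitaryGroup_iff'.1 V.2

theorem measurable_normSq : Measurable (normSq : (ι → ℂ) → ℝ) := by
  unfold normSq
  fun_prop

/-- An orthonormal family extends to the columns of a unitary matrix. -/
theorem exists_unitary_mulVec_single [DecidableEq ι] (v : ι → ι → ℂ) (s : Set ι)
    (hv : ∀ i ∈ s, ∀ j ∈ s, star (v i) ⬝ᵥ v j = if i = j then 1 else 0) :
    ∃ V : Matrix.unitaryGroup ι ℂ, ∀ i ∈ s, (V : Matrix ι ι ℂ) *ᵥ Pi.single i 1 = v i := by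
  have hv' : Orthonormal ℂ (s.domRestrict fun i => WithLp.toLp 2 (v i)) := by
    rw [orthonormal_iff_ite]
    intro i j
    have h : inner ℂ (WithLp.toLp 2 (v i)) (WithLp.toLp 2 (v j)) = star (v i) ⬝ᵥ v j := by
      rw [EuclideanSpace.inner_toLp_toLp, dotProduct_comm]
    refine h.trans ((hv i i.2 j j.2).trans ?_)
    simp [Subtype.ext_iff]
  obtain ⟨b, hb⟩ := hv'.exists_orthonormalBasis_extension_of_card_eq (by simp)
  let W : Matrix ι ι ℂ := Matrix.of fun k l => b l k
  have hW : Wᴴ * W = 1 := by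
    ext k l
    have := orthonormal_iff_ite.1 b.orthonormal k l
    rw [Matrix.one_apply, ← this, PiLp.inner_apply]
    simp [Matrix.mul_apply, W, mul_comm]
  refine ⟨⟨W, Matrix.mem_unitaryGroup_iff'.2 hW⟩, fun i hi => ?_⟩
  ext k
  simp [W, hb i hi]

/-- The unitary group acts transitively on orthonormal pairs. -/
theorem exists_unitary_mulVec_pair [DecidableEq ι] {i j : ι} (hij : i ≠ j) {e f : ι → ℂ}
    (he : normSq e = 1) (hf : normSq f = 1) (hef : star e ⬝ᵥ f = 0) :
    ∃ V : Matrix.unitaryGroup ι ℂ,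
      (V : Matrix ι ι ℂ) *ᵥ Pi.single i 1 = e ∧ (V : Matrix ι ι ℂ) *ᵥ Pi.single j 1 = f := by
  have hfe : star f ⬝ᵥ e = 0 := by rw [star_dotProduct_comm, hef, star_zero]
  have hee : star e ⬝ᵥ e = 1 := by rw [star_dotProduct_self, he, Complex.ofReal_one]
  have hff : star f ⬝ᵥ f = 1 := by rw [star_dotProduct_self, hf, Complex.ofReal_one]
  obtain ⟨V, hV⟩ := exists_unitary_mulVec_single (fun l => if l = i then e else f) {i, j} (by
    rintro k (rfl | rfl) l (rfl | rfl) <;> simp [hij, hij.symm, hee, hff, hef, hfe])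
  exact ⟨V, by simpa using hV i (by simp), by simpa [hij.symm] using hV j (by simp)⟩

theorem normSq_normalize {v : ι → ℂ} (hv : v ≠ 0) :
    normSq ((((√(normSq v))⁻¹ : ℝ) : ℂ) • v) = 1 := by
  have h := normSq_pos hv
  rw [normSq_smul, Complex.norm_real, Real.norm_eq_abs, sq_abs, inv_pow, Real.sq_sqrt h.le,
    inv_mul_cancel₀ h.ne']

end Hermitian

/-! ### Averaging over the unitary group -/

section Haar

variable {ι : Type*} [Fintype ι] [DecidableEq ι]

instance compactSpace_unitaryGroup : CompactSpace (Matrix.unitaryGroup ι ℂ) := by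
  have hc : IsCompact (Set.univ.pi fun _ : ι => Set.univ.pi fun _ : ι =>
      Metric.closedBall (0 : ℂ) 1) :=
    isCompact_univ_pi fun _ => isCompact_univ_pi fun _ => isCompact_closedBall _ _
  have hc' : IsCompact {A : Matrix ι ι ℂ | ∀ i j, ‖A i j‖ ≤ 1} := by
    have hs : {A : ι → ι → ℂ | ∀ i j, ‖A i j‖ ≤ 1} = Set.univ.pi fun _ : ι =>
        Set.univ.pi fun _ : ι => Metric.closedBall (0 : ℂ) 1 := by
      ext A
      simp [Set.mem_pi]
    rw [← hs] at hc
    exact hc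
  refine isCompact_iff_compactSpace.1 (hc'.of_isClosed_subset isClosed_unitary ?_)
  exact fun A hA i j => entry_norm_bound_of_unitary hA i j

/-- A right-invariant probability measure on the unitary group. -/
noncomputable def unitaryHaar (ι : Type*) [Fintype ι] [DecidableEq ι] :
    Measure (Matrix.unitaryGroup ι ℂ) :=
  (Measure.haarMeasure (⊤ : TopologicalSpace.PositiveCompacts (Matrix.unitaryGroup ι ℂ))).inv

instance isMulRightInvariant_unitaryHaar : (unitaryHaar ι).IsMulRightInvariant :=
  inferInstanceAs (Measure.inv _).IsMulRightInvariant

instance isProbabilityMeasure_unitaryHaar : IsProbabilityMeasure (unitaryHaar ι) := by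
  constructor
  rw [unitaryHaar, Measure.inv_apply, Set.inv_univ]
  exact Measure.haarMeasure_self

theorem measurable_unitary_mulVec_pair :
    Measurable fun p : Matrix.unitaryGroup ι ℂ × ((ι → ℂ) × (ι → ℂ)) =>
      ((p.1 : Matrix ι ι ℂ) *ᵥ p.2.1, (p.1 : Matrix ι ι ℂ) *ᵥ p.2.2) := by
  have hA : Continuous fun p : Matrix.unitaryGroup ι ℂ × ((ι → ℂ) × (ι → ℂ)) =>
      (p.1 : Matrix ι ι ℂ) := by fun_prop
  have h : Continuous fun p : Matrix.unitaryGroup ι ℂ × ((ι → ℂ) × (ι → ℂ)) =>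
      ((p.1 : Matrix ι ι ℂ) *ᵥ p.2.1, (p.1 : Matrix ι ι ℂ) *ᵥ p.2.2) :=
    (hA.matrix_mulVec (by fun_prop)).prodMk (hA.matrix_mulVec (by fun_prop))
  exact h.measurable

/-- The average of `F` over the orthonormal pairs. -/
noncomputable def pairAverage (i j : ι) (F : (ι → ℂ) × (ι → ℂ) → ℝ≥0∞) : ℝ≥0∞ :=
  ∫⁻ V : Matrix.unitaryGroup ι ℂ, F ((V : Matrix ι ι ℂ) *ᵥ Pi.single i 1,
    (V : Matrix ι ι ℂ) *ᵥ Pi.single j 1) ∂unitaryHaar ι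

/-- The normalized pair is the image of a standard one under some unitary W. Homogeneity of F
removes the norms, and right invariance of the measure absorbs W; this is why `unitaryHaar` is the
inverse of the left Haar measure. -/
theorem lintegral_unitary_orthogonal_pair {i j : ι} (hij : i ≠ j)
    {F : (ι → ℂ) × (ι → ℂ) → ℝ≥0∞}
    (hF : ∀ (s t : ℝ) (b u : ι → ℂ), 0 < s → 0 < t → F ((s : ℂ) • b, (t : ℂ) • u) = F (b, u))
    {b u : ι → ℂ} (hb : b ≠ 0) (hu : u ≠ 0) (hbu : star b ⬝ᵥ u = 0) :
    ∫⁻ V : Matrix.unitaryGroup ι ℂ, F ((V : Matrix ι ι ℂ) *ᵥ b, (V : Matrix ι ι ℂ) *ᵥ u)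
      ∂unitaryHaar ι = pairAverage i j F := by
  have hsb : 0 < (√(normSq b))⁻¹ := inv_pos.2 (Real.sqrt_pos.2 (normSq_pos hb))
  have hsu : 0 < (√(normSq u))⁻¹ := inv_pos.2 (Real.sqrt_pos.2 (normSq_pos hu))
  obtain ⟨W, hWb, hWu⟩ := exists_unitary_mulVec_pair hij (normSq_normalize hb) (normSq_normalize hu) (by
    rw [star_smul, smul_dotProduct, dotProduct_smul, hbu]; simp)
  rw [pairAverage, ← lintegral_mul_right_eq_self (fun V : Matrix.unitaryGroup ι ℂ =>
    F ((V : Matrix ι ι ℂ) *ᵥ Pi.single i 1, (V : Matrix ι ι ℂ) *ᵥ Pi.single j 1)) W]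
  refine lintegral_congr fun V => ?_
  rw [← hF _ _ (_ *ᵥ b) _ hsb hsu, ← Matrix.mulVec_smul, ← Matrix.mulVec_smul, ← hWb, ← hWu,
    Matrix.mulVec_mulVec, Matrix.mulVec_mulVec]
  rfl

/-- Under a unitarily invariant law on pairs of orthogonal vectors, the norms are independent of
the directions, and the law of the directions does not depend on the law. -/
theorem lintegral_invariant_pair {i j : ι} (hij : i ≠ j) (ν : Measure ((ι → ℂ) × (ι → ℂ)))
    [SFinite ν]
    (hinv : ∀ V : Matrix.unitaryGroup ι ℂ, MeasurePreserving (fun q : (ι → ℂ) × (ι → ℂ) =>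
      ((V : Matrix ι ι ℂ) *ᵥ q.1, (V : Matrix ι ι ℂ) *ᵥ q.2)) ν ν)
    (horth : ∀ᵐ q ∂ν, star q.1 ⬝ᵥ q.2 = 0) (hne : ∀ᵐ q ∂ν, q.1 ≠ 0 ∧ q.2 ≠ 0)
    {F : (ι → ℂ) × (ι → ℂ) → ℝ≥0∞} (hFm : Measurable F)
    (hF : ∀ (s t : ℝ) (b u : ι → ℂ), 0 < s → 0 < t → F ((s : ℂ) • b, (t : ℂ) • u) = F (b, u))
    {H : ℝ × ℝ → ℝ≥0∞} (hH : Measurable H) :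
    ∫⁻ q, H (normSq q.1, normSq q.2) * F q ∂ν =
      (∫⁻ q, H (normSq q.1, normSq q.2) ∂ν) * pairAverage i j F := by
  have hHm : Measurable fun q : (ι → ℂ) × (ι → ℂ) => H (normSq q.1, normSq q.2) :=
    hH.comp ((measurable_normSq.comp measurable_fst).prodMk (measurable_normSq.comp measurable_snd))
  have hmm : Measurable fun p : Matrix.unitaryGroup ι ℂ × ((ι → ℂ) × (ι → ℂ)) =>
      H (normSq p.2.1, normSq p.2.2) *
        F ((p.1 : Matrix ι ι ℂ) *ᵥ p.2.1, (p.1 : Matrix ι ι ℂ) *ᵥ p.2.2) :=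
    (hHm.comp measurable_snd).mul (hFm.comp measurable_unitary_mulVec_pair)
  have h1 (V : Matrix.unitaryGroup ι ℂ) :
      ∫⁻ q, H (normSq q.1, normSq q.2) * F q ∂ν = ∫⁻ q, H (normSq q.1, normSq q.2) *
        F ((V : Matrix ι ι ℂ) *ᵥ q.1, (V : Matrix ι ι ℂ) *ᵥ q.2) ∂ν := by
    have := (hinv V).lintegral_comp (hHm.mul hFm)
    simp only [Pi.mul_apply] at this
    rw [← this]
    simp only [normSq_mulVec (unitary_conjTranspose_mul V)]
  -- The integral is averaged over all V and the order of integration exchanged. For fixed q the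
  -- inner average of F is the constant `pairAverage`.
  calc ∫⁻ q, H (normSq q.1, normSq q.2) * F q ∂ν
      = ∫⁻ _V, ∫⁻ q, H (normSq q.1, normSq q.2) * F q ∂ν ∂unitaryHaar ι := by simp
    _ = ∫⁻ V : Matrix.unitaryGroup ι ℂ, ∫⁻ q, H (normSq q.1, normSq q.2) *
        F ((V : Matrix ι ι ℂ) *ᵥ q.1, (V : Matrix ι ι ℂ) *ᵥ q.2) ∂ν ∂unitaryHaar ι :=
        lintegral_congr h1
    _ = ∫⁻ q, ∫⁻ V : Matrix.unitaryGroup ι ℂ, H (normSq q.1, normSq q.2) *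
        F ((V : Matrix ι ι ℂ) *ᵥ q.1, (V : Matrix ι ι ℂ) *ᵥ q.2) ∂unitaryHaar ι ∂ν :=
        lintegral_lintegral_swap hmm.aemeasurable
    _ = ∫⁻ q, H (normSq q.1, normSq q.2) * pairAverage i j F ∂ν := by
        refine lintegral_congr_ae ?_
        filter_upwards [horth, hne] with q hq hq'
        refine (lintegral_const_mul _ (hFm.comp
          (measurable_unitary_mulVec_pair.comp (measurable_id.prodMk measurable_const)))).trans ?_
        congr 1
        exact lintegral_unitary_orthogonal_pair hij hF hq'.1 hq'.2 hq
    _ = _ := lintegral_mul_const _ hHm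

end Haar

/-! ### Linear forms of Gaussian vectors -/

section LinearForm

variable {ι : Type*} [Fintype ι] [DecidableEq ι]

/-- A unitary matrix sending a basis vector to e turns the form into a coordinate of the Gaussian
vector. -/
theorem measurePreserving_star_dotProduct_gaussVec {e : ι → ℂ} (he : normSq e = 1) :
    MeasurePreserving (fun z : ι → ℂ => star e ⬝ᵥ z) (gaussVec ι) complexGaussian := by
  have : Nonempty ι := by
    by_contra h
    rw [not_nonempty_iff] at h
    simp [normSq] at he
  let i : ι := Classical.arbitrary ι
  obtain ⟨V, hV⟩ := exists_unitary_mulVec_single (fun _ => e) {i} (by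
    rintro k rfl l rfl
    simp [star_dotProduct_self, he])
  have hVi := hV i rfl
  have h1 := measurePreserving_unitary_gaussVec V
  have h2 : MeasurePreserving (fun z : ι → ℂ => z i) (gaussVec ι) complexGaussian :=
    measurePreserving_eval (fun _ : ι => complexGaussian) i
  have hm : Measurable fun z : ι → ℂ => star e ⬝ᵥ z := by
    unfold dotProduct
    fun_prop
  refine ⟨hm, ?_⟩
  rw [← h1.map_eq, Measure.map_map hm h1.measurable, ← h2.map_eq]
  congr 1
  ext z
  simp only [Function.comp_apply]
  rw [← hVi, star_mulVec_dotProduct_mulVec (unitary_conjTranspose_mul V)]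
  simp

theorem lintegral_rpow_neg_star_dotProduct_gaussVec {w : ι → ℂ} (hw : w ≠ 0) (θ : ℝ) :
    ∫⁻ z, ENNReal.ofReal (‖star w ⬝ᵥ z‖ ^ 2) ^ (-θ) ∂gaussVec ι =
      ENNReal.ofReal (normSq w) ^ (-θ) *
        ∫⁻ z, ENNReal.ofReal (‖z‖ ^ 2) ^ (-θ) ∂complexGaussian := by
  have h := measurePreserving_star_dotProduct_gaussVec (normSq_normalize hw)
  rw [← h.lintegral_comp (by fun_prop), ← lintegral_const_mul _
    (((h.measurable.norm.pow_const 2).ennreal_ofReal).pow_const _)]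
  refine lintegral_congr fun z => ?_
  rw [← ENNReal.mul_rpow_of_ne_top ENNReal.ofReal_ne_top ENNReal.ofReal_ne_top,
    ← ENNReal.ofReal_mul (normSq_nonneg w)]
  congr 2
  have := normSq_pos hw
  rw [star_smul, smul_dotProduct, norm_smul, mul_pow, ← mul_assoc]
  simp only [RCLike.star_def, Complex.conj_ofReal, Complex.norm_real, Real.norm_eq_abs, sq_abs,
    inv_pow, Real.sq_sqrt this.le]
  rw [mul_inv_cancel₀ this.ne', one_mul]

theorem gaussVec_two_coordinates {i j : ι} (hij : i ≠ j) (A B : Set ℂ) :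
    gaussVec ι {z | z i ∈ A ∧ z j ∈ B} = complexGaussian A * complexGaussian B := by
  have h : {z : ι → ℂ | z i ∈ A ∧ z j ∈ B} =
      Set.univ.pi fun l => if l = i then A else if l = j then B else Set.univ := by
    ext z
    simp only [Set.mem_ofPred_eq, Set.mem_univ_pi]
    constructor
    · rintro ⟨h1, h2⟩ l
      split_ifs with h h'
      · rwa [h]
      · rwa [h']
      · trivial
    · intro h
      exact ⟨by simpa using h i, by simpa [hij.symm] using h j⟩
  rw [h, gaussVec, Measure.pi_pi, Fintype.prod_eq_mul i j hij]
  · simp [hij.symm]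
  · rintro l ⟨h1, h2⟩
    simp [h1, h2]

/-- Orthonormal forms are two coordinates after a unitary change of variables, hence independent. -/
theorem gaussVec_two_linear_forms {i j : ι} (hij : i ≠ j) {e f : ι → ℂ}
    (he : normSq e = 1) (hf : normSq f = 1) (hef : star e ⬝ᵥ f = 0) {A B : Set ℂ}
    (hA : MeasurableSet A) (hB : MeasurableSet B) :
    gaussVec ι {z | star e ⬝ᵥ z ∈ A ∧ star f ⬝ᵥ z ∈ B} =
      complexGaussian A * complexGaussian B := by
  obtain ⟨V, rfl, rfl⟩ := exists_unitary_mulVec_pair hij he hf hef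
  have h1 := measurePreserving_unitary_gaussVec V
  rw [← gaussVec_two_coordinates hij, ← h1.measure_preimage]
  · congr 1
    ext z
    simp only [Set.preimage_ofPred_eq, Set.mem_ofPred_eq,
      star_mulVec_dotProduct_mulVec (unitary_conjTranspose_mul V)]
    simp
  · have hm (e : ι → ℂ) : Measurable fun z : ι → ℂ => star e ⬝ᵥ z := by
      unfold dotProduct
      fun_prop
    exact ((hm _ hA).inter (hm _ hB)).nullMeasurableSet

end LinearForm

/-! ### A Gaussian model of a uniform orthogonal pair -/

section GaussianPair

variable {κ : Type*} [Fintype κ]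

/-- The contribution of the first block to the Hermitian product. -/
noncomputable def topDot (b u : κ ⊕ κ → ℂ) : ℂ := ∑ n, star (b (Sum.inl n)) * u (Sum.inl n)

/-- The squared norm of the first block. -/
noncomputable def topSq (u : κ ⊕ κ → ℂ) : ℝ := normSq fun n => u (Sum.inl n)

/-- The squared norm of the second block. -/
noncomputable def botSq (u : κ ⊕ κ → ℂ) : ℝ := normSq fun n => u (Sum.inr n)

theorem topSq_add_botSq (u : κ ⊕ κ → ℂ) : topSq u + botSq u = normSq u := by
  simp [topSq, botSq, normSq, Fintype.sum_sum_type]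

theorem topSq_nonneg (u : κ ⊕ κ → ℂ) : 0 ≤ topSq u := normSq_nonneg _

theorem botSq_nonneg (u : κ ⊕ κ → ℂ) : 0 ≤ botSq u := normSq_nonneg _

theorem topDot_smul (s t : ℝ) (b u : κ ⊕ κ → ℂ) :
    topDot ((s : ℂ) • b) ((t : ℂ) • u) = (s * t : ℝ) * topDot b u := by
  simp only [topDot, Finset.mul_sum]
  refine Finset.sum_congr rfl fun n _ => ?_
  simp
  ring

theorem botSq_smul (t : ℝ) (u : κ ⊕ κ → ℂ) : botSq ((t : ℂ) • u) = t ^ 2 * botSq u := by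
  have := normSq_smul (t : ℂ) fun n => u (Sum.inr n)
  rw [Complex.norm_real, Real.norm_eq_abs, sq_abs] at this
  exact this

theorem measurable_topDot :
    Measurable fun q : (κ ⊕ κ → ℂ) × (κ ⊕ κ → ℂ) => topDot q.1 q.2 := by
  unfold topDot
  fun_prop

theorem measurable_botSq : Measurable (botSq : (κ ⊕ κ → ℂ) → ℝ) := by
  unfold botSq normSq
  fun_prop

/-- The component of `z` orthogonal to `u`. -/
noncomputable def projOrth {ι : Type*} [Fintype ι] (u z : ι → ℂ) : ι → ℂ :=
  z - ((star u ⬝ᵥ z) / (normSq u : ℂ)) • u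

theorem star_dotProduct_projOrth {ι : Type*} [Fintype ι] (u z : ι → ℂ) :
    star u ⬝ᵥ projOrth u z = 0 := by
  rw [projOrth, dotProduct_sub, dotProduct_smul, star_dotProduct_self]
  by_cases hu : u = 0
  · simp [hu]
  · have : (normSq u : ℂ) ≠ 0 := by exact_mod_cast (normSq_pos hu).ne'
    rw [smul_eq_mul, div_mul_cancel₀ _ this, sub_self]

theorem star_dotProduct_projOrth_of_orthogonal {ι : Type*} [Fintype ι] {u w : ι → ℂ} (z : ι → ℂ)
    (h : star w ⬝ᵥ u = 0) : star w ⬝ᵥ projOrth u z = star w ⬝ᵥ z := by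
  rw [projOrth, dotProduct_sub, dotProduct_smul, h, smul_zero, sub_zero]

theorem projOrth_mulVec {ι : Type*} [Fintype ι] [DecidableEq ι] (V : Matrix.unitaryGroup ι ℂ)
    (u z : ι → ℂ) : projOrth ((V : Matrix ι ι ℂ) *ᵥ u) ((V : Matrix ι ι ℂ) *ᵥ z) =
      (V : Matrix ι ι ℂ) *ᵥ projOrth u z := by
  rw [projOrth, projOrth, Matrix.mulVec_sub, Matrix.mulVec_smul,
    star_mulVec_dotProduct_mulVec (unitary_conjTranspose_mul V),
    normSq_mulVec (unitary_conjTranspose_mul V)]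

theorem measurable_projOrth {ι : Type*} [Fintype ι] :
    Measurable fun q : (ι → ℂ) × (ι → ℂ) => projOrth q.1 q.2 := by
  unfold projOrth dotProduct normSq
  simp only [Pi.star_apply]
  fun_prop

/-- The component orthogonal to `u` of the first block of `u`. -/
noncomputable def topProj (u : κ ⊕ κ → ℂ) : κ ⊕ κ → ℂ :=
  Sum.elim (fun n => ((botSq u / normSq u : ℝ) : ℂ) * u (Sum.inl n))
    (fun n => ((-(topSq u / normSq u) : ℝ) : ℂ) * u (Sum.inr n))

/-- This is the conditional variance of `topDot` in the Gaussian model. It is half the harmonic mean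
of the two block norms, so its inverse splits as a sum. -/
theorem normSq_topProj (u : κ ⊕ κ → ℂ) :
    normSq (topProj u) = topSq u * botSq u / normSq u := by
  have h1 := normSq_smul ((botSq u / normSq u : ℝ) : ℂ) fun n => u (Sum.inl n)
  have h2 := normSq_smul ((-(topSq u / normSq u) : ℝ) : ℂ) fun n => u (Sum.inr n)
  rw [Complex.norm_real, Real.norm_eq_abs, sq_abs] at h1 h2
  have h3 : topSq (topProj u) = (botSq u / normSq u) ^ 2 * topSq u := h1
  have h4 : botSq (topProj u) = (-(topSq u / normSq u)) ^ 2 * botSq u := h2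
  rw [← topSq_add_botSq, h3, h4]
  by_cases hu : normSq u = 0
  · simp [hu]
  · field_simp
    linear_combination (topSq u * botSq u) * topSq_add_botSq u

theorem star_topProj_dotProduct (u z : κ ⊕ κ → ℂ) :
    star (topProj u) ⬝ᵥ z = ((botSq u / normSq u : ℝ) : ℂ) *
        ∑ n, star (u (Sum.inl n)) * z (Sum.inl n) -
      ((topSq u / normSq u : ℝ) : ℂ) * ∑ n, star (u (Sum.inr n)) * z (Sum.inr n) := by
  simp only [dotProduct, Fintype.sum_sum_type, Pi.star_apply, topProj, Sum.elim_inl, Sum.elim_inr,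
    RCLike.star_def, Finset.mul_sum]
  rw [sub_eq_add_neg, ← Finset.sum_neg_distrib]
  simp [mul_assoc]

theorem star_topProj_dotProduct_self (u : κ ⊕ κ → ℂ) : star (topProj u) ⬝ᵥ u = 0 := by
  rw [star_topProj_dotProduct]
  have h1 : ∑ n, star (u (Sum.inl n)) * u (Sum.inl n) = (topSq u : ℂ) :=
    star_dotProduct_self fun n => u (Sum.inl n)
  have h2 : ∑ n, star (u (Sum.inr n)) * u (Sum.inr n) = (botSq u : ℂ) :=
    star_dotProduct_self fun n => u (Sum.inr n)
  rw [h1, h2]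
  push_cast
  ring

/-- Orthogonal projection is self-adjoint, so it can be moved from z to the first block of u. For
fixed u, `topDot` thus becomes the conjugate of a linear form in the Gaussian vector z. -/
theorem star_topDot_projOrth {u : κ ⊕ κ → ℂ} (hu : u ≠ 0) (z : κ ⊕ κ → ℂ) :
    star (topDot (projOrth u z) u) = star (topProj u) ⬝ᵥ z := by
  have hn : (normSq u : ℂ) ≠ 0 := by exact_mod_cast (normSq_pos hu).ne'
  have hsum := congrArg (fun x : ℝ => (x : ℂ)) (topSq_add_botSq u)
  have hself : ∑ n, star (u (Sum.inl n)) * u (Sum.inl n) = (topSq u : ℂ) :=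
    star_dotProduct_self fun n => u (Sum.inl n)
  have h1 : star (topDot (projOrth u z) u) =
      ∑ n, star (u (Sum.inl n)) * projOrth u z (Sum.inl n) := by
    simp [topDot, mul_comm]
  rw [h1, star_topProj_dotProduct]
  have h2 : star u ⬝ᵥ z = ∑ n, star (u (Sum.inl n)) * z (Sum.inl n) +
      ∑ n, star (u (Sum.inr n)) * z (Sum.inr n) := by
    simp [dotProduct, Fintype.sum_sum_type]
  simp only [projOrth, Pi.sub_apply, Pi.smul_apply, smul_eq_mul, mul_sub, Finset.sum_sub_distrib]
  have h3 : ∑ n, star (u (Sum.inl n)) * (star u ⬝ᵥ z / (normSq u : ℂ) * u (Sum.inl n)) =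
      star u ⬝ᵥ z / (normSq u : ℂ) * (topSq u : ℂ) := by
    rw [← hself, Finset.mul_sum]
    exact Finset.sum_congr rfl fun n _ => by ring
  rw [h3, h2]
  push_cast at hsum ⊢
  field_simp
  linear_combination (-(∑ n, star (u (Sum.inl n)) * z (Sum.inl n))) * hsum

variable (κ) in
/-- The law of `(z - proj_u z, u)` for independent Gaussian vectors `z`, `u`. -/
noncomputable def gaussPair : Measure ((κ ⊕ κ → ℂ) × (κ ⊕ κ → ℂ)) :=
  ((gaussVec (κ ⊕ κ)).prod (gaussVec (κ ⊕ κ))).map fun q => (projOrth q.1 q.2, q.1)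

theorem measurable_projOrth_pair : Measurable
    fun q : (κ ⊕ κ → ℂ) × (κ ⊕ κ → ℂ) => (projOrth q.1 q.2, q.1) :=
  measurable_projOrth.prodMk measurable_fst

instance isProbabilityMeasure_gaussPair : IsProbabilityMeasure (gaussPair κ) :=
  Measure.isProbabilityMeasure_map measurable_projOrth_pair.aemeasurable

theorem measurePreserving_unitary_gaussPair [DecidableEq κ]
    (V : Matrix.unitaryGroup (κ ⊕ κ) ℂ) :
    MeasurePreserving (fun q : (κ ⊕ κ → ℂ) × (κ ⊕ κ → ℂ) =>
      ((V : Matrix (κ ⊕ κ) (κ ⊕ κ) ℂ) *ᵥ q.1, (V : Matrix (κ ⊕ κ) (κ ⊕ κ) ℂ) *ᵥ q.2))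
      (gaussPair κ) (gaussPair κ) := by
  have h := (measurePreserving_unitary_gaussVec V).prod (measurePreserving_unitary_gaussVec V)
  have hm : Measurable (fun q : (κ ⊕ κ → ℂ) × (κ ⊕ κ → ℂ) =>
      ((V : Matrix (κ ⊕ κ) (κ ⊕ κ) ℂ) *ᵥ q.1, (V : Matrix (κ ⊕ κ) (κ ⊕ κ) ℂ) *ᵥ q.2)) :=
    measurable_unitary_mulVec_pair.comp (measurable_const.prodMk measurable_id)
  refine ⟨hm, ?_⟩
  rw [gaussPair, Measure.map_map hm measurable_projOrth_pair]
  conv_rhs => rw [← h.map_eq, Measure.map_map measurable_projOrth_pair h.measurable]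
  congr 1
  ext1 q
  simp [projOrth_mulVec]

theorem gaussPair_orthogonal : ∀ᵐ q ∂gaussPair κ, star q.1 ⬝ᵥ q.2 = 0 := by
  have hm : MeasurableSet {q : (κ ⊕ κ → ℂ) × (κ ⊕ κ → ℂ) | star q.1 ⬝ᵥ q.2 = 0} := by
    refine measurableSet_eq_fun ?_ measurable_const
    unfold dotProduct
    simp only [Pi.star_apply]
    fun_prop
  rw [gaussPair, ae_map_iff measurable_projOrth_pair.aemeasurable hm]
  refine ae_of_all _ fun q => ?_
  rw [star_dotProduct_comm, star_dotProduct_projOrth, star_zero]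

theorem lintegral_rpow_neg_coordinate_gaussVec_lt_top {ι : Type*} [Fintype ι] (i : ι) {θ : ℝ}
    (h0 : 0 < θ) (h1 : θ < 1) :
    ∫⁻ u : ι → ℂ, ENNReal.ofReal (‖u i‖ ^ 2) ^ (-θ) ∂gaussVec ι < ∞ := by
  have h2 : MeasurePreserving (fun z : ι → ℂ => z i) (gaussVec ι) complexGaussian :=
    measurePreserving_eval (fun _ : ι => complexGaussian) i
  have := h2.lintegral_comp (f := fun z : ℂ => ENNReal.ofReal (‖z‖ ^ 2) ^ (-θ)) (by fun_prop)
  rw [this]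
  exact lintegral_norm_sq_rpow_neg_complexGaussian_lt_top h0 h1

/-- A finite negative moment excludes the value 0, where the integrand is ∞. The same device recurs
below for other forms. -/
theorem ae_coordinate_ne_zero_gaussVec {ι : Type*} [Fintype ι] (i : ι) :
    ∀ᵐ u ∂gaussVec ι, u i ≠ 0 := by
  have h := lintegral_rpow_neg_coordinate_gaussVec_lt_top i (θ := 1 / 2) (by norm_num)
    (by norm_num)
  filter_upwards [ae_lt_top (by fun_prop) h.ne] with u hu h0
  simp [h0] at hu

theorem rpow_neg_ofReal_anti {x y θ : ℝ} (h0 : 0 < θ) (h : x ≤ y) :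
    ENNReal.ofReal y ^ (-θ) ≤ ENNReal.ofReal x ^ (-θ) := by
  rw [ENNReal.rpow_neg, ENNReal.rpow_neg]
  exact ENNReal.inv_le_inv.2 (ENNReal.rpow_le_rpow (ENNReal.ofReal_le_ofReal h) h0.le)

/-- Let p and q be the squared norms of the two blocks of u. Given u, the integral over z is a
constant times (1/p + 1/q)^θ ≤ p^(-θ) + q^(-θ), by subadditivity for θ ≤ 1. Each block norm
dominates the modulus of one Gaussian coordinate. -/
theorem lintegral_rpow_neg_topDot_gaussPair_lt_top [DecidableEq κ] [Nonempty κ] {θ : ℝ}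
    (h0 : 0 < θ) (h1 : θ < 1) :
    ∫⁻ q, ENNReal.ofReal (‖topDot q.1 q.2‖ ^ 2) ^ (-θ) ∂gaussPair κ < ∞ := by
  have hm : Measurable fun q : (κ ⊕ κ → ℂ) × (κ ⊕ κ → ℂ) =>
      ENNReal.ofReal (‖topDot q.1 q.2‖ ^ 2) ^ (-θ) :=
    ((measurable_topDot.norm.pow_const 2).ennreal_ofReal).pow_const _
  let n : κ := Classical.arbitrary κ
  set C := ∫⁻ z, ENNReal.ofReal (‖z‖ ^ 2) ^ (-θ) ∂complexGaussian
  have hC : C < ∞ := lintegral_norm_sq_rpow_neg_complexGaussian_lt_top h0 h1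
  rw [gaussPair, lintegral_map hm measurable_projOrth_pair,
    lintegral_prod (fun q => ENNReal.ofReal (‖topDot (projOrth q.1 q.2) q.1‖ ^ 2) ^ (-θ))
      (hm.comp measurable_projOrth_pair).aemeasurable]
  calc _ ≤ ∫⁻ u : κ ⊕ κ → ℂ, (ENNReal.ofReal (‖u (Sum.inl n)‖ ^ 2) ^ (-θ) +
        ENNReal.ofReal (‖u (Sum.inr n)‖ ^ 2) ^ (-θ)) * C ∂gaussVec (κ ⊕ κ) := by
        refine lintegral_mono_ae ?_
        filter_upwards [ae_coordinate_ne_zero_gaussVec (Sum.inl n),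
          ae_coordinate_ne_zero_gaussVec (Sum.inr n)] with u hl hr
        have hu : u ≠ 0 := fun h => hl (by simp [h])
        have hlT : ‖u (Sum.inl n)‖ ^ 2 ≤ topSq u := norm_sq_le_normSq (fun n => u (Sum.inl n)) n
        have hrB : ‖u (Sum.inr n)‖ ^ 2 ≤ botSq u := norm_sq_le_normSq (fun n => u (Sum.inr n)) n
        have hT : 0 < topSq u := lt_of_lt_of_le (by positivity) hlT
        have hB : 0 < botSq u := lt_of_lt_of_le (by positivity) hrB
        have hn : 0 < normSq u := normSq_pos hu
        have hw : topProj u ≠ 0 := by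
          intro h
          have := normSq_topProj u
          rw [h, normSq_eq_zero.2 rfl] at this
          exact absurd this (by positivity)
        have e (z : κ ⊕ κ → ℂ) : ‖topDot (projOrth u z) u‖ = ‖star (topProj u) ⬝ᵥ z‖ := by
          rw [← star_topDot_projOrth hu, norm_star]
        simp only [e]
        rw [lintegral_rpow_neg_star_dotProduct_gaussVec hw, normSq_topProj]
        gcongr
        refine le_trans ?_ (add_le_add (rpow_neg_ofReal_anti h0 hlT) (rpow_neg_ofReal_anti h0 hrB))
        have hinv : (topSq u * botSq u / normSq u)⁻¹ = (topSq u)⁻¹ + (botSq u)⁻¹ := by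
          rw [← topSq_add_botSq]
          field_simp
          ring
        rw [ENNReal.rpow_neg, ENNReal.rpow_neg, ENNReal.rpow_neg, ← ENNReal.inv_rpow,
          ← ENNReal.inv_rpow, ← ENNReal.inv_rpow, ← ENNReal.ofReal_inv_of_pos (by positivity),
          ← ENNReal.ofReal_inv_of_pos hT, ← ENNReal.ofReal_inv_of_pos hB, hinv,
          ENNReal.ofReal_add (by positivity) (by positivity)]
        exact ENNReal.rpow_add_le_add_rpow _ _ h0.le h1.le
    _ < ∞ := by
        rw [lintegral_mul_const _ (by fun_prop), lintegral_add_left (by fun_prop)]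
        exact ENNReal.mul_lt_top (ENNReal.add_lt_top.2
          ⟨lintegral_rpow_neg_coordinate_gaussVec_lt_top _ h0 h1,
            lintegral_rpow_neg_coordinate_gaussVec_lt_top _ h0 h1⟩) hC

theorem topDot_zero_left (u : κ ⊕ κ → ℂ) : topDot 0 u = 0 := by simp [topDot]

theorem topDot_zero_right (b : κ ⊕ κ → ℂ) : topDot b 0 = 0 := by simp [topDot]

theorem gaussPair_ne_zero [DecidableEq κ] [Nonempty κ] :
    ∀ᵐ q ∂gaussPair κ, q.1 ≠ 0 ∧ q.2 ≠ 0 := by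
  have h := lintegral_rpow_neg_topDot_gaussPair_lt_top (κ := κ) (θ := 1 / 2) (by norm_num)
    (by norm_num)
  filter_upwards [ae_lt_top (((measurable_topDot.norm.pow_const 2).ennreal_ofReal).pow_const _)
    h.ne] with q hq
  constructor <;> intro h0
  · simp [h0, topDot_zero_left] at hq
  · simp [h0, topDot_zero_right] at hq

end GaussianPair

/-! ### Estimates for unitarily invariant orthogonal pairs -/

section InvariantPair

variable {κ : Type*} [Fintype κ]

/-- A unitarily invariant law on pairs of nonzero orthogonal vectors. -/
structure IsInvariantPair {ι : Type*} [Fintype ι] [DecidableEq ι]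
    (ν : Measure ((ι → ℂ) × (ι → ℂ))) : Prop where
  invariant : ∀ V : Matrix.unitaryGroup ι ℂ, MeasurePreserving (fun q : (ι → ℂ) × (ι → ℂ) =>
    ((V : Matrix ι ι ℂ) *ᵥ q.1, (V : Matrix ι ι ℂ) *ᵥ q.2)) ν ν
  orthogonal : ∀ᵐ q ∂ν, star q.1 ⬝ᵥ q.2 = 0
  ne_zero : ∀ᵐ q ∂ν, q.1 ≠ 0 ∧ q.2 ≠ 0

theorem isInvariantPair_gaussPair [DecidableEq κ] [Nonempty κ] : IsInvariantPair (gaussPair κ) :=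
  ⟨measurePreserving_unitary_gaussPair, gaussPair_orthogonal, gaussPair_ne_zero⟩

/-- The negative power of `‖topDot b u‖²` for the normalized vectors. -/
noncomputable def dirMoment (θ : ℝ) (q : (κ ⊕ κ → ℂ) × (κ ⊕ κ → ℂ)) : ℝ≥0∞ :=
  ENNReal.ofReal (‖topDot q.1 q.2‖ ^ 2 / (normSq q.1 * normSq q.2)) ^ (-θ)

theorem measurable_normSq_mul_normSq {ι : Type*} [Fintype ι] :
    Measurable fun q : (ι → ℂ) × (ι → ℂ) => normSq q.1 * normSq q.2 :=
  (measurable_normSq.comp measurable_fst).mul (measurable_normSq.comp measurable_snd)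

theorem measurable_dirMoment (θ : ℝ) : Measurable (dirMoment (κ := κ) θ) :=
  (((measurable_topDot.norm.pow_const 2).div
    measurable_normSq_mul_normSq).ennreal_ofReal).pow_const _

theorem norm_sq_topDot_smul (s t : ℝ) (b u : κ ⊕ κ → ℂ) :
    ‖topDot ((s : ℂ) • b) ((t : ℂ) • u)‖ ^ 2 = s ^ 2 * t ^ 2 * ‖topDot b u‖ ^ 2 := by
  rw [topDot_smul, norm_mul, mul_pow, Complex.norm_real, Real.norm_eq_abs, sq_abs, mul_pow]

theorem normSq_ofReal_smul {ι : Type*} [Fintype ι] (s : ℝ) (b : ι → ℂ) :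
    normSq ((s : ℂ) • b) = s ^ 2 * normSq b := by
  rw [normSq_smul, Complex.norm_real, Real.norm_eq_abs, sq_abs]

theorem dirMoment_smul (θ s t : ℝ) (b u : κ ⊕ κ → ℂ) (hs : 0 < s) (ht : 0 < t) :
    dirMoment θ ((s : ℂ) • b, (t : ℂ) • u) = dirMoment θ (b, u) := by
  simp only [dirMoment]
  rw [norm_sq_topDot_smul, normSq_ofReal_smul, normSq_ofReal_smul]
  congr 2
  rw [show s ^ 2 * normSq b * (t ^ 2 * normSq u) = s ^ 2 * t ^ 2 * (normSq b * normSq u) by ring,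
    mul_div_mul_left _ _ (by positivity)]

/-- `topDot` is the product of the norms with a function of the directions, and norms and directions
are independent. -/
theorem lintegral_rpow_neg_topDot_of_isInvariantPair [DecidableEq κ] {i j : κ ⊕ κ} (hij : i ≠ j)
    {ν : Measure ((κ ⊕ κ → ℂ) × (κ ⊕ κ → ℂ))} [SFinite ν] (hν : IsInvariantPair ν) (θ : ℝ) :
    ∫⁻ q, ENNReal.ofReal (‖topDot q.1 q.2‖ ^ 2) ^ (-θ) ∂ν =
      (∫⁻ q, ENNReal.ofReal (normSq q.1 * normSq q.2) ^ (-θ) ∂ν) *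
        pairAverage i j (dirMoment θ) := by
  rw [← lintegral_invariant_pair hij ν hν.invariant hν.orthogonal hν.ne_zero
    (measurable_dirMoment θ) (dirMoment_smul θ)
    (H := fun p : ℝ × ℝ => ENNReal.ofReal (p.1 * p.2) ^ (-θ)) (by fun_prop)]
  refine lintegral_congr_ae ?_
  filter_upwards [hν.ne_zero] with q hq
  have h1 := normSq_pos hq.1
  have h2 := normSq_pos hq.2
  simp only [dirMoment]
  rw [← ENNReal.mul_rpow_of_ne_top ENNReal.ofReal_ne_top ENNReal.ofReal_ne_top,
    ← ENNReal.ofReal_mul (by positivity), mul_div_cancel₀ _ (by positivity)]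

/-- The average is the same for all invariant laws, so finiteness can be read off from the Gaussian
model. -/
theorem pairAverage_dirMoment_lt_top [DecidableEq κ] {i j : κ ⊕ κ} (hij : i ≠ j) {θ : ℝ} (h0 : 0 < θ)
    (h1 : θ < 1) : pairAverage i j (dirMoment θ) < ∞ := by
  have : Nonempty κ := by cases i <;> exact ⟨‹κ›⟩
  have h := lintegral_rpow_neg_topDot_of_isInvariantPair hij
    (isInvariantPair_gaussPair (κ := κ)) θ
  have hlt := lintegral_rpow_neg_topDot_gaussPair_lt_top (κ := κ) h0 h1
  rw [h] at hlt
  refine lt_top_iff_ne_top.2 fun htop => ?_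
  rw [htop, ENNReal.mul_top] at hlt
  · exact lt_irrefl _ hlt
  -- The case 0 * ∞ has to be ruled out: the norm factor integrates a negative power of a finite
  -- quantity, which is nowhere zero.
  · rw [lintegral_eq_zero_iff (measurable_normSq_mul_normSq.ennreal_ofReal.pow_const _)|>.ne]
    intro hz
    have hfalse : ∀ᵐ _q ∂gaussPair κ, False := by
      filter_upwards [hz] with q hq
      simp only [Pi.zero_apply, ENNReal.rpow_eq_zero_iff] at hq
      rcases hq with hq | hq
      · linarith [hq.2]
      · exact ENNReal.ofReal_ne_top hq.1
    exact hfalse.exists.elim fun _ h => h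

/-- The event that the normalized `topDot` is small compared with the second block. -/
def smallSet (s : ℝ) : Set ((κ ⊕ κ → ℂ) × (κ ⊕ κ → ℂ)) :=
  {q | ‖topDot q.1 q.2‖ ^ 2 < s * (normSq q.1 * botSq q.2)}

theorem measurableSet_smallSet (s : ℝ) : MeasurableSet (smallSet (κ := κ) s) :=
  measurableSet_lt (measurable_topDot.norm.pow_const 2) (((measurable_normSq.comp
    measurable_fst).mul (measurable_botSq.comp measurable_snd)).const_mul s)

theorem smul_mem_smallSet_iff (σ : ℝ) (s t : ℝ) (b u : κ ⊕ κ → ℂ) (hs : 0 < s) (ht : 0 < t) :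
    ((s : ℂ) • b, (t : ℂ) • u) ∈ smallSet σ ↔ (b, u) ∈ smallSet σ := by
  simp only [smallSet, Set.mem_ofPred_eq]
  rw [norm_sq_topDot_smul, normSq_ofReal_smul, botSq_smul,
    show σ * (s ^ 2 * normSq b * (t ^ 2 * botSq u)) =
      s ^ 2 * t ^ 2 * (σ * (normSq b * botSq u)) by ring]
  exact mul_lt_mul_iff_right₀ (by positivity)

/-- `smallSet` depends on the directions only, hence is independent of the norm of the first vector.
The extra event will bound that norm from above. -/
theorem measure_inter_smallSet_of_isInvariantPair [DecidableEq κ] {i j : κ ⊕ κ} (hij : i ≠ j)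
    {ν : Measure ((κ ⊕ κ → ℂ) × (κ ⊕ κ → ℂ))} [SFinite ν] (hν : IsInvariantPair ν) (σ : ℝ)
    {A : Set ℝ} (hA : MeasurableSet A) :
    ν ({q | normSq q.1 ∈ A} ∩ smallSet σ) =
      ν {q | normSq q.1 ∈ A} * pairAverage i j ((smallSet σ).indicator 1) := by
  have hA' : MeasurableSet {q : (κ ⊕ κ → ℂ) × (κ ⊕ κ → ℂ) | normSq q.1 ∈ A} :=
    (measurable_normSq.comp measurable_fst) hA
  have h := lintegral_invariant_pair hij ν hν.invariant hν.orthogonal hν.ne_zero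
    (F := (smallSet σ).indicator 1) (measurable_one.indicator (measurableSet_smallSet σ))
    (fun s t b u hs ht => by
      by_cases hm : (b, u) ∈ smallSet σ
      · rw [Set.indicator_of_mem hm,
          Set.indicator_of_mem ((smul_mem_smallSet_iff σ s t b u hs ht).2 hm)]; rfl
      · rw [Set.indicator_of_notMem hm,
          Set.indicator_of_notMem (mt (smul_mem_smallSet_iff σ s t b u hs ht).1 hm)])
    (H := fun p : ℝ × ℝ => A.indicator 1 p.1) ((measurable_one.indicator hA).comp measurable_fst)
  rw [← lintegral_indicator_one (hA'.inter (measurableSet_smallSet σ)),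
    ← lintegral_indicator_one hA']
  convert h using 2
  · ext q
    have := Set.inter_indicator_mul (s := {q : (κ ⊕ κ → ℂ) × (κ ⊕ κ → ℂ) | normSq q.1 ∈ A})
      (t := smallSet σ) (fun _ => (1 : ℝ≥0∞)) (fun _ => 1) q
    simp only [mul_one] at this
    exact this
  · rfl

theorem normSq_topProj_le_topSq (u : κ ⊕ κ → ℂ) : normSq (topProj u) ≤ topSq u := by
  rw [normSq_topProj, mul_div_assoc]
  refine mul_le_of_le_one_right (topSq_nonneg u) (div_le_one_of_le₀ ?_ (normSq_nonneg u))
  linarith [topSq_add_botSq u, topSq_nonneg u]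

theorem normSq_topProj_le_botSq (u : κ ⊕ κ → ℂ) : normSq (topProj u) ≤ botSq u := by
  rw [normSq_topProj, mul_comm, mul_div_assoc]
  refine mul_le_of_le_one_right (botSq_nonneg u) (div_le_one_of_le₀ ?_ (normSq_nonneg u))
  linarith [topSq_add_botSq u, botSq_nonneg u]

theorem norm_topDot_projOrth {u : κ ⊕ κ → ℂ} (hu : u ≠ 0) (z : κ ⊕ κ → ℂ) :
    ‖topDot (projOrth u z) u‖ = ‖star (topProj u) ⬝ᵥ z‖ := by
  rw [← star_topDot_projOrth hu, norm_star]

theorem norm_sq_star_normalize_dotProduct {ι : Type*} [Fintype ι] {w : ι → ℂ} (hw : w ≠ 0)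
    (z : ι → ℂ) : ‖star w ⬝ᵥ z‖ ^ 2 =
      normSq w * ‖star ((((√(normSq w))⁻¹ : ℝ) : ℂ) • w) ⬝ᵥ z‖ ^ 2 := by
  have := normSq_pos hw
  rw [star_smul, smul_dotProduct, norm_smul, mul_pow, ← mul_assoc]
  simp only [RCLike.star_def, Complex.conj_ofReal, Complex.norm_real, Real.norm_eq_abs, sq_abs,
    inv_pow, Real.sq_sqrt this.le]
  rw [mul_inv_cancel₀ this.ne', one_mul]

/-- With two coordinates in the first block there is a vector f orthogonal to both u and `topProj
u`. The normalized forms of z along `topProj u` and f are independent: a small first one makes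
`topDot` small, and a second one of modulus at least 1 keeps the projection of z from being short.
-/
theorem le_gaussPair_smallSet_of_ne [DecidableEq κ] {n₁ n₂ : κ} (hn : n₁ ≠ n₂) {s : ℝ} (hs : 0 < s) :
    complexGaussian {z | ‖z‖ ^ 2 < s} * complexGaussian {z | 1 ≤ ‖z‖ ^ 2} ≤
      gaussPair κ (smallSet s) := by
  rw [gaussPair, Measure.map_apply measurable_projOrth_pair (measurableSet_smallSet s),
    Measure.prod_apply (measurable_projOrth_pair (measurableSet_smallSet s))]
  have hconst : complexGaussian {z | ‖z‖ ^ 2 < s} * complexGaussian {z | 1 ≤ ‖z‖ ^ 2} =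
      ∫⁻ _ : κ ⊕ κ → ℂ, complexGaussian {z | ‖z‖ ^ 2 < s} *
        complexGaussian {z | 1 ≤ ‖z‖ ^ 2} ∂gaussVec (κ ⊕ κ) := by simp
  rw [hconst]
  refine lintegral_mono_ae ?_
  filter_upwards [ae_coordinate_ne_zero_gaussVec (Sum.inl n₁),
    ae_coordinate_ne_zero_gaussVec (Sum.inr n₁)] with u hl hr
  have hu : u ≠ 0 := fun h => hl (by simp [h])
  have hT : 0 < topSq u := normSq_pos fun h => hl (congrFun h n₁)
  have hB : 0 < botSq u := normSq_pos fun h => hr (congrFun h n₁)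
  have hw : topProj u ≠ 0 := by
    intro h
    have h' := normSq_topProj u
    have := normSq_pos hu
    rw [h, normSq_eq_zero.2 rfl] at h'
    exact absurd h' (by positivity)
  -- Both u and `topProj u` have first blocks proportional to that of u; the antisymmetric choice of
  -- f cancels against both.
  let f : κ ⊕ κ → ℂ := Pi.single (Sum.inl n₁) (star (u (Sum.inl n₂))) -
    Pi.single (Sum.inl n₂) (star (u (Sum.inl n₁)))
  have hne : (Sum.inl n₂ : κ ⊕ κ) ≠ Sum.inl n₁ := fun h => hn (Sum.inl_injective h).symm
  have hf : f ≠ 0 := by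
    intro h
    have := congrFun h (Sum.inl n₂)
    simp [f, hne, hl] at this
  have hfdot (z : κ ⊕ κ → ℂ) : star f ⬝ᵥ z =
      u (Sum.inl n₂) * z (Sum.inl n₁) - u (Sum.inl n₁) * z (Sum.inl n₂) := by
    simp only [f, star_sub, sub_dotProduct, ← Pi.single_star, star_star, single_dotProduct]
  have hfu : star f ⬝ᵥ u = 0 := by rw [hfdot]; ring
  have hwf : star (topProj u) ⬝ᵥ f = 0 := by
    rw [star_dotProduct_comm, hfdot]
    simp [topProj]
    ring
  rw [← gaussVec_two_linear_forms hne (normSq_normalize hw) (normSq_normalize hf)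
    (by rw [star_smul, smul_dotProduct, dotProduct_smul, hwf]; simp)
    (measurableSet_lt (by fun_prop) measurable_const)
    (measurableSet_le measurable_const (by fun_prop))]
  refine measure_mono fun z hz => ?_
  obtain ⟨hz1, hz2⟩ := hz
  simp only [Set.mem_ofPred_eq] at hz1 hz2
  simp only [Set.mem_preimage, smallSet, Set.mem_ofPred_eq]
  have hb : 1 ≤ normSq (projOrth u z) := by
    refine hz2.trans ?_
    rw [← star_dotProduct_projOrth_of_orthogonal (u := u) z
      (by rw [star_smul, smul_dotProduct, hfu, smul_zero])]
    refine (norm_sq_star_dotProduct_le _ _).trans ?_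
    rw [normSq_normalize hf, one_mul]
  rw [norm_topDot_projOrth hu, norm_sq_star_normalize_dotProduct hw]
  calc _ < normSq (topProj u) * s := mul_lt_mul_of_pos_left hz1 (normSq_pos hw)
    _ ≤ botSq u * s := mul_le_mul_of_nonneg_right (normSq_topProj_le_botSq u) hs.le
    _ ≤ s * (normSq (projOrth u z) * botSq u) := by
      have := mul_le_mul_of_nonneg_right hb hB.le
      nlinarith

/-- In ℂ² no direction is left orthogonal to u and `topProj u`, so the randomness of u is used
instead. A small first and a large second coordinate of u suffice, by Cauchy–Schwarz and
`normSq_topProj_le_topSq`. -/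
theorem le_gaussPair_smallSet_of_subsingleton [DecidableEq κ] [Subsingleton κ] [Nonempty κ] {s : ℝ}
    (hs : 0 < s) :
    complexGaussian {z | ‖z‖ ^ 2 < s} * complexGaussian {z | 1 ≤ ‖z‖ ^ 2} ≤
      gaussPair κ (smallSet s) := by
  let n : κ := Classical.arbitrary κ
  have hsum (v : κ → ℂ) : normSq v = ‖v n‖ ^ 2 := by
    have : Unique κ := ⟨⟨n⟩, fun _ => Subsingleton.elim _ _⟩
    rw [normSq, Fintype.sum_unique, Subsingleton.elim default n]
  have hlr : (Sum.inl n : κ ⊕ κ) ≠ Sum.inr n := Sum.inl_ne_inr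
  rw [gaussPair, Measure.map_apply measurable_projOrth_pair (measurableSet_smallSet s),
    ← gaussVec_two_coordinates hlr]
  have hprod : gaussVec (κ ⊕ κ) {z | z (Sum.inl n) ∈ {z | ‖z‖ ^ 2 < s} ∧
        z (Sum.inr n) ∈ {z | 1 ≤ ‖z‖ ^ 2}} =
      ((gaussVec (κ ⊕ κ)).prod (gaussVec (κ ⊕ κ))) ({z | z (Sum.inl n) ∈ {z | ‖z‖ ^ 2 < s} ∧
        z (Sum.inr n) ∈ {z | 1 ≤ ‖z‖ ^ 2}} ×ˢ Set.univ) := by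
    rw [Measure.prod_prod, measure_univ, mul_one]
  rw [hprod]
  have hae := gaussPair_ne_zero (κ := κ)
  rw [gaussPair] at hae
  have hae' := ae_of_ae_map measurable_projOrth_pair.aemeasurable hae
  refine measure_mono_ae ?_
  filter_upwards [hae'] with q hq hmem
  obtain ⟨⟨h1, h2⟩, -⟩ := hmem
  change ‖topDot (projOrth q.1 q.2) q.1‖ ^ 2 < s * (normSq (projOrth q.1 q.2) * botSq q.1)
  have hp := normSq_pos hq.1
  rw [norm_topDot_projOrth hq.2, ← star_dotProduct_projOrth_of_orthogonal (u := q.1) q.2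
    (star_topProj_dotProduct_self q.1)]
  have hT : topSq q.1 < s := by rw [topSq, hsum]; exact h1
  have hB : 1 ≤ botSq q.1 := by rw [botSq, hsum]; exact h2
  calc _ ≤ normSq (topProj q.1) * normSq (projOrth q.1 q.2) := norm_sq_star_dotProduct_le _ _
    _ < s * normSq (projOrth q.1 q.2) :=
      mul_lt_mul_of_pos_right ((normSq_topProj_le_topSq _).trans_lt hT) hp
    _ ≤ _ := by
      have : s * normSq (projOrth q.1 q.2) * 1 ≤ s * normSq (projOrth q.1 q.2) * botSq q.1 :=
        mul_le_mul_of_nonneg_left hB (by positivity)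
      linarith

/-- The average is the probability of `smallSet` in the Gaussian model, which is bounded below
separately for a first block of one coordinate and of several. -/
theorem exists_le_pairAverage_smallSet [DecidableEq κ] {i j : κ ⊕ κ} (hij : i ≠ j) :
    ∃ c : ℝ, 0 < c ∧ ∀ s : ℝ, 0 < s → s ≤ 1 →
      ENNReal.ofReal (c * s) ≤ pairAverage i j ((smallSet s).indicator 1) := by
  have hne : Nonempty κ := by cases i <;> exact ⟨‹κ›⟩
  obtain ⟨c, hc, h⟩ := exists_le_complexGaussian_norm_sq_lt
  have hp := complexGaussian_one_le_norm_sq_pos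
  have hp' : 0 < (complexGaussian {z | 1 ≤ ‖z‖ ^ 2}).toReal :=
    ENNReal.toReal_pos hp.ne' (measure_ne_top _ _)
  refine ⟨c * (complexGaussian {z | 1 ≤ ‖z‖ ^ 2}).toReal, by positivity, fun s hs hs1 => ?_⟩
  have h1 := measure_inter_smallSet_of_isInvariantPair hij (isInvariantPair_gaussPair (κ := κ)) s
    MeasurableSet.univ
  simp only [Set.mem_univ, Set.ofPred_true, Set.univ_inter, measure_univ, one_mul] at h1
  rw [← h1]
  have h2 : complexGaussian {z | ‖z‖ ^ 2 < s} * complexGaussian {z | 1 ≤ ‖z‖ ^ 2} ≤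
      gaussPair κ (smallSet s) := by
    rcases subsingleton_or_nontrivial κ with hκ | hκ
    · exact le_gaussPair_smallSet_of_subsingleton hs
    · obtain ⟨n₁, n₂, hn⟩ := exists_pair_ne κ
      exact le_gaussPair_smallSet_of_ne hn hs
  refine le_trans ?_ h2
  rw [mul_right_comm, ENNReal.ofReal_mul (by positivity), ENNReal.ofReal_toReal (measure_ne_top _ _)]
  exact mul_le_mul_left (h s hs hs1) _

end InvariantPair

/-! ### Resampling one coordinate, and random determinants -/

section Resample

variable {κ : Type*} [DecidableEq κ] {Y : κ → Type*} [∀ i, MeasurableSpace (Y i)]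

theorem measurable_update_pair (m : κ) :
    Measurable fun p : (∀ i, Y i) × Y m => Function.update p.1 m p.2 := by
  refine measurable_pi_lambda _ fun i => ?_
  by_cases h : i = m
  · subst h
    simpa using measurable_snd
  · simp only [Function.update_of_ne h]
    exact (measurable_pi_apply i).comp measurable_fst

variable [Fintype κ] (ν : ∀ i, Measure (Y i)) [∀ i, IsProbabilityMeasure (ν i)]

/-- Replacing one coordinate by an independent copy preserves a product measure. -/
theorem measurePreserving_update (m : κ) :
    MeasurePreserving (fun p : (∀ i, Y i) × Y m => Function.update p.1 m p.2)
      ((Measure.pi ν).prod (ν m)) (Measure.pi ν) := by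
  refine ⟨measurable_update_pair m, (Measure.pi_eq fun s hs => ?_).symm⟩
  rw [Measure.map_apply (measurable_update_pair m) (MeasurableSet.univ_pi hs)]
  have h : (fun p : (∀ i, Y i) × Y m => Function.update p.1 m p.2) ⁻¹' Set.univ.pi s =
      (Set.univ.pi (Function.update s m Set.univ)) ×ˢ s m := by
    ext ⟨y, t⟩
    simp only [Set.mem_preimage, Set.mem_univ_pi, Set.mem_prod]
    constructor
    · intro h
      refine ⟨fun i => ?_, by simpa using h m⟩
      by_cases hi : i = m
      · subst hi; simp
      · simpa [hi] using h i
    · rintro ⟨h1, h2⟩ i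
      by_cases hi : i = m
      · subst hi; simpa using h2
      · simpa [hi] using h1 i
  rw [h, Measure.prod_prod, Measure.pi_pi, ← Finset.mul_prod_erase _ _ (Finset.mem_univ m),
    ← Finset.mul_prod_erase _ (fun i => ν i (s i)) (Finset.mem_univ m)]
  simp only [Function.update_self, measure_univ, one_mul]
  rw [mul_comm]
  congr 1
  refine Finset.prod_congr rfl fun i hi => ?_
  rw [Function.update_of_ne (Finset.ne_of_mem_erase hi)]

theorem det_updateCol_eq_adjugate_dotProduct (A : Matrix κ κ ℂ) (i : κ) (b : κ → ℂ) :
    (A.updateCol i b).det = A.adjugate i ⬝ᵥ b := by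
  rw [← Matrix.cramer_apply, Matrix.cramer_eq_adjugate_mulVec]
  rfl

theorem adjugate_dotProduct_col (A : Matrix κ κ ℂ) (i : κ) :
    (A.adjugate i ⬝ᵥ fun j => A j i) = A.det := by
  rw [← det_updateCol_eq_adjugate_dotProduct, Matrix.updateCol_eq_self]

/-- Row i of the adjugate consists of the cofactors of column i, which do not involve that column.
With all other pairs fixed, c stays constant while one pair is resampled. -/
theorem adjugate_updateCol_self (A : Matrix κ κ ℂ) (i : κ) (b : κ → ℂ) :
    (A.updateCol i b).adjugate i = A.adjugate i := by
  ext j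
  have h (B : Matrix κ κ ℂ) : B.adjugate i j = (B.updateCol i (Pi.single j 1)).det := by
    rw [det_updateCol_eq_adjugate_dotProduct]
    simp
  rw [h, h, Matrix.updateCol_idem]

theorem measurable_matrix_of {α m n : Type*} [MeasurableSpace α] {f : α → m → n → ℂ}
    (hf : ∀ i j, Measurable fun a => f a i j) : Measurable fun a => Matrix.of (f a) :=
  measurable_pi_lambda (X := fun _ : m => n → ℂ) _ fun i => measurable_pi_lambda _ fun j => hf i j

theorem measurable_det : Measurable (Matrix.det : Matrix κ κ ℂ → ℂ) :=
  (continuous_id.matrix_det).measurable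

/-- A random matrix with independent columns, none of which charges a hyperplane, is almost surely
invertible. -/
theorem ae_det_ne_zero {g : ∀ i, Y i → κ → ℂ} (hg : ∀ i, Measurable (g i))
    (h : ∀ i, ∀ c : κ → ℂ, c ≠ 0 → ∀ᵐ y ∂ν i, c ⬝ᵥ g i y ≠ 0) :
    ∀ᵐ y ∂Measure.pi ν, (Matrix.of fun j i => g i (y i) j).det ≠ 0 := by
  -- The columns of the identity matrix are replaced by random ones one at a time. Each step
  -- resamples one column against the nonzero cofactor row of the previous matrix.
  let E : Finset κ → (∀ i, Y i) → Matrix κ κ ℂ := fun s y =>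
    Matrix.of fun j i => if i ∈ s then g i (y i) j else (1 : Matrix κ κ ℂ) j i
  have hE (s : Finset κ) : Measurable (E s) := by
    refine measurable_matrix_of fun j i => ?_
    by_cases hi : i ∈ s
    · simp only [hi, if_true]
      exact (measurable_pi_apply j).comp ((hg i).comp (measurable_pi_apply i))
    · simp only [hi, if_false]
      exact measurable_const
  have key (s : Finset κ) : ∀ᵐ y ∂Measure.pi ν, (E s y).det ≠ 0 := by
    induction s using Finset.induction_on with
    | empty =>
      refine ae_of_all _ fun y => ?_
      have : E ∅ y = 1 := by ext i j; simp [E]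
      rw [this, Matrix.det_one]
      exact one_ne_zero
    | insert i s hi ih =>
      have hS : MeasurableSet {y | (E (insert i s) y).det ≠ 0} :=
        (measurableSet_eq_fun (measurable_det.comp (hE _)) measurable_const).compl
      rw [← (measurePreserving_update ν i).map_eq,
        ae_map_iff (measurable_update_pair i).aemeasurable hS]
      have hS' := measurable_update_pair i hS
      refine (Measure.ae_prod_iff_ae_ae hS').2 ?_
      filter_upwards [ih] with y hy
      have hc : (E s y).adjugate i ≠ 0 := by
        intro h0
        rw [← adjugate_dotProduct_col _ i, h0, zero_dotProduct] at hy
        exact hy rfl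
      filter_upwards [h i _ hc] with t ht
      have : E (insert i s) (Function.update y i t) = (E s y).updateCol i (g i t) := by
        ext j l
        by_cases hl : l = i
        · subst hl
          simp [E]
        · simp [E, hl]
      rw [this, det_updateCol_eq_adjugate_dotProduct]
      exact ht
  filter_upwards [key Finset.univ] with y hy
  simpa [E] using hy

/-- The diagonal entries of `A⁻¹ A⁻ᴴ`. -/
theorem inv_mul_inv_conjTranspose_diag_re (A : Matrix κ κ ℂ) (i : κ) :
    ((A⁻¹ * (A⁻¹)ᴴ) i i).re = normSq (A.adjugate i) / ‖A.det‖ ^ 2 := by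
  rw [Matrix.mul_apply, normSq, Finset.sum_div, Complex.re_sum]
  refine Finset.sum_congr rfl fun j _ => ?_
  -- No invertibility is needed: for a zero determinant both the inverse and the quotient are 0 by
  -- convention.
  rw [Matrix.conjTranspose_apply, Matrix.inv_def, Ring.inverse_eq_inv, Matrix.smul_apply,
    smul_eq_mul, RCLike.star_def, Complex.mul_conj', ← Complex.ofReal_pow, Complex.ofReal_re,
    norm_mul, norm_inv, mul_pow, inv_pow, div_eq_inv_mul]

end Resample

/-! ### Random frames of the null space of a Gaussian matrix -/

section UniformSphere

variable {k : ℕ}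

theorem measurable_normalize : Measurable fun (z : Fin k → ℂ) i =>
    ((√2 / √(normSq z) : ℝ) : ℂ) * z i := by
  unfold normSq
  fun_prop

instance isProbabilityMeasure_uniformSphere : IsProbabilityMeasure (uniformSphere k) :=
  Measure.isProbabilityMeasure_map (μ := gaussVec (Fin k)) measurable_normalize.aemeasurable

/-- Normalization commutes with unitary maps, so the invariance of the Gaussian vector is inherited.
-/
theorem measurePreserving_unitary_uniformSphere (R : Matrix.unitaryGroup (Fin k) ℂ) :
    MeasurePreserving (fun x : Fin k → ℂ => (R : Matrix (Fin k) (Fin k) ℂ) *ᵥ x)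
      (uniformSphere k) (uniformSphere k) := by
  have hm : Measurable fun x : Fin k → ℂ => (R : Matrix (Fin k) (Fin k) ℂ) *ᵥ x :=
    (measurePreserving_unitary_gaussVec R).measurable
  refine ⟨hm, ?_⟩
  change ((gaussVec (Fin k)).map _).map _ = (gaussVec (Fin k)).map _
  rw [Measure.map_map hm measurable_normalize]
  conv_rhs => rw [← (measurePreserving_unitary_gaussVec R).map_eq,
    Measure.map_map measurable_normalize hm]
  congr 1
  ext1 z
  have := Matrix.mulVec_smul (R : Matrix (Fin k) (Fin k) ℂ) ((√2 / √(normSq z) : ℝ) : ℂ) z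
  simp only [Function.comp_apply, normSq_mulVec (unitary_conjTranspose_mul R)]
  exact this

theorem ae_normSq_uniformSphere (hk : 0 < k) : ∀ᵐ x ∂uniformSphere k, normSq x = 2 := by
  change ∀ᵐ x ∂((gaussVec (Fin k)).map _), normSq x = 2
  rw [ae_map_iff measurable_normalize.aemeasurable
    (measurableSet_eq_fun measurable_normSq measurable_const)]
  filter_upwards [ae_coordinate_ne_zero_gaussVec (⟨0, hk⟩ : Fin k)] with z hz
  have hz' : 0 < normSq z := normSq_pos fun h => hz (congrFun h _)
  have := normSq_ofReal_smul (√2 / √(normSq z)) z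
  rw [div_pow, Real.sq_sqrt hz'.le, Real.sq_sqrt zero_le_two, div_mul_cancel₀ _ hz'.ne'] at this
  exact this

end UniformSphere

/-! ### Full rank of Gaussian matrices -/

section FullRank

variable {ι κ : Type*} [Fintype ι] [Fintype κ]

theorem measurePreserving_comp_injective {α : Type*} [MeasurableSpace α] (P : Measure α)
    [IsProbabilityMeasure P] {e : κ → ι} (he : Function.Injective e) :
    MeasurePreserving (fun (x : ι → α) j => x (e j)) (Measure.pi fun _ => P)
      (Measure.pi fun _ => P) := by
  have h : iIndepFun (fun i (x : ι → α) => x i) (Measure.pi fun _ => P) :=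
    iIndepFun_pi (X := fun _ => id) fun _ => aemeasurable_id
  have h2 := (iIndepFun_iff_map_fun_eq_pi_map fun j =>
    (measurable_pi_apply (e j)).aemeasurable).1 (h.precomp he)
  refine ⟨measurable_pi_lambda _ fun j => measurable_pi_apply (e j), h2.trans ?_⟩
  congr 1
  ext1 j
  exact (measurePreserving_eval (fun _ : ι => P) (e j)).map_eq

theorem ae_dotProduct_ne_zero_gaussVec [DecidableEq κ] {c : κ → ℂ} (hc : c ≠ 0) :
    ∀ᵐ z ∂gaussVec κ, c ⬝ᵥ z ≠ 0 := by
  have hc' : star c ≠ 0 := star_ne_zero.2 hc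
  have h := lintegral_rpow_neg_star_dotProduct_gaussVec hc' (1 / 2)
  rw [star_star] at h
  have hlt : ∫⁻ z, ENNReal.ofReal (‖c ⬝ᵥ z‖ ^ 2) ^ (-(1 / 2) : ℝ) ∂gaussVec κ < ∞ := by
    rw [h]
    refine ENNReal.mul_lt_top ?_ (lintegral_norm_sq_rpow_neg_complexGaussian_lt_top (by norm_num)
      (by norm_num))
    rw [ENNReal.rpow_neg]
    refine ENNReal.inv_lt_top.2 (ENNReal.rpow_pos ?_ ENNReal.ofReal_ne_top)
    exact ENNReal.ofReal_pos.2 (normSq_pos hc')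
  have hm : Measurable fun z : κ → ℂ => ENNReal.ofReal (‖c ⬝ᵥ z‖ ^ 2) ^ (-(1 / 2) : ℝ) := by
    unfold dotProduct
    fun_prop
  filter_upwards [ae_lt_top hm hlt.ne] with z hz h0
  simp [h0] at hz

/-- Any choice of as many rows as columns gives a square matrix with independent Gaussian rows,
almost surely invertible because no row charges a hyperplane. -/
theorem ae_rank_eq_gaussMat [DecidableEq κ] (hκ : Fintype.card κ ≤ Fintype.card ι) :
    ∀ᵐ K ∂gaussMat ι κ, K.rank = Fintype.card κ := by
  obtain ⟨e⟩ := Function.Embedding.nonempty_of_card_le hκ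
  have h1 := measurePreserving_comp_injective (Measure.pi fun _ : κ => complexGaussian) e.injective
  have h2 := ae_det_ne_zero (fun _ : κ => gaussVec κ) (g := fun _ z => z)
    (fun _ => measurable_id) fun _ c hc => ae_dotProduct_ne_zero_gaussVec hc
  have h3 := h1.quasiMeasurePreserving.ae h2
  filter_upwards [h3] with K hK
  have hdet : (K.submatrix e id).det ≠ 0 := by
    rw [← Matrix.det_transpose]
    exact hK
  have hinj : Function.Injective K.mulVecLin := by
    refine (injective_iff_map_eq_zero _).2 fun v hv => Matrix.eq_zero_of_mulVec_eq_zero hdet ?_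
    ext j
    exact congrFun hv (e j)
  rw [Matrix.rank, LinearMap.finrank_range_of_inj hinj, Module.finrank_fintype_fun_eq_card]

end FullRank

/-! ### Independence of the choice of frame, and unitary invariance -/

section Frame

variable {ι κ : Type*} [Fintype ι] {k : ℕ}

/-- A measurable choice of an orthonormal frame of `k` vectors orthogonal to the columns. -/
structure IsNullFrame (T : Matrix ι κ ℂ → Matrix ι (Fin k) ℂ) : Prop where
  measurable : Measurable T
  orthonormal : ∀ K, (T K)ᴴ * T K = 1
  null : ∀ K, Kᴴ * T K = 0

theorem IsNullFrame.measurable_mulVec {T : Matrix ι κ ℂ → Matrix ι (Fin k) ℂ}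
    (hT : IsNullFrame T) :
    Measurable fun p : Matrix ι κ ℂ × (Fin k → ℂ) => T p.1 *ᵥ p.2 := by
  have h : Continuous fun p : Matrix ι (Fin k) ℂ × (Fin k → ℂ) => p.1 *ᵥ p.2 := by fun_prop
  exact h.measurable.comp ((hT.measurable.comp measurable_fst).prodMk measurable_snd)

variable [Fintype κ]

open scoped ComplexOrder in
-- By a dimension count the columns of T span the whole kernel of Kᴴ, so T Tᴴ is the projection onto
-- it and fixes T'. The matrix TᴴT' is the change of frame.
theorem mul_conjTranspose_mul_of_null_frame [DecidableEq ι] {K : Matrix ι κ ℂ}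
    {T T' : Matrix ι (Fin k) ℂ} (hcard : Fintype.card κ + k = Fintype.card ι)
    (hK : K.rank = Fintype.card κ) (h1 : Tᴴ * T = 1) (h0 : Kᴴ * T = 0) (h0' : Kᴴ * T' = 0) :
    T * (Tᴴ * T') = T' := by
  have hrange : LinearMap.range T.mulVecLin = LinearMap.ker Kᴴ.mulVecLin := by
    refine Submodule.eq_of_le_of_finrank_eq ?_ ?_
    · rintro _ ⟨x, rfl⟩
      simp [Matrix.mulVec_mulVec, h0]
    · have hinj : Function.Injective T.mulVecLin := by
        refine (injective_iff_map_eq_zero _).2 fun v hv => ?_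
        have : Tᴴ *ᵥ (T *ᵥ v) = 0 := by
          rw [show T *ᵥ v = 0 from hv, Matrix.mulVec_zero]
        rwa [Matrix.mulVec_mulVec, h1, Matrix.one_mulVec] at this
      have hn := LinearMap.finrank_range_add_finrank_ker Kᴴ.mulVecLin
      have hr : Module.finrank ℂ (LinearMap.range Kᴴ.mulVecLin) = Fintype.card κ := by
        rw [← hK, ← Matrix.rank_conjTranspose]
        rfl
      rw [LinearMap.finrank_range_of_inj hinj, Module.finrank_fintype_fun_eq_card, Fintype.card_fin]
      rw [hr, Module.finrank_fintype_fun_eq_card] at hn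
      omega
  ext i j
  have hj : T' *ᵥ Pi.single j 1 ∈ LinearMap.range T.mulVecLin := by
    rw [hrange]
    simp only [LinearMap.mem_ker, Matrix.mulVecLin_apply]
    rw [Matrix.mulVec_mulVec, h0', Matrix.zero_mulVec]
  obtain ⟨y, hy⟩ := hj
  have hy' : T *ᵥ y = T' *ᵥ Pi.single j 1 := hy
  have : (T * (Tᴴ * T')) *ᵥ Pi.single j 1 = T' *ᵥ Pi.single j 1 := by
    rw [← Matrix.mulVec_mulVec, ← Matrix.mulVec_mulVec, ← hy', Matrix.mulVec_mulVec y, h1,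
      Matrix.one_mulVec]
  simpa using congrFun this i

/-- The law of `(K n, T(K) x)`, for a Gaussian matrix `K` and an independent `x` uniform on the
sphere. -/
noncomputable def frameLaw (T : Matrix ι κ ℂ → Matrix ι (Fin k) ℂ) (n : κ → ℂ) :
    Measure ((ι → ℂ) × (ι → ℂ)) :=
  ((gaussMat ι κ).prod (uniformSphere k)).map fun p => (p.1 *ᵥ n, T p.1 *ᵥ p.2)

theorem measurable_mulVec_const (n : κ → ℂ) : Measurable fun K : Matrix ι κ ℂ => K *ᵥ n :=
  (by fun_prop : Continuous fun K : Matrix ι κ ℂ => K *ᵥ n).measurable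

theorem IsNullFrame.measurable_pair {T : Matrix ι κ ℂ → Matrix ι (Fin k) ℂ}
    (hT : IsNullFrame T) (n : κ → ℂ) :
    Measurable fun p : Matrix ι κ ℂ × (Fin k → ℂ) => (p.1 *ᵥ n, T p.1 *ᵥ p.2) :=
  ((measurable_mulVec_const n).comp measurable_fst).prodMk hT.measurable_mulVec

theorem IsNullFrame.isProbabilityMeasure_frameLaw {T : Matrix ι κ ℂ → Matrix ι (Fin k) ℂ}
    (hT : IsNullFrame T) (n : κ → ℂ) : IsProbabilityMeasure (frameLaw T n) :=
  Measure.isProbabilityMeasure_map (hT.measurable_pair n).aemeasurable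

/-- The law of `(K n, T(K) x)` does not depend on the choice of the frame. -/
theorem IsNullFrame.frameLaw_eq [DecidableEq ι] [DecidableEq κ]
    {T T' : Matrix ι κ ℂ → Matrix ι (Fin k) ℂ} (hT : IsNullFrame T) (hT' : IsNullFrame T')
    (hcard : Fintype.card κ + k = Fintype.card ι) (n : κ → ℂ) :
    frameLaw T' n = frameLaw T n := by
  ext S hS
  rw [frameLaw, frameLaw, Measure.map_apply (hT'.measurable_pair n) hS,
    Measure.map_apply (hT.measurable_pair n) hS, Measure.prod_apply (hT'.measurable_pair n hS),
    Measure.prod_apply (hT.measurable_pair n hS)]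
  refine lintegral_congr_ae ?_
  filter_upwards [ae_rank_eq_gaussMat (ι := ι) (κ := κ) (by omega)] with K hK
  have hR := mul_conjTranspose_mul_of_null_frame hcard hK (hT.orthonormal K) (hT.null K)
    (hT'.null K)
  have hRu : ((T K)ᴴ * T' K)ᴴ * ((T K)ᴴ * T' K) = 1 := by
    rw [Matrix.conjTranspose_mul, Matrix.conjTranspose_conjTranspose, Matrix.mul_assoc, hR,
      hT'.orthonormal]
  let R : Matrix.unitaryGroup (Fin k) ℂ := ⟨_, Matrix.mem_unitaryGroup_iff'.2 hRu⟩
  have hmeas : MeasurableSet (Prod.mk K ⁻¹' ((fun p : Matrix ι κ ℂ × (Fin k → ℂ) =>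
      (p.1 *ᵥ n, T p.1 *ᵥ p.2)) ⁻¹' S)) :=
    measurable_prodMk_left (hT.measurable_pair n hS)
  -- For fixed K the second frame is T(K) R with R unitary, and R is absorbed by the uniform vector
  -- x.
  rw [← (measurePreserving_unitary_uniformSphere R).measure_preimage hmeas.nullMeasurableSet]
  congr 1
  ext x
  simp only [Set.mem_preimage, R]
  rw [Matrix.mulVec_mulVec, hR]

theorem IsNullFrame.conj_unitary [DecidableEq ι] {T : Matrix ι κ ℂ → Matrix ι (Fin k) ℂ}
    (hT : IsNullFrame T) (V : Matrix.unitaryGroup ι ℂ) :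
    IsNullFrame fun K => (V : Matrix ι ι ℂ) * T ((V : Matrix ι ι ℂ)ᴴ * K) where
  measurable := by
    have h1 : Continuous fun K : Matrix ι κ ℂ => (V : Matrix ι ι ℂ)ᴴ * K := by fun_prop
    have h2 : Continuous fun K : Matrix ι (Fin k) ℂ => (V : Matrix ι ι ℂ) * K := by fun_prop
    exact h2.measurable.comp (hT.measurable.comp h1.measurable)
  orthonormal K := by
    rw [Matrix.conjTranspose_mul, Matrix.mul_assoc, ← Matrix.mul_assoc _ (V : Matrix ι ι ℂ),
      unitary_conjTranspose_mul, Matrix.one_mul, hT.orthonormal]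
  null K := by
    have h := hT.null ((V : Matrix ι ι ℂ)ᴴ * K)
    rwa [Matrix.conjTranspose_mul, Matrix.conjTranspose_conjTranspose, Matrix.mul_assoc] at h

/-- Applying V to (K n, T(K)x) gives the same construction for the matrix VK, again Gaussian, and
the frame K ↦ V T(VᴴK). By `frameLaw_eq` the change of frame does not alter the law. -/
theorem IsNullFrame.isInvariantPair [DecidableEq ι] [DecidableEq κ]
    {T : Matrix ι κ ℂ → Matrix ι (Fin k) ℂ} (hT : IsNullFrame T)
    (hcard : Fintype.card κ + k = Fintype.card ι) (hk : 0 < k) {n : κ → ℂ} (hn : n ≠ 0) :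
    IsInvariantPair (frameLaw T n) where
  invariant V := by
    have hV : Measurable fun q : (ι → ℂ) × (ι → ℂ) =>
        ((V : Matrix ι ι ℂ) *ᵥ q.1, (V : Matrix ι ι ℂ) *ᵥ q.2) :=
      measurable_unitary_mulVec_pair.comp (measurable_const.prodMk measurable_id)
    refine ⟨hV, ?_⟩
    conv_rhs => rw [← hT.frameLaw_eq (hT.conj_unitary V) hcard n]
    have h := (measurePreserving_unitary_gaussMat (κ := κ) V).prod
      (MeasurePreserving.id (uniformSphere k))
    conv_rhs => rw [frameLaw, ← h.map_eq,
      Measure.map_map ((hT.conj_unitary V).measurable_pair n) h.measurable]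
    rw [frameLaw, Measure.map_map hV (hT.measurable_pair n)]
    congr 1
    ext1 p
    simp only [Function.comp_apply, Prod.map_fst, Prod.map_snd, id_eq]
    rw [← Matrix.mul_assoc, unitary_conjTranspose_mul, Matrix.one_mul, Matrix.mulVec_mulVec,
      Matrix.mulVec_mulVec]
  orthogonal := by
    have hm : MeasurableSet {q : (ι → ℂ) × (ι → ℂ) | star q.1 ⬝ᵥ q.2 = 0} := by
      refine measurableSet_eq_fun ?_ measurable_const
      unfold dotProduct
      simp only [Pi.star_apply]
      fun_prop
    rw [frameLaw, ae_map_iff (hT.measurable_pair n).aemeasurable hm]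
    refine ae_of_all _ fun p => ?_
    rw [Matrix.star_mulVec, ← Matrix.dotProduct_mulVec, Matrix.mulVec_mulVec, hT.null,
      Matrix.zero_mulVec, dotProduct_zero]
  ne_zero := by
    have hm : MeasurableSet {q : (ι → ℂ) × (ι → ℂ) | q.1 ≠ 0 ∧ q.2 ≠ 0} :=
      (measurable_fst (measurableSet_singleton 0)).compl.inter
        (measurable_snd (measurableSet_singleton 0)).compl
    have : Nonempty ι := Fintype.card_pos_iff.1 (by omega)
    let i : ι := Classical.arbitrary ι
    have h1 : MeasurePreserving (fun K : Matrix ι κ ℂ => K i) (gaussMat ι κ) (gaussVec κ) :=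
      measurePreserving_eval (fun _ : ι => Measure.pi fun _ : κ => complexGaussian) i
    rw [frameLaw, ae_map_iff (hT.measurable_pair n).aemeasurable hm]
    have h2 : ∀ᵐ p ∂((gaussMat ι κ).prod (uniformSphere k)), p.1 *ᵥ n ≠ 0 := by
      have := Measure.quasiMeasurePreserving_fst (μ := gaussMat ι κ) (ν := uniformSphere k)
      refine this.ae (p := fun K => K *ᵥ n ≠ 0) ?_
      filter_upwards [h1.quasiMeasurePreserving.ae (ae_dotProduct_ne_zero_gaussVec hn)] with K hK h0
      refine hK ?_
      rw [dotProduct_comm]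
      exact congrFun h0 i
    have h3 : ∀ᵐ p ∂((gaussMat ι κ).prod (uniformSphere k)), normSq p.2 = 2 :=
      Measure.quasiMeasurePreserving_snd.ae (ae_normSq_uniformSphere hk)
    filter_upwards [h2, h3] with p hp hp'
    refine ⟨hp, fun h0 => ?_⟩
    have := normSq_mulVec (hT.orthonormal p.1) p.2
    rw [h0, hp', normSq_eq_zero.2 rfl] at this
    norm_num at this

theorem IsNullFrame.ae_normSq_snd {T : Matrix ι κ ℂ → Matrix ι (Fin k) ℂ}
    (hT : IsNullFrame T) (hk : 0 < k) (n : κ → ℂ) :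
    ∀ᵐ q ∂frameLaw T n, normSq q.2 = 2 := by
  have hm : MeasurableSet {q : (ι → ℂ) × (ι → ℂ) | normSq q.2 = 2} :=
    measurableSet_eq_fun (measurable_normSq.comp measurable_snd) measurable_const
  rw [frameLaw, ae_map_iff (hT.measurable_pair n).aemeasurable hm]
  filter_upwards [Measure.quasiMeasurePreserving_snd.ae (ae_normSq_uniformSphere hk)] with p hp
  rw [normSq_mulVec (hT.orthonormal p.1), hp]

end Frame

/-! ### Small-ball estimates for frames and for the effective channel of one pair -/

section FrameEstimates

theorem normSq_mulVec_le {ι κ : Type*} [Fintype ι] [Fintype κ] (K : Matrix ι κ ℂ) (n : κ → ℂ) :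
    normSq (K *ᵥ n) ≤ (∑ i, normSq (K i)) * normSq n := by
  rw [Finset.sum_mul]
  refine Finset.sum_le_sum fun i _ => ?_
  have := norm_sq_star_dotProduct_le (star (K i)) n
  rw [star_star, normSq_star] at this
  exact this

variable {τ κ : Type*} [Fintype τ] [DecidableEq τ] [Nonempty τ] [Fintype κ] [DecidableEq κ] {k : ℕ}

/-- The direction factor is universal. The norm factor is controlled by a single entry of K n, which
is a linear form of one Gaussian row; hence C depends neither on T nor on n. -/
theorem exists_lintegral_rpow_neg_topDot_frameLaw_le
    (hcard : Fintype.card κ + k = Fintype.card (τ ⊕ τ)) (hk : 0 < k) {θ : ℝ} (h0 : 0 < θ)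
    (h1 : θ < 1) :
    ∃ C : ℝ≥0∞, C < ∞ ∧ ∀ T : Matrix (τ ⊕ τ) κ ℂ → Matrix (τ ⊕ τ) (Fin k) ℂ, IsNullFrame T →
      ∀ n : κ → ℂ, n ≠ 0 →
        ∫⁻ q, ENNReal.ofReal (‖topDot q.1 q.2‖ ^ 2) ^ (-θ) ∂frameLaw T n ≤
          ENNReal.ofReal (normSq n) ^ (-θ) * C := by
  let t : τ := Classical.arbitrary τ
  have hij : (Sum.inl t : τ ⊕ τ) ≠ Sum.inr t := Sum.inl_ne_inr
  refine ⟨(∫⁻ z, ENNReal.ofReal (‖z‖ ^ 2) ^ (-θ) ∂complexGaussian) *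
    pairAverage (Sum.inl t : τ ⊕ τ) (Sum.inr t) (dirMoment θ),
    ENNReal.mul_lt_top (lintegral_norm_sq_rpow_neg_complexGaussian_lt_top h0 h1)
      (pairAverage_dirMoment_lt_top hij h0 h1), fun T hT n hn => ?_⟩
  have := hT.isProbabilityMeasure_frameLaw n
  rw [lintegral_rpow_neg_topDot_of_isInvariantPair hij (hT.isInvariantPair hcard hk hn) θ,
    ← mul_assoc]
  gcongr
  have hn' : star n ≠ 0 := star_ne_zero.2 hn
  have hrow := lintegral_rpow_neg_star_dotProduct_gaussVec hn' θ
  rw [star_star, normSq_star] at hrow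
  have h2 : MeasurePreserving (fun K : Matrix (τ ⊕ τ) κ ℂ => K (Sum.inl t))
      (gaussMat (τ ⊕ τ) κ) (gaussVec κ) :=
    measurePreserving_eval (fun _ : τ ⊕ τ => Measure.pi fun _ : κ => complexGaussian) _
  have hm : Measurable fun z : κ → ℂ => ENNReal.ofReal (‖n ⬝ᵥ z‖ ^ 2) ^ (-θ) := by
    unfold dotProduct
    fun_prop
  have hm2 : Measurable fun q : (τ ⊕ τ → ℂ) × (τ ⊕ τ → ℂ) =>
      ENNReal.ofReal (‖q.1 (Sum.inl t)‖ ^ 2) ^ (-θ) := by fun_prop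
  have hK : ∫⁻ K : Matrix (τ ⊕ τ) κ ℂ, ENNReal.ofReal (‖(K *ᵥ n) (Sum.inl t)‖ ^ 2) ^ (-θ)
      ∂gaussMat (τ ⊕ τ) κ = ∫⁻ z, ENNReal.ofReal (‖n ⬝ᵥ z‖ ^ 2) ^ (-θ) ∂gaussVec κ := by
    rw [← h2.lintegral_comp hm]
    refine lintegral_congr fun K => ?_
    rw [dotProduct_comm]
    rfl
  have hm3 : Measurable fun K : Matrix (τ ⊕ τ) κ ℂ =>
      ENNReal.ofReal (‖(K *ᵥ n) (Sum.inl t)‖ ^ 2) ^ (-θ) :=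
    ((((measurable_pi_apply _).comp
      (measurable_mulVec_const n)).norm.pow_const 2).ennreal_ofReal).pow_const _
  rw [← hrow, ← hK,
    ← (measurePreserving_fst (μ := gaussMat (τ ⊕ τ) κ) (ν := uniformSphere k)).lintegral_comp hm3]
  calc _ ≤ ∫⁻ q, ENNReal.ofReal (‖q.1 (Sum.inl t)‖ ^ 2) ^ (-θ) ∂frameLaw T n := by
        refine lintegral_mono_ae ?_
        filter_upwards [hT.ae_normSq_snd hk n] with q hq
        refine rpow_neg_ofReal_anti h0 ?_
        rw [hq]
        linarith [norm_sq_le_normSq q.1 (Sum.inl t), normSq_nonneg q.1]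
    _ = _ := by
        rw [frameLaw, lintegral_map hm2 (hT.measurable_pair n)]

/-- The norm of K n is at most a fixed multiple of that of n with positive probability, uniformly in
n, through the Frobenius norm of K. Independence of norm and direction then transfers the universal
small-ball bound. -/
theorem exists_le_frameLaw_small (hcard : Fintype.card κ + k = Fintype.card (τ ⊕ τ))
    (hk : 0 < k) :
    ∃ c : ℝ, 0 < c ∧ ∀ T : Matrix (τ ⊕ τ) κ ℂ → Matrix (τ ⊕ τ) (Fin k) ℂ, IsNullFrame T →
      ∀ n : κ → ℂ, n ≠ 0 → ∀ s : ℝ, 0 < s → s ≤ 1 →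
        ENNReal.ofReal (c * s) ≤
          frameLaw T n {q | ‖topDot q.1 q.2‖ ^ 2 < s * normSq n * botSq q.2} := by
  let t : τ := Classical.arbitrary τ
  have hij : (Sum.inl t : τ ⊕ τ) ≠ Sum.inr t := Sum.inl_ne_inr
  obtain ⟨c, hc, hle⟩ := exists_le_pairAverage_smallSet hij
  let frob : Matrix (τ ⊕ τ) κ ℂ → ℝ := fun K => ∑ i, normSq (K i)
  have hfrob : Measurable frob := Finset.measurable_sum _ fun i _ =>
    measurable_normSq.comp (measurable_pi_apply i)
  -- L + 1 instead of L ensures a positive divisor and s/(L+1) ≤ 1.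
  obtain ⟨L, hL⟩ : ∃ L : ℕ, 0 < gaussMat (τ ⊕ τ) κ {K | frob K ≤ L + 1} := by
    by_contra hcon
    push Not at hcon
    have hzero : gaussMat (τ ⊕ τ) κ (⋃ L : ℕ, {K | frob K ≤ L + 1}) = 0 :=
      measure_iUnion_null fun L => nonpos_iff_eq_zero.1 (hcon L)
    have huniv : (⋃ L : ℕ, {K : Matrix (τ ⊕ τ) κ ℂ | frob K ≤ L + 1}) = Set.univ := by
      refine Set.eq_univ_of_forall fun K => Set.mem_iUnion.2 ?_
      obtain ⟨L, hL⟩ := exists_nat_ge (frob K)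
      exact ⟨L, hL.trans (by linarith)⟩
    rw [huniv, measure_univ] at hzero
    exact one_ne_zero hzero
  set p := (gaussMat (τ ⊕ τ) κ {K | frob K ≤ L + 1}).toReal with hp
  have hp0 : 0 < p := ENNReal.toReal_pos hL.ne' (measure_ne_top _ _)
  have hL1 : (0 : ℝ) < L + 1 := by positivity
  refine ⟨p * (c / (L + 1)), by positivity, fun T hT n hn s hs hs1 => ?_⟩
  have := hT.isProbabilityMeasure_frameLaw n
  have hkey := measure_inter_smallSet_of_isInvariantPair hij (hT.isInvariantPair hcard hk hn)
    (s / (L + 1)) (measurableSet_Iic (a := (L + 1) * normSq n))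
  have hs' : s / (L + 1) ≤ 1 := by
    rw [div_le_one hL1]
    linarith [(Nat.cast_nonneg L : (0 : ℝ) ≤ L)]
  calc ENNReal.ofReal (p * (c / (L + 1)) * s)
      = ENNReal.ofReal p * ENNReal.ofReal (c * (s / (L + 1))) := by
        rw [← ENNReal.ofReal_mul hp0.le]
        congr 1
        ring
    _ ≤ frameLaw T n {q | normSq q.1 ∈ Set.Iic ((L + 1) * normSq n)} *
        pairAverage (Sum.inl t : τ ⊕ τ) (Sum.inr t) ((smallSet (s / (L + 1))).indicator 1) := by
        refine mul_le_mul' ?_ (hle _ (by positivity) hs')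
        have hm : MeasurableSet {q : (τ ⊕ τ → ℂ) × (τ ⊕ τ → ℂ) |
            normSq q.1 ∈ Set.Iic ((L + 1) * normSq n)} :=
          (measurable_normSq.comp measurable_fst) measurableSet_Iic
        rw [hp, ENNReal.ofReal_toReal (measure_ne_top _ _), frameLaw,
          Measure.map_apply (hT.measurable_pair n) hm,
          ← (measurePreserving_fst (μ := gaussMat (τ ⊕ τ) κ)
            (ν := uniformSphere k)).measure_preimage
            (measurableSet_le hfrob measurable_const).nullMeasurableSet]
        refine measure_mono fun q hq => ?_
        have hq' : frob q.1 ≤ L + 1 := hq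
        exact (normSq_mulVec_le q.1 n).trans (mul_le_mul_of_nonneg_right hq' (normSq_nonneg n))
    _ = _ := hkey.symm
    _ ≤ _ := by
        refine measure_mono fun q hq => ?_
        obtain ⟨h1, h2⟩ := hq
        have h1' : normSq q.1 ≤ (L + 1) * normSq n := h1
        have h2' : ‖topDot q.1 q.2‖ ^ 2 < s / (L + 1) * (normSq q.1 * botSq q.2) := h2
        refine h2'.trans_le ?_
        have hb := botSq_nonneg q.2
        calc s / (L + 1) * (normSq q.1 * botSq q.2)
            ≤ s / (L + 1) * ((L + 1) * normSq n * botSq q.2) := by gcongr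
          _ = s * normSq n * botSq q.2 := by field_simp

end FrameEstimates

/-! ### The effective channel of one pair -/

section PairChannel

variable {M N : ℕ}

/-- The random quantities of one pair of users: two channel matrices and the vector `x`. -/
abbrev PairData (M N : ℕ) : Type := Channel N M × Channel N M × (Fin (2 * N - M) → ℂ)

/-- The law of the random quantities of one pair. -/
noncomputable def pairLaw (M N : ℕ) : Measure (PairData M N) :=
  (rayleigh N M).prod ((rayleigh N M).prod (uniformSphere (2 * N - M)))

instance isProbabilityMeasure_rayleigh : IsProbabilityMeasure (rayleigh N M) :=
  isProbabilityMeasure_gaussMat (ι := Fin N) (κ := Fin M)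

instance isProbabilityMeasure_pairLaw : IsProbabilityMeasure (pairLaw M N) := by
  unfold pairLaw
  infer_instance

variable (U : Channel N M → Channel N M → Matrix (Fin N ⊕ Fin N) (Fin (2 * N - M)) ℂ)

/-- The effective channel vector of a pair. -/
noncomputable def pairEff (y : PairData M N) : Fin M → ℂ :=
  y.1ᴴ *ᵥ fun n => (U y.1 y.2.1 *ᵥ y.2.2) (Sum.inl n)

/-- The detection vector of the far user of a pair. -/
noncomputable def pairFar (y : PairData M N) : Fin N → ℂ :=
  fun n => (U y.1 y.2.1 *ᵥ y.2.2) (Sum.inr n)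

/-- The frame with the sign of the second block reversed, as a function of the stacked matrix. -/
def stackFrame (K : Matrix (Fin N ⊕ Fin N) (Fin M) ℂ) :
    Matrix (Fin N ⊕ Fin N) (Fin (2 * N - M)) ℂ :=
  Matrix.fromRows (U K.toRows₁ K.toRows₂).toRows₁ (-(U K.toRows₁ K.toRows₂).toRows₂)

variable {U}

/-- Moving the minus sign from [Aᴴ -A'ᴴ] to the lower half of the frame preserves orthonormality and
turns the alignment condition into orthogonality to the columns of the stacked matrix. -/
theorem isNullFrame_stackFrame (hU : IsAlignment U) : IsNullFrame (stackFrame U) where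
  measurable := by
    have h1 : Measurable fun K : Matrix (Fin N ⊕ Fin N) (Fin M) ℂ => K.toRows₁ :=
      measurable_matrix_of fun i j => (measurable_pi_apply j).comp (measurable_pi_apply (Sum.inl i))
    have h2 : Measurable fun K : Matrix (Fin N ⊕ Fin N) (Fin M) ℂ => K.toRows₂ :=
      measurable_matrix_of fun i j => (measurable_pi_apply j).comp (measurable_pi_apply (Sum.inr i))
    have h3 := hU.measurable.comp (h1.prodMk h2)
    refine measurable_matrix_of fun i j => ?_
    cases i with
    | inl i => exact (measurable_pi_apply j).comp ((measurable_pi_apply (Sum.inl i)).comp h3)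
    | inr i => exact ((measurable_pi_apply j).comp ((measurable_pi_apply (Sum.inr i)).comp h3)).neg
  orthonormal K := by
    rw [← hU.orthonormal K.toRows₁ K.toRows₂]
    ext i j
    simp [Matrix.mul_apply, Fintype.sum_sum_type, stackFrame]
  null K := by
    rw [← hU.null K.toRows₁ K.toRows₂]
    ext i j
    simp [Matrix.mul_apply, Fintype.sum_sum_type, stackFrame]

theorem measurePreserving_stack : MeasurePreserving
    (fun y : PairData M N => (Matrix.fromRows y.1 y.2.1, y.2.2)) (pairLaw M N)
    ((gaussMat (Fin N ⊕ Fin N) (Fin M)).prod (uniformSphere (2 * N - M))) := by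
  have h1 : MeasurePreserving (fun p : Channel N M × Channel N M => Matrix.fromRows p.1 p.2)
      ((rayleigh N M).prod (rayleigh N M)) (gaussMat (Fin N ⊕ Fin N) (Fin M)) := by
    have h := measurePreserving_sumPiEquivProdPi_symm
      (fun _ : Fin N ⊕ Fin N => Measure.pi fun _ : Fin M => complexGaussian)
    have he : ∀ p : (Fin N → Fin M → ℂ) × (Fin N → Fin M → ℂ),
        (MeasurableEquiv.sumPiEquivProdPi fun _ : Fin N ⊕ Fin N => Fin M → ℂ).symm p =
          Matrix.fromRows (Matrix.of p.1) (Matrix.of p.2) := by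
      intro p
      ext i j
      cases i <;> rfl
    have hf := funext he
    rw [hf] at h
    exact h
  have hP : SFinite (uniformSphere (2 * N - M)) := inferInstance
  have h2 := (measurePreserving_prodAssoc (rayleigh N M) (rayleigh N M)
    (uniformSphere (2 * N - M))).symm
  exact (h1.prod (MeasurePreserving.id _)).comp h2

/-- As c·Aᴴv is the Hermitian product of A c̄ with v, a linear form of the effective channel is
`topDot` of an orthogonal pair. The sign change affects only the second block. -/
theorem topDot_stack (c : Fin M → ℂ) (y : PairData M N) :
    topDot (Matrix.fromRows y.1 y.2.1 *ᵥ star c)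
      (stackFrame U (Matrix.fromRows y.1 y.2.1) *ᵥ y.2.2) = c ⬝ᵥ pairEff U y := by
  have h : c ⬝ᵥ pairEff U y =
      (star (y.1 *ᵥ star c)) ⬝ᵥ fun n => (U y.1 y.2.1 *ᵥ y.2.2) (Sum.inl n) := by
    rw [Matrix.star_mulVec, star_star, ← Matrix.dotProduct_mulVec]
    rfl
  rw [h]
  simp [topDot, dotProduct, stackFrame, Matrix.mulVec]

theorem botSq_stack (y : PairData M N) :
    botSq (stackFrame U (Matrix.fromRows y.1 y.2.1) *ᵥ y.2.2) = normSq (pairFar U y) := by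
  simp [botSq, normSq, stackFrame, pairFar, Matrix.mulVec, dotProduct]

theorem frameLaw_stackFrame (hU : IsAlignment U) (c : Fin M → ℂ) :
    frameLaw (stackFrame U) (star c) = (pairLaw M N).map fun y =>
      (Matrix.fromRows y.1 y.2.1 *ᵥ star c,
        stackFrame U (Matrix.fromRows y.1 y.2.1) *ᵥ y.2.2) := by
  rw [frameLaw, ← measurePreserving_stack.map_eq,
    Measure.map_map ((isNullFrame_stackFrame hU).measurable_pair _)
      measurePreserving_stack.measurable]
  rfl

theorem measurable_stack_pair (hU : IsAlignment U) (c : Fin M → ℂ) :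
    Measurable fun y : PairData M N => (Matrix.fromRows y.1 y.2.1 *ᵥ star c,
      stackFrame U (Matrix.fromRows y.1 y.2.1) *ᵥ y.2.2) :=
  ((isNullFrame_stackFrame hU).measurable_pair _).comp measurePreserving_stack.measurable

/-- Negative moments of a linear form of the effective channel vector. -/
theorem exists_lintegral_rpow_neg_pairEff_le (hMN : M < 2 * N) {θ : ℝ} (h0 : 0 < θ)
    (h1 : θ < 1) :
    ∃ C : ℝ≥0∞, C < ∞ ∧
      ∀ U : Channel N M → Channel N M → Matrix (Fin N ⊕ Fin N) (Fin (2 * N - M)) ℂ,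
      IsAlignment U → ∀ c : Fin M → ℂ, c ≠ 0 →
        ∫⁻ y, ENNReal.ofReal (‖c ⬝ᵥ pairEff U y‖ ^ 2) ^ (-θ) ∂pairLaw M N ≤
          ENNReal.ofReal (normSq c) ^ (-θ) * C := by
  have : Nonempty (Fin N) := ⟨⟨0, by omega⟩⟩
  obtain ⟨C, hC, h⟩ := exists_lintegral_rpow_neg_topDot_frameLaw_le (τ := Fin N) (κ := Fin M)
    (k := 2 * N - M) (by simp; omega) (by omega) h0 h1
  refine ⟨C, hC, fun U hU c hc => ?_⟩
  have h' := h _ (isNullFrame_stackFrame hU) (star c) (star_ne_zero.2 hc)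
  rw [normSq_star, frameLaw_stackFrame hU, lintegral_map
    (((measurable_topDot.norm.pow_const 2).ennreal_ofReal).pow_const _)
    (measurable_stack_pair hU c)] at h'
  simp only [topDot_stack] at h'
  exact h'

/-- Small-ball lower bound for a linear form of the effective channel vector, relative to the
detection vector of the far user. -/
theorem exists_le_pairLaw_small (hMN : M < 2 * N) :
    ∃ c₀ : ℝ, 0 < c₀ ∧
      ∀ U : Channel N M → Channel N M → Matrix (Fin N ⊕ Fin N) (Fin (2 * N - M)) ℂ,
      IsAlignment U → ∀ c : Fin M → ℂ, c ≠ 0 → ∀ s : ℝ, 0 < s → s ≤ 1 →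
        ENNReal.ofReal (c₀ * s) ≤
          pairLaw M N {y | ‖c ⬝ᵥ pairEff U y‖ ^ 2 < s * normSq c * normSq (pairFar U y)} := by
  have : Nonempty (Fin N) := ⟨⟨0, by omega⟩⟩
  obtain ⟨c₀, hc₀, h⟩ := exists_le_frameLaw_small (τ := Fin N) (κ := Fin M)
    (k := 2 * N - M) (by simp; omega) (by omega)
  refine ⟨c₀, hc₀, fun U hU c hc s hs hs1 => ?_⟩
  have h' := h _ (isNullFrame_stackFrame hU) (star c) (star_ne_zero.2 hc) s hs hs1
  have hm : MeasurableSet {q : (Fin N ⊕ Fin N → ℂ) × (Fin N ⊕ Fin N → ℂ) |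
      ‖topDot q.1 q.2‖ ^ 2 < s * normSq (star c) * botSq q.2} :=
    measurableSet_lt (measurable_topDot.norm.pow_const 2)
      ((measurable_botSq.comp measurable_snd).const_mul _)
  rw [frameLaw_stackFrame hU, Measure.map_apply (measurable_stack_pair hU c) hm] at h'
  simp only [Set.preimage_ofPred_eq, topDot_stack, botSq_stack, normSq_star] at h'
  exact h'

theorem measurable_pairVec (hU : IsAlignment U) :
    Measurable fun y : PairData M N => U y.1 y.2.1 *ᵥ y.2.2 := by
  have h : Continuous fun p : Matrix (Fin N ⊕ Fin N) (Fin (2 * N - M)) ℂ ×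
      (Fin (2 * N - M) → ℂ) => p.1 *ᵥ p.2 := by fun_prop
  exact h.measurable.comp ((hU.measurable.comp
    (measurable_fst.prodMk (measurable_fst.comp measurable_snd))).prodMk
      (measurable_snd.comp measurable_snd))

theorem measurable_pairEff (hU : IsAlignment U) : Measurable (pairEff U) := by
  refine measurable_pi_lambda _ fun j => ?_
  have hj : (fun y : PairData M N => pairEff U y j) = fun y => ∑ n,
      star (y.1 n j) * (U y.1 y.2.1 *ᵥ y.2.2) (Sum.inl n) := by
    ext y
    simp [pairEff, Matrix.mulVec, dotProduct]
  rw [hj]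
  refine Finset.measurable_sum _ fun n _ => Measurable.mul ?_ ?_
  · have h1 : Measurable fun A : Channel N M => A n j :=
      (measurable_pi_apply j).comp (measurable_pi_apply n)
    exact continuous_star.measurable.comp (h1.comp measurable_fst)
  · exact (measurable_pi_apply (Sum.inl n)).comp (measurable_pairVec hU)

theorem measurable_pairFar (hU : IsAlignment U) : Measurable (pairFar U) :=
  measurable_pi_lambda _ fun n => (measurable_pi_apply (Sum.inr n)).comp (measurable_pairVec hU)

theorem ae_dotProduct_pairEff_ne_zero (hMN : M < 2 * N) (hU : IsAlignment U) {c : Fin M → ℂ}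
    (hc : c ≠ 0) : ∀ᵐ y ∂pairLaw M N, c ⬝ᵥ pairEff U y ≠ 0 := by
  obtain ⟨C, hC, h⟩ := exists_lintegral_rpow_neg_pairEff_le hMN (θ := 1 / 2) (by norm_num)
    (by norm_num)
  have hlt : ∫⁻ y, ENNReal.ofReal (‖c ⬝ᵥ pairEff U y‖ ^ 2) ^ (-(1 / 2) : ℝ) ∂pairLaw M N < ∞ := by
    refine (h U hU c hc).trans_lt (ENNReal.mul_lt_top ?_ hC)
    rw [ENNReal.rpow_neg]
    exact ENNReal.inv_lt_top.2 (ENNReal.rpow_pos (ENNReal.ofReal_pos.2 (normSq_pos hc))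
      ENNReal.ofReal_ne_top)
  have hm : Measurable fun z : Fin M → ℂ => ENNReal.ofReal (‖c ⬝ᵥ z‖ ^ 2) ^ (-(1 / 2) : ℝ) := by
    unfold dotProduct
    fun_prop
  filter_upwards [ae_lt_top (hm.comp (measurable_pairEff hU)) hlt.ne] with z hz h0
  simp [h0] at hz

end PairChannel

/-! ### The zero-forcing gain -/

section ZeroForcing

variable {M N : ℕ}
  (U : Fin M → Channel N M → Channel N M → Matrix (Fin N ⊕ Fin N) (Fin (2 * N - M)) ℂ)

/-- The effective channel matrix as a function of the data of all pairs. -/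
noncomputable def pairsMatrix (y : Fin M → PairData M N) : Matrix (Fin M) (Fin M) ℂ :=
  Matrix.of fun j i => pairEff (U i) (y i) j

/-- `(G⁻¹ G⁻ᴴ)_{m,m}` as a function of the data of all pairs. -/
noncomputable def pairsDiag (m : Fin M) (y : Fin M → PairData M N) : ℝ :=
  normSq ((pairsMatrix U y).adjugate m) / ‖(pairsMatrix U y).det‖ ^ 2

theorem zfDiag_eq_pairsDiag (G G' : Fin M → Channel N M) (x : Fin M → Fin (2 * N - M) → ℂ)
    (m : Fin M) : zfDiag U G G' x m = pairsDiag U m fun i => (G i, G' i, x i) :=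
  inv_mul_inv_conjTranspose_diag_re _ m

theorem pairsDiag_nonneg (m : Fin M) (y : Fin M → PairData M N) : 0 ≤ pairsDiag U m y :=
  div_nonneg (normSq_nonneg _) (sq_nonneg _)

theorem pairsMatrix_update (m : Fin M) (y : Fin M → PairData M N) (t : PairData M N) :
    pairsMatrix U (Function.update y m t) = (pairsMatrix U y).updateCol m (pairEff (U m) t) := by
  ext j i
  by_cases hi : i = m
  · subst hi
    simp [pairsMatrix]
  · simp [pairsMatrix, hi]

/-- Only the determinant sees pair m, and it is linear in column m with coefficients the cofactors.
-/
theorem pairsDiag_update (m : Fin M) (y : Fin M → PairData M N) (t : PairData M N) :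
    pairsDiag U m (Function.update y m t) = normSq ((pairsMatrix U y).adjugate m) /
      ‖(pairsMatrix U y).adjugate m ⬝ᵥ pairEff (U m) t‖ ^ 2 := by
  rw [pairsDiag, pairsMatrix_update, adjugate_updateCol_self, det_updateCol_eq_adjugate_dotProduct]

variable {U}

theorem measurable_pairsMatrix (hU : ∀ i, IsAlignment (U i)) : Measurable (pairsMatrix U) :=
  measurable_matrix_of fun j i =>
    (measurable_pi_apply j).comp ((measurable_pairEff (hU i)).comp (measurable_pi_apply i))

theorem measurable_pairsDiag (hU : ∀ i, IsAlignment (U i)) (m : Fin M) :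
    Measurable (pairsDiag U m) := by
  have h1 : Measurable fun A : Matrix (Fin M) (Fin M) ℂ => A.adjugate :=
    (continuous_id.matrix_adjugate).measurable
  have h2 : Measurable fun A : Matrix (Fin M) (Fin M) ℂ => A.adjugate m :=
    (measurable_pi_apply m).comp h1
  exact ((measurable_normSq.comp h2).comp (measurable_pairsMatrix hU)).div
    ((measurable_det.comp (measurable_pairsMatrix hU)).norm.pow_const 2)

theorem ae_det_pairsMatrix_ne_zero (hMN : M < 2 * N) (hU : ∀ i, IsAlignment (U i)) :
    ∀ᵐ y ∂Measure.pi fun _ : Fin M => pairLaw M N, (pairsMatrix U y).det ≠ 0 :=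
  ae_det_ne_zero (fun _ : Fin M => pairLaw M N) (fun i => measurable_pairEff (hU i))
    fun i _ hc => ae_dotProduct_pairEff_ne_zero hMN (hU i) hc

theorem pairsDiag_ne_zero {m : Fin M} {y : Fin M → PairData M N}
    (h : (pairsMatrix U y).det ≠ 0) : pairsDiag U m y ≠ 0 := by
  have hc : (pairsMatrix U y).adjugate m ≠ 0 := by
    intro h0
    rw [← adjugate_dotProduct_col _ m, h0, zero_dotProduct] at h
    exact h rfl
  exact (div_pos (normSq_pos hc) (by positivity)).ne'

/-- With the other pairs fixed, the moment over pair m is at most a universal constant: the power of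
|c| in the numerator cancels the one in the bound for the linear form. -/
theorem lintegral_pairsDiag_rpow_lt_top (hMN : M < 2 * N) (hU : ∀ i, IsAlignment (U i))
    (m : Fin M) {θ : ℝ} (h0 : 0 < θ) (h1 : θ < 1) :
    ∫⁻ y, ENNReal.ofReal (pairsDiag U m y) ^ θ ∂(Measure.pi fun _ : Fin M => pairLaw M N) < ∞ := by
  obtain ⟨C, hC, h⟩ := exists_lintegral_rpow_neg_pairEff_le hMN h0 h1
  have hm : Measurable fun y : Fin M → PairData M N => ENNReal.ofReal (pairsDiag U m y) ^ θ :=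
    (measurable_pairsDiag hU m).ennreal_ofReal.pow_const _
  have hup := measurePreserving_update (fun _ : Fin M => pairLaw M N) m
  rw [← hup.lintegral_comp hm,
    lintegral_prod (fun p : (Fin M → PairData M N) × PairData M N =>
      ENNReal.ofReal (pairsDiag U m (Function.update p.1 m p.2)) ^ θ)
      (hm.comp hup.measurable).aemeasurable]
  refine lt_of_le_of_lt (b := ∫⁻ _, C ∂(Measure.pi fun _ : Fin M => pairLaw M N))
    (lintegral_mono fun y => ?_) (by simpa using hC)
  simp only [pairsDiag_update]
  set c := (pairsMatrix U y).adjugate m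
  by_cases hc : c = 0
  · simp [hc, normSq_eq_zero.2 rfl, h0]
  have hcp := normSq_pos hc
  have hm2 : Measurable fun t => ENNReal.ofReal (‖c ⬝ᵥ pairEff (U m) t‖ ^ 2) ^ (-θ) := by
    have : Measurable fun z : Fin M → ℂ => ENNReal.ofReal (‖c ⬝ᵥ z‖ ^ 2) ^ (-θ) := by
      unfold dotProduct
      fun_prop
    exact this.comp (measurable_pairEff (hU m))
  calc _ ≤ ∫⁻ t, ENNReal.ofReal (normSq c) ^ θ *
        ENNReal.ofReal (‖c ⬝ᵥ pairEff (U m) t‖ ^ 2) ^ (-θ) ∂pairLaw M N := by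
        refine lintegral_mono_ae ?_
        filter_upwards [ae_dotProduct_pairEff_ne_zero hMN (hU m) hc] with t ht
        rw [ENNReal.ofReal_div_of_pos (by positivity), ENNReal.div_rpow_of_nonneg _ _ h0.le,
          ENNReal.rpow_neg, div_eq_mul_inv]
    _ = ENNReal.ofReal (normSq c) ^ θ *
        ∫⁻ t, ENNReal.ofReal (‖c ⬝ᵥ pairEff (U m) t‖ ^ 2) ^ (-θ) ∂pairLaw M N :=
        lintegral_const_mul _ hm2
    _ ≤ ENNReal.ofReal (normSq c) ^ θ * (ENNReal.ofReal (normSq c) ^ (-θ) * C) := by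
        gcongr
        exact h (U m) (hU m) c hc
    _ = C := by
        rw [← mul_assoc, ← ENNReal.rpow_add _ _ (ENNReal.ofReal_pos.2 hcp).ne'
          ENNReal.ofReal_ne_top, add_neg_cancel, ENNReal.rpow_zero, one_mul]

/-- Resampling pair m reduces the claim to `exists_le_pairLaw_small` with fixed c. The alternative
`pairsDiag = 0` covers c = 0 and will count as outage, the gain being 0 by convention. -/
theorem exists_le_pairs_small (hMN : M < 2 * N) (hU : ∀ i, IsAlignment (U i)) (m : Fin M) :
    ∃ c₀ : ℝ, 0 < c₀ ∧ ∀ s : ℝ, 0 < s → s ≤ 1 →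
      ENNReal.ofReal (c₀ * s) ≤ (Measure.pi fun _ : Fin M => pairLaw M N)
        {y | pairsDiag U m y = 0 ∨
          (pairsDiag U m y)⁻¹ < s * normSq (pairFar (U m) (y m))} := by
  obtain ⟨c₀, hc₀, h⟩ := exists_le_pairLaw_small hMN
  -- For c = 0 the section is the whole space, and its probability 1 must still dominate the
  -- constant times s.
  refine ⟨min c₀ 1, lt_min hc₀ one_pos, fun s hs hs1 => ?_⟩
  have hS : MeasurableSet {y : Fin M → PairData M N | pairsDiag U m y = 0 ∨
      (pairsDiag U m y)⁻¹ < s * normSq (pairFar (U m) (y m))} :=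
    (measurableSet_eq_fun (measurable_pairsDiag hU m) measurable_const).union
      (measurableSet_lt (measurable_pairsDiag hU m).inv
        ((measurable_normSq.comp ((measurable_pairFar (hU m)).comp
          (measurable_pi_apply m))).const_mul s))
  have hup := measurePreserving_update (fun _ : Fin M => pairLaw M N) m
  rw [← hup.measure_preimage hS.nullMeasurableSet, Measure.prod_apply (hup.measurable hS)]
  have hconst : ENNReal.ofReal (min c₀ 1 * s) = ∫⁻ _, ENNReal.ofReal (min c₀ 1 * s)
      ∂(Measure.pi fun _ : Fin M => pairLaw M N) := by simp
  rw [hconst]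
  refine lintegral_mono fun y => ?_
  set c := (pairsMatrix U y).adjugate m with hcdef
  by_cases hc : c = 0
  · have huniv : Prod.mk y ⁻¹' ((fun p : (Fin M → PairData M N) × PairData M N =>
        Function.update p.1 m p.2) ⁻¹' {y | pairsDiag U m y = 0 ∨
          (pairsDiag U m y)⁻¹ < s * normSq (pairFar (U m) (y m))}) = Set.univ := by
      refine Set.eq_univ_of_forall fun t => Or.inl ?_
      change pairsDiag U m (Function.update y m t) = 0
      rw [pairsDiag_update, ← hcdef, hc, normSq_eq_zero.2 rfl, zero_div]
    rw [huniv, measure_univ]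
    refine ENNReal.ofReal_le_one.2 ?_
    nlinarith [min_le_right c₀ 1, lt_min hc₀ one_pos]
  · refine (ENNReal.ofReal_le_ofReal (mul_le_mul_of_nonneg_right (min_le_left c₀ 1) hs.le)).trans
      ((h (U m) (hU m) c hc s hs hs1).trans (measure_mono fun t ht => Or.inr ?_))
    change (pairsDiag U m (Function.update y m t))⁻¹ <
      s * normSq (pairFar (U m) (Function.update y m t m))
    have ht' : ‖c ⬝ᵥ pairEff (U m) t‖ ^ 2 < s * normSq c * normSq (pairFar (U m) t) := ht
    rw [pairsDiag_update, ← hcdef, inv_div, Function.update_self, div_lt_iff₀ (normSq_pos hc)]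
    linarith

/-- Collecting the data of the pairs. -/
theorem measurePreserving_pairs (k : ℕ) :
    MeasurePreserving (fun (q : (Fin M → Channel N M) × (Fin M → Channel N M) ×
        (Fin M → Fin k → ℂ)) i => (q.1 i, q.2.1 i, q.2.2 i))
      ((Measure.pi fun _ => rayleigh N M).prod ((Measure.pi fun _ => rayleigh N M).prod
        (Measure.pi fun _ => uniformSphere k)))
      (Measure.pi fun _ => (rayleigh N M).prod ((rayleigh N M).prod (uniformSphere k))) := by
  have h1 := (measurePreserving_arrowProdEquivProdArrow (Channel N M) (Fin k → ℂ) (Fin M)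
    (fun _ => rayleigh N M) (fun _ => uniformSphere k)).symm
  have h2 := (measurePreserving_arrowProdEquivProdArrow (Channel N M)
    (Channel N M × (Fin k → ℂ)) (Fin M) (fun _ => rayleigh N M)
    (fun _ => (rayleigh N M).prod (uniformSphere k))).symm
  exact h2.comp ((MeasurePreserving.id _).prod h1)

end ZeroForcing

/-! ### Interference -/

section Interference

theorem lintegral_natCast_poissonMeasure (r : ℝ≥0) :
    ∫⁻ n : ℕ, (n : ℝ≥0∞) ∂poissonMeasure r = r := by
  have hsum := (hasSum_one_poissonMeasure r)
  have hone : ∑' n : ℕ, ENNReal.ofReal (Real.exp (-r) * r ^ n / n.factorial) = 1 := by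
    rw [← ENNReal.ofReal_tsum_of_nonneg (fun n => by positivity) hsum.summable, hsum.tsum_eq,
      ENNReal.ofReal_one]
  rw [poissonMeasure, lintegral_sum_measure]
  simp only [lintegral_smul_measure, lintegral_dirac, smul_eq_mul]
  rw [tsum_eq_zero_add' ENNReal.summable]
  have hstep (n : ℕ) : ENNReal.ofReal (Real.exp (-r) * r ^ (n + 1) / (n + 1).factorial) *
      ((n + 1 : ℕ) : ℝ≥0∞) =
      r * ENNReal.ofReal (Real.exp (-r) * r ^ n / n.factorial) := by
    rw [← ENNReal.ofReal_natCast, ← ENNReal.ofReal_mul (by positivity), ← ENNReal.ofReal_coe_nnreal,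
      ← ENNReal.ofReal_mul (by positivity), Nat.factorial_succ]
    congr 1
    push_cast
    field_simp
    ring
  simp_rw [hstep]
  rw [ENNReal.tsum_mul_left, hone]
  simp

variable {Ω : Type*} [MeasurableSpace Ω] {μ : Measure Ω} {lam : ℝ≥0} {Ψ : Ω → Set Plane}

theorem IsPoissonProcess.lintegral_count (h : IsPoissonProcess μ lam Ψ) {B : Set Plane}
    (hB : MeasurableSet B) (hfin : volume B ≠ ∞) :
    ∫⁻ ω, points (Ψ ω) B ∂μ = lam * volume B := by
  have hl := h.count_law B hB hfin
  have := hl.lintegral_comp (f := id) measurable_id.aemeasurable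
  simp only [id_eq] at this
  rw [this, lintegral_map measurable_id' .of_discrete]
  rw [lintegral_natCast_poissonMeasure, ENNReal.coe_mul, ENNReal.coe_toNNReal hfin]

/-- The intensity measure of a homogeneous Poisson process. -/
theorem IsPoissonProcess.join_eq (h : IsPoissonProcess μ lam Ψ) :
    (μ.map fun ω => points (Ψ ω)).join = lam • (volume : Measure Plane) := by
  have hfin (B : Set Plane) (hB : MeasurableSet B) (hv : volume B ≠ ∞) :
      (μ.map fun ω => points (Ψ ω)).join B = (lam • (volume : Measure Plane)) B := by
    rw [Measure.join_apply hB, lintegral_map (Measure.measurable_coe hB) h.measurable,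
      h.lintegral_count hB hv]
    rfl
  -- The counting law is available only for sets of finite area, so the plane is exhausted by such
  -- sets.
  refine Measure.ext_iff_of_iUnion_eq_univ
    (iUnion_spanningSets (volume : Measure Plane)) |>.2 fun n => ?_
  ext B hB
  rw [Measure.restrict_apply hB, Measure.restrict_apply hB]
  refine hfin _ (hB.inter (measurableSet_spanningSets _ n)) (ne_top_of_le_ne_top ?_
    (measure_mono Set.inter_subset_right))
  exact (measure_spanningSets_lt_top _ n).ne

/-- Campbell's formula: the mean of the random counting measures is the intensity measure. -/
theorem IsPoissonProcess.lintegral_lintegral (h : IsPoissonProcess μ lam Ψ) {f : Plane → ℝ≥0∞}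
    (hf : Measurable f) :
    ∫⁻ ω, ∫⁻ y, f y ∂points (Ψ ω) ∂μ = lam * ∫⁻ y, f y := by
  have h1 := Measure.lintegral_join (m := μ.map fun ω => points (Ψ ω)) hf.aemeasurable
  rw [h.join_eq, lintegral_map (Measure.measurable_lintegral hf) h.measurable] at h1
  rw [← h1]
  exact lintegral_smul_measure _ _

variable {r₀ α : ℝ}

theorem pathLoss_eq (d : ℝ) : pathLoss r₀ α d = max r₀ d ^ α := by
  unfold pathLoss
  split_ifs with h
  · rw [max_eq_right h.le]
  · rw [max_eq_left (not_lt.1 h)]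

theorem pathLoss_pos (hr₀ : 0 < r₀) (d : ℝ) : 0 < pathLoss r₀ α d := by
  rw [pathLoss_eq]
  exact Real.rpow_pos_of_pos (lt_max_of_lt_left hr₀) _

theorem pathLoss_mono (hr₀ : 0 < r₀) (hα : 0 < α) {d d' : ℝ} (h : d ≤ d') :
    pathLoss r₀ α d ≤ pathLoss r₀ α d' := by
  rw [pathLoss_eq, pathLoss_eq]
  exact Real.rpow_le_rpow (hr₀.le.trans (le_max_left _ _)) (max_le_max_left _ h) hα.le

theorem measurable_pathLoss : Measurable (pathLoss r₀ α) := by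
  unfold pathLoss
  exact Measurable.ite measurableSet_Ioi (by fun_prop) measurable_const

theorem interference_eq_lintegral (ρI : ℝ) (S : Set Plane) (p : Plane) :
    interference r₀ α ρI S p =
      ∫⁻ y, ENNReal.ofReal (ρI / pathLoss r₀ α (dist p y)) ∂points S := by
  rw [points, lintegral_sum_measure, interference]
  simp_rw [lintegral_dirac]

/-- An upper bound for the contribution of an interferer at `y` to the interference at any point
of the disc of radius `r`. -/
noncomputable def interferenceBound (r₀ α ρI r : ℝ) (y : Plane) : ℝ≥0∞ :=
  ENNReal.ofReal (ρI / pathLoss r₀ α (‖y‖ - r))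

theorem measurable_interferenceBound (ρI r : ℝ) :
    Measurable (interferenceBound r₀ α ρI r) :=
  ((measurable_pathLoss.comp (measurable_norm.sub_const r)).const_div ρI).ennreal_ofReal

/-- An interferer at y is at distance at least ‖y‖ - r from the user, and path loss increases with
distance. The bound no longer involves the location p, which makes it independent of the cell. -/
theorem interference_le (hr₀ : 0 < r₀) (hα : 0 < α) {ρI : ℝ} (hρI : 0 ≤ ρI) (S : Set Plane)
    {p : Plane} {r : ℝ} (hp : ‖p‖ ≤ r) :
    interference r₀ α ρI S p ≤ ∫⁻ y, interferenceBound r₀ α ρI r y ∂points S := by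
  rw [interference_eq_lintegral]
  refine lintegral_mono fun y => ENNReal.ofReal_le_ofReal ?_
  refine div_le_div_of_nonneg_left hρI (pathLoss_pos hr₀ _) (pathLoss_mono hr₀ hα ?_)
  have := norm_sub_norm_le y p
  rw [dist_comm, dist_eq_norm]
  linarith

/-- In the plane (1 + ‖y‖)^(-α) is integrable exactly when α > 2, and the bounded path loss is
comparable to it from below. -/
theorem lintegral_interferenceBound_lt_top (hr₀ : 0 < r₀) {ρI r : ℝ} (hρI : 0 ≤ ρI)
    (hr : 0 ≤ r) (hαI : 0 < ρI → 2 < α) :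
    ∫⁻ y, interferenceBound r₀ α ρI r y < ∞ := by
  rcases hρI.eq_or_lt with h0 | hpos
  · simp [interferenceBound, ← h0]
  have hα := hαI hpos
  -- Write 1 + ‖y‖ = (1 + r) + (‖y‖ - r); the maximum with r₀ dominates the first term up to the
  -- factor (1 + r)/r₀ and the second up to 1.
  set C : ℝ := (1 + r) / r₀ + 1 with hC
  have hCpos : 0 < C := by positivity
  have hint : Integrable (fun y : Plane => (1 + ‖y‖) ^ (-α)) volume :=
    integrable_one_add_norm (by simpa using hα)
  have hint' := (hint.const_mul (ρI * C ^ α)).lintegral_lt_top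
  refine lt_of_le_of_lt (lintegral_mono fun y => ENNReal.ofReal_le_ofReal ?_) hint'
  have hmax : 0 < max r₀ (‖y‖ - r) := lt_max_of_lt_left hr₀
  have hle : 1 + ‖y‖ ≤ C * max r₀ (‖y‖ - r) := by
    have h1 : (1 + r) / r₀ * r₀ ≤ (1 + r) / r₀ * max r₀ (‖y‖ - r) :=
      mul_le_mul_of_nonneg_left (le_max_left _ _) (by positivity)
    rw [div_mul_cancel₀ _ hr₀.ne'] at h1
    have h2 := le_max_right r₀ (‖y‖ - r)
    rw [hC]
    linarith
  have hy : 0 < 1 + ‖y‖ := by positivity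
  rw [pathLoss_eq, Real.rpow_neg hy.le, mul_assoc, div_eq_mul_inv, ← div_eq_mul_inv (C ^ α)]
  refine mul_le_mul_of_nonneg_left ?_ hpos.le
  rw [inv_eq_one_div, div_le_div_iff₀ (Real.rpow_pos_of_pos hmax _) (Real.rpow_pos_of_pos hy _),
    one_mul, ← Real.mul_rpow hCpos.le hmax.le]
  exact Real.rpow_le_rpow hy.le hle (by linarith)

theorem IsPoissonProcess.lintegral_interferenceBound_lt_top (h : IsPoissonProcess μ lam Ψ)
    (hr₀ : 0 < r₀) {ρI r : ℝ} (hρI : 0 ≤ ρI) (hr : 0 ≤ r) (hαI : 0 < ρI → 2 < α) :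
    ∫⁻ ω, ∫⁻ y, interferenceBound r₀ α ρI r y ∂points (Ψ ω) ∂μ < ∞ := by
  rw [h.lintegral_lintegral (measurable_interferenceBound ρI r)]
  exact ENNReal.mul_lt_top ENNReal.coe_lt_top
    (MimoNoma.lintegral_interferenceBound_lt_top hr₀ hρI hr hαI)

end Interference

/-! ### Diversity order and the outage event -/

section Diversity

/-- After taking logarithms and dividing by log ρ, multiplicative constants vanish in the limit. The
upper bounds with θ arbitrarily close to 1 therefore suffice, although C may depend on θ. -/
theorem hasDiversityOrder_one_of_bounds {P : ℝ → ℝ} {c : ℝ} (hc : 0 < c)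
    (hlow : ∀ᶠ ρ in atTop, c / ρ ≤ P ρ)
    (hup : ∀ θ : ℝ, 0 < θ → θ < 1 → ∃ C : ℝ, ∀ ρ : ℝ, 0 < ρ → P ρ ≤ C * ρ ^ (-θ)) :
    HasDiversityOrder P 1 := by
  have hpos : ∀ᶠ ρ in atTop, 0 < P ρ := by
    filter_upwards [hlow, eventually_gt_atTop 0] with ρ h1 h2
    exact (div_pos hc h2).trans_le h1
  have hlim (b t : ℝ) : Tendsto (fun ρ => t - b / Real.log ρ) atTop (𝓝 t) := by
    have := (tendsto_const_nhds (x := t)).sub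
      ((tendsto_const_nhds (x := b)).div_atTop Real.tendsto_log_atTop)
    simpa using this
  refine ⟨hpos, tendsto_order.2 ⟨fun b hb => ?_, fun b hb => ?_⟩⟩
  · obtain ⟨θ, hθ, hθ1⟩ := exists_between (max_lt hb one_pos)
    have hbθ := (le_max_left b 0).trans_lt hθ
    have hθ0 := (le_max_right b 0).trans_lt hθ
    obtain ⟨C, hC⟩ := hup θ hθ0 hθ1
    filter_upwards [(tendsto_order.1 (hlim (Real.log C) θ)).1 b hbθ, hpos,
      eventually_gt_atTop 1] with ρ h1 h2 h3
    refine h1.trans_le ?_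
    have hlog : 0 < Real.log ρ := Real.log_pos h3
    have hρ : 0 < ρ := one_pos.trans h3
    have hCpos : 0 < C := by
      by_contra hneg
      have := hC ρ hρ
      nlinarith [Real.rpow_pos_of_pos hρ (-θ)]
    have hle := Real.log_le_log h2 (hC ρ hρ)
    rw [Real.log_mul hCpos.ne' (Real.rpow_pos_of_pos hρ _).ne', Real.log_rpow hρ] at hle
    rw [le_div_iff₀ hlog, sub_mul, div_mul_cancel₀ _ hlog.ne']
    linarith
  · filter_upwards [(tendsto_order.1 (hlim (Real.log c) 1)).2 b hb, hlow, hpos,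
      eventually_gt_atTop 1] with ρ h1 h2 h2' h3
    refine lt_of_le_of_lt ?_ h1
    have hlog : 0 < Real.log ρ := Real.log_pos h3
    have hρ : 0 < ρ := one_pos.trans h3
    have hle := Real.log_le_log (div_pos hc hρ) h2
    rw [Real.log_div hc.ne' hρ.ne'] at hle
    rw [div_le_iff₀ hlog, sub_mul, div_mul_cancel₀ _ hlog.ne']
    linarith

variable {r₀ α a a' R ρ d z w : ℝ}

theorem abs_scalarGain_sq (hr₀ : 0 < r₀) (hz : 0 ≤ z) :
    |scalarGain r₀ α d z| ^ 2 = (pathLoss r₀ α d * z)⁻¹ := by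
  rw [sq_abs, scalarGain, div_pow, one_pow,
    Real.sq_sqrt (mul_nonneg (pathLoss_pos hr₀ d).le hz), one_div]

/-- Clearing denominators in the SINR condition isolates the effective power coefficient a'² - a²ε,
with ε = 2^R - 1. -/
theorem le_of_outage (hr₀ : 0 < r₀) (hρ : 0 < ρ) (hz : 0 < z) (hw : 0 < w)
    (hout : Real.logb 2 (1 + sinr a a' ρ (scalarGain r₀ α d z) w) < R) :
    ρ * (a' ^ 2 - a ^ 2 * ((2 : ℝ) ^ R - 1)) ≤ ((2 : ℝ) ^ R - 1) * w * (pathLoss r₀ α d * z) := by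
  have hL := pathLoss_pos (α := α) hr₀ d
  rw [sinr, abs_scalarGain_sq hr₀ hz.le] at hout
  set Q := pathLoss r₀ α d * z with hQ
  have hQp : 0 < Q := mul_pos hL hz
  have hden : 0 < ρ * Q⁻¹ * a ^ 2 + w := by positivity
  rw [Real.logb_lt_iff_lt_rpow one_lt_two (by positivity)] at hout
  have h1 : ρ * Q⁻¹ * a' ^ 2 / (ρ * Q⁻¹ * a ^ 2 + w) < (2 : ℝ) ^ R - 1 := by linarith
  rw [div_lt_iff₀ hden] at h1
  have h2 : ρ * (a' ^ 2 - a ^ 2 * ((2 : ℝ) ^ R - 1)) * Q⁻¹ ≤ ((2 : ℝ) ^ R - 1) * w := by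
    nlinarith
  have h3 := mul_le_mul_of_nonneg_right h2 hQp.le
  rwa [mul_assoc, inv_mul_cancel₀ hQp.ne', mul_one] at h3

/-- The converse with the path loss replaced by its minimum L(0), so that the location drops out,
and the noise by a lower bound f. -/
theorem outage_of_lt (hr₀ : 0 < r₀) (hα : 0 < α) (hR : 0 < R) (hρ : 0 < ρ) (hz : 0 ≤ z)
    {f : ℝ} (hfw : f ≤ w) (hcond : a ^ 2 * ((2 : ℝ) ^ R - 1) < a' ^ 2)
    (h : z = 0 ∨ z⁻¹ < ((2 : ℝ) ^ R - 1) * pathLoss r₀ α 0 /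
      (a' ^ 2 - a ^ 2 * ((2 : ℝ) ^ R - 1)) / ρ * f) (hd : 0 ≤ d) :
    Real.logb 2 (1 + sinr a a' ρ (scalarGain r₀ α d z) w) < R := by
  have hε : 0 < (2 : ℝ) ^ R - 1 := sub_pos.2 (Real.one_lt_rpow one_lt_two hR)
  have hc : 0 < a' ^ 2 - a ^ 2 * ((2 : ℝ) ^ R - 1) := sub_pos.2 hcond
  rcases hz.eq_or_lt with h0 | hzp
  · rw [sinr, abs_scalarGain_sq hr₀ hz, ← h0]
    simpa using hR
  have h := h.resolve_left hzp.ne'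
  have hL := pathLoss_pos (α := α) hr₀ d
  have hL0 := pathLoss_pos (α := α) hr₀ 0
  have hLL : pathLoss r₀ α 0 ≤ pathLoss r₀ α d := pathLoss_mono hr₀ hα hd
  rw [sinr, abs_scalarGain_sq hr₀ hz, mul_inv]
  set ε := (2 : ℝ) ^ R - 1 with hεdef
  set c := a' ^ 2 - a ^ 2 * ε with hcdef
  have hzi : 0 < z⁻¹ := inv_pos.2 hzp
  have hk : 0 < ε * pathLoss r₀ α 0 / c / ρ := by positivity
  -- Forced by the hypothesis, since the reciprocal of z is positive.
  have hf : 0 < f := by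
    by_contra hneg
    nlinarith
  have hw : 0 < w := hf.trans_le hfw
  have hX : ρ * ((pathLoss r₀ α d)⁻¹ * z⁻¹) * c < ε * w := by
    calc ρ * ((pathLoss r₀ α d)⁻¹ * z⁻¹) * c
        ≤ ρ * ((pathLoss r₀ α 0)⁻¹ * z⁻¹) * c := by gcongr
      _ < ρ * ((pathLoss r₀ α 0)⁻¹ * (ε * pathLoss r₀ α 0 / c / ρ * f)) * c := by gcongr
      _ = ε * f := by field_simp
      _ ≤ ε * w := by gcongr
  set X := ρ * ((pathLoss r₀ α d)⁻¹ * z⁻¹) with hXdef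
  have hXp : 0 < X := by positivity
  have hden : 0 < X * a ^ 2 + w := by positivity
  rw [Real.logb_lt_iff_lt_rpow one_lt_two (by positivity)]
  have : X * a' ^ 2 / (X * a ^ 2 + w) < ε := by
    rw [div_lt_iff₀ hden]
    have : X * c = X * a' ^ 2 - ε * (X * a ^ 2) := by rw [hcdef]; ring
    nlinarith
  linarith

end Diversity

/-! ### The random downlink -/

section Model

variable {M N : ℕ} {Ω : Type*}

/-- The data of all pairs. -/
def Downlink.pairs (S : Downlink M N Ω) (ω : Ω) : Fin M → PairData M N :=
  fun i => (S.G ω i, S.G' ω i, S.x ω i)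

theorem isProbabilityMeasure_cond_innerDisc {r₁ : ℝ} (h : 0 < r₁) :
    IsProbabilityMeasure ((volume : Measure Plane)[|innerDisc r₁]) :=
  cond_isProbabilityMeasure_of_finite (Metric.measure_closedBall_pos _ _ h).ne'
    measure_closedBall_lt_top.ne

theorem isProbabilityMeasure_cond_outerRing {r₁ r : ℝ} (h : 0 ≤ r₁) (hr : r₁ < r) :
    IsProbabilityMeasure ((volume : Measure Plane)[|outerRing r₁ r]) := by
  refine cond_isProbabilityMeasure_of_finite ?_
    (measure_ne_top_of_subset Set.sdiff_subset measure_closedBall_lt_top.ne)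
  have hopen : IsOpen (Metric.ball (0 : Plane) r \ Metric.closedBall 0 r₁) :=
    Metric.isOpen_ball.sdiff Metric.isClosed_closedBall
  obtain ⟨p, hp⟩ := exists_norm_eq Plane (c := (r₁ + r) / 2) (by linarith)
  have hne : (Metric.ball (0 : Plane) r \ Metric.closedBall 0 r₁).Nonempty := by
    refine ⟨p, ?_, ?_⟩ <;> simp [hp] <;> linarith
  exact ((hopen.measure_pos volume hne).trans_le
    (measure_mono (Set.sdiff_subset_sdiff_left Metric.ball_subset_closedBall))).ne'

variable [MeasurableSpace Ω] {μ : Measure Ω} {S : Downlink M N Ω} {r₁ r : ℝ} {lam : ℝ≥0}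

/-- The map from the cell to the data of the pairs. -/
def cellPairs {M N : ℕ} (q : (Fin M → Channel N M) × (Fin M → Channel N M) × (Fin M → Plane) ×
    (Fin M → Plane) × (Fin M → Fin (2 * N - M) → ℂ)) : Fin M → PairData M N :=
  fun i => (q.1 i, q.2.1 i, q.2.2.2.2 i)

theorem measurePreserving_cellPairs (h₁ : 0 < r₁) (hr : r₁ < r) :
    MeasurePreserving (cellPairs (M := M) (N := N))
      ((Measure.pi fun _ => rayleigh N M).prod <|
        (Measure.pi fun _ => rayleigh N M).prod <|
        (Measure.pi fun _ => (volume : Measure Plane)[|innerDisc r₁]).prod <|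
        (Measure.pi fun _ => (volume : Measure Plane)[|outerRing r₁ r]).prod <|
        Measure.pi fun _ => uniformSphere (2 * N - M))
      (Measure.pi fun _ => pairLaw M N) := by
  have := isProbabilityMeasure_cond_innerDisc h₁
  have := isProbabilityMeasure_cond_outerRing h₁.le hr
  exact (measurePreserving_pairs (2 * N - M)).comp ((MeasurePreserving.id _).prod
    ((MeasurePreserving.id _).prod (measurePreserving_snd.comp measurePreserving_snd)))

theorem Downlink.IsModel.hasLaw_pairs (hS : S.IsModel μ r₁ r lam) (h₁ : 0 < r₁) (hr : r₁ < r) :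
    HasLaw S.pairs (Measure.pi fun _ => pairLaw M N) μ := by
  have hm := measurePreserving_cellPairs (M := M) (N := N) h₁ hr
  have e : S.pairs = cellPairs ∘ S.cell := rfl
  rw [e]
  exact hm.hasLaw.comp hS.law

theorem measurePreserving_cell_far (h₁ : 0 < r₁) (hr : r₁ < r) (m : Fin M) :
    MeasurePreserving (fun q : (Fin M → Channel N M) × (Fin M → Channel N M) × (Fin M → Plane) ×
        (Fin M → Plane) × (Fin M → Fin (2 * N - M) → ℂ) => q.2.2.2.1 m)
      ((Measure.pi fun _ => rayleigh N M).prod <|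
        (Measure.pi fun _ => rayleigh N M).prod <|
        (Measure.pi fun _ => (volume : Measure Plane)[|innerDisc r₁]).prod <|
        (Measure.pi fun _ => (volume : Measure Plane)[|outerRing r₁ r]).prod <|
        Measure.pi fun _ => uniformSphere (2 * N - M))
      ((volume : Measure Plane)[|outerRing r₁ r]) := by
  have := isProbabilityMeasure_cond_innerDisc h₁
  have := isProbabilityMeasure_cond_outerRing h₁.le hr
  exact (measurePreserving_eval (fun _ : Fin M => (volume : Measure Plane)[|outerRing r₁ r])
    m).comp (measurePreserving_fst.comp (measurePreserving_snd.comp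
      (measurePreserving_snd.comp measurePreserving_snd)))

theorem Downlink.IsModel.ae_norm_far_le (hS : S.IsModel μ r₁ r lam) (h₁ : 0 < r₁) (hr : r₁ < r)
    (m : Fin M) : ∀ᵐ ω ∂μ, ‖S.p' ω m‖ ≤ r := by
  have hm : MeasurableSet (outerRing r₁ r) :=
    Metric.isClosed_closedBall.measurableSet.diff Metric.isClosed_closedBall.measurableSet
  have h1 : ∀ᵐ p ∂(volume : Measure Plane)[|outerRing r₁ r], ‖p‖ ≤ r := by
    filter_upwards [ae_cond_mem hm] with p hp
    simpa using hp.1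
  have h2 := (measurePreserving_cell_far (N := N) h₁ hr m).quasiMeasurePreserving.ae h1
  rw [← hS.law.map_eq] at h2
  exact ae_of_ae_map hS.law.aemeasurable h2

end Model

/-! ### Outage of the far user -/

section FarUser

variable {M N : ℕ} {Ω : Type*}

theorem normSq_pairFar_le {U : Channel N M → Channel N M →
    Matrix (Fin N ⊕ Fin N) (Fin (2 * N - M)) ℂ} (hU : IsAlignment U) (y : PairData M N) :
    normSq (pairFar U y) ≤ normSq y.2.2 := by
  rw [← normSq_mulVec (hU.orthonormal y.1 y.2.1) y.2.2, ← topSq_add_botSq]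
  exact le_add_of_nonneg_left (topSq_nonneg _)

/-- Alignment gives the two users of a pair the same effective vector, so a vanishing far detector
kills it. Hence an invertible channel matrix forces positive noise power. -/
theorem pairEff_eq_zero_of_pairFar {U : Channel N M → Channel N M →
    Matrix (Fin N ⊕ Fin N) (Fin (2 * N - M)) ℂ} (hU : IsAlignment U) {y : PairData M N}
    (h : pairFar U y = 0) : pairEff U y = 0 := by
  have h0 : Matrix.fromCols y.1ᴴ (-y.2.1ᴴ) *ᵥ (U y.1 y.2.1 *ᵥ y.2.2) = 0 := by
    rw [Matrix.mulVec_mulVec, hU.null, Matrix.zero_mulVec]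
  rw [Matrix.fromCols_mulVec] at h0
  have h2 : (U y.1 y.2.1 *ᵥ y.2.2) ∘ Sum.inr = 0 := h
  rw [h2, Matrix.mulVec_zero, add_zero] at h0
  exact h0

theorem pairFar_ne_zero {U : Fin M → Channel N M → Channel N M →
    Matrix (Fin N ⊕ Fin N) (Fin (2 * N - M)) ℂ} (hU : ∀ i, IsAlignment (U i))
    {y : Fin M → PairData M N} (h : (pairsMatrix U y).det ≠ 0) (m : Fin M) :
    pairFar (U m) (y m) ≠ 0 := by
  intro h0
  have h1 := pairEff_eq_zero_of_pairFar (hU m) h0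
  exact h (Matrix.det_eq_zero_of_column_eq_zero m fun j => congrFun h1 j)

theorem norm_sum_star_sq_le (v : Fin N → ℂ) : ‖∑ n, star (v n)‖ ^ 2 ≤ N * normSq v := by
  have h := norm_sq_star_dotProduct_le v (fun _ => 1)
  simp only [dotProduct, Pi.star_apply, mul_one] at h
  refine h.trans (le_of_eq ?_)
  simp [normSq, mul_comm]

variable {S : Downlink M N Ω} {r₀ r₁ r α ρI a a' R : ℝ} {lam : ℝ≥0}
  {U : Fin M → Channel N M → Channel N M → Matrix (Fin N ⊕ Fin N) (Fin (2 * N - M)) ℂ}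

theorem Downlink.farChannel_eq (m : Fin M) (ω : Ω) :
    S.farChannel U r₀ α m ω = scalarGain r₀ α (dist (S.p' ω m) 0) (pairsDiag U m (S.pairs ω)) := by
  rw [Downlink.farChannel, zfDiag_eq_pairsDiag]
  rfl

variable [MeasurableSpace Ω] {μ : Measure Ω}

/-- The outage probability of the far user for a general noise power `w`. -/
noncomputable def Downlink.outageProb (S : Downlink M N Ω)
    (U : Fin M → Channel N M → Channel N M → Matrix (Fin N ⊕ Fin N) (Fin (2 * N - M)) ℂ)
    (μ : Measure Ω) (r₀ α a a' R : ℝ) (m : Fin M) (w : Ω → ℝ) (ρ : ℝ) : ℝ :=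
  μ.real {ω | Real.logb 2 (1 + sinr a a' ρ (S.farChannel U r₀ α m ω) (w ω)) < R}

theorem Downlink.IsModel.ae_normSq_pairFar_le (hS : S.IsModel μ r₁ r lam) (hMN : M < 2 * N)
    (h₁ : 0 < r₁) (hr : r₁ < r) (hU : ∀ i, IsAlignment (U i)) (m : Fin M) :
    ∀ᵐ ω ∂μ, normSq (pairFar (U m) (S.pairs ω m)) ≤ 2 := by
  have h1 : ∀ᵐ y ∂pairLaw M N, normSq y.2.2 = 2 := by
    have : MeasurePreserving (fun y : PairData M N => y.2.2) (pairLaw M N)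
        (uniformSphere (2 * N - M)) := measurePreserving_snd.comp measurePreserving_snd
    exact this.quasiMeasurePreserving.ae (ae_normSq_uniformSphere (by omega))
  have h2 := (measurePreserving_eval (fun _ : Fin M => pairLaw M N)
    m).quasiMeasurePreserving.ae h1
  have hl := hS.hasLaw_pairs h₁ hr
  rw [← hl.map_eq] at h2
  filter_upwards [ae_of_ae_map hl.aemeasurable h2] with ω hω
  exact (normSq_pairFar_le (hU m) _).trans hω.le

theorem Downlink.IsModel.ae_det_ne_zero (hS : S.IsModel μ r₁ r lam) (hMN : M < 2 * N)
    (h₁ : 0 < r₁) (hr : r₁ < r) (hU : ∀ i, IsAlignment (U i)) :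
    ∀ᵐ ω ∂μ, (pairsMatrix U (S.pairs ω)).det ≠ 0 := by
  have hl := hS.hasLaw_pairs h₁ hr
  have h := ae_det_pairsMatrix_ne_zero hMN hU
  rw [← hl.map_eq] at h
  exact ae_of_ae_map hl.aemeasurable h

/-- Interference can only be discarded here: the small-ball event with s = κ/ρ is contained in the
outage event up to a null set, and s ≤ 1 once ρ ≥ κ. -/
theorem Downlink.IsModel.exists_le_outageProb [IsProbabilityMeasure μ]
    (hS : S.IsModel μ r₁ r lam) (hMN : M < 2 * N) (hr₀ : 0 < r₀) (h₁ : 0 < r₁) (hr : r₁ < r)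
    (hα : 0 < α) (hU : ∀ i, IsAlignment (U i)) (m : Fin M) (hR : 0 < R)
    (hcond : a ^ 2 * ((2 : ℝ) ^ R - 1) < a' ^ 2) {w : Ω → ℝ}
    (hw : ∀ᵐ ω ∂μ, normSq (pairFar (U m) (S.pairs ω m)) ≤ w ω) :
    ∃ c : ℝ, 0 < c ∧ ∀ᶠ ρ in atTop, c / ρ ≤ S.outageProb U μ r₀ α a a' R m w ρ := by
  obtain ⟨c₀, hc₀, h⟩ := exists_le_pairs_small hMN hU m
  set κ := ((2 : ℝ) ^ R - 1) * pathLoss r₀ α 0 / (a' ^ 2 - a ^ 2 * ((2 : ℝ) ^ R - 1)) with hκ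
  have hκp : 0 < κ := by
    have hε : 0 < (2 : ℝ) ^ R - 1 := sub_pos.2 (Real.one_lt_rpow one_lt_two hR)
    have hc : 0 < a' ^ 2 - a ^ 2 * ((2 : ℝ) ^ R - 1) := sub_pos.2 hcond
    have := pathLoss_pos (α := α) hr₀ 0
    positivity
  refine ⟨c₀ * κ, by positivity, ?_⟩
  filter_upwards [eventually_ge_atTop κ, eventually_gt_atTop 0] with ρ hρκ hρ
  have hl := hS.hasLaw_pairs h₁ hr
  have hs := h (κ / ρ) (by positivity) ((div_le_one hρ).2 hρκ)
  have hSm : MeasurableSet {y : Fin M → PairData M N | pairsDiag U m y = 0 ∨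
      (pairsDiag U m y)⁻¹ < κ / ρ * normSq (pairFar (U m) (y m))} :=
    (measurableSet_eq_fun (measurable_pairsDiag hU m) measurable_const).union
      (measurableSet_lt (measurable_pairsDiag hU m).inv
        ((measurable_normSq.comp ((measurable_pairFar (hU m)).comp
          (measurable_pi_apply m))).const_mul _))
  rw [← hl.measure_eq (p := fun y => pairsDiag U m y = 0 ∨
      (pairsDiag U m y)⁻¹ < κ / ρ * normSq (pairFar (U m) (y m))) hSm] at hs
  have hle : μ {ω | pairsDiag U m (S.pairs ω) = 0 ∨ (pairsDiag U m (S.pairs ω))⁻¹ <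
        κ / ρ * normSq (pairFar (U m) (S.pairs ω m))} ≤
      μ {ω | Real.logb 2 (1 + sinr a a' ρ (S.farChannel U r₀ α m ω) (w ω)) < R} := by
    refine measure_mono_ae ?_
    filter_upwards [hw] with ω hω hmem
    change Real.logb 2 (1 + sinr a a' ρ (S.farChannel U r₀ α m ω) (w ω)) < R
    rw [Downlink.farChannel_eq]
    exact outage_of_lt hr₀ hα hR hρ (pairsDiag_nonneg U m _) hω hcond hmem dist_nonneg
  rw [Downlink.outageProb, mul_div_assoc]
  exact (ENNReal.ofReal_le_iff_le_toReal (measure_ne_top _ _)).1 (hs.trans hle)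

/-- Markov's inequality for the θ-th power of (κ/ρ) Z w. A bound W for the noise depending only on
the interferers makes the expectation factorize. -/
theorem Downlink.IsModel.exists_outageProb_le [IsProbabilityMeasure μ]
    (hS : S.IsModel μ r₁ r lam) (hMN : M < 2 * N) (hr₀ : 0 < r₀) (h₁ : 0 < r₁) (hr : r₁ < r)
    (hα : 0 < α) (hρI : 0 ≤ ρI) (hαI : 0 < ρI → 2 < α) (hU : ∀ i, IsAlignment (U i)) (m : Fin M)
    (hR : 0 < R) (hcond : a ^ 2 * ((2 : ℝ) ^ R - 1) < a' ^ 2) {w : Ω → ℝ} {δ : ℝ} (hδ : 0 ≤ δ)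
    (hw0 : ∀ᵐ ω ∂μ, 0 < w ω)
    (hw : ∀ᵐ ω ∂μ, w ω ≤ 2 + 2 * δ * S.farInterference r₀ α ρI m ω)
    {θ : ℝ} (h0 : 0 < θ) (h1 : θ < 1) :
    ∃ C : ℝ, ∀ ρ : ℝ, 0 < ρ → S.outageProb U μ r₀ α a a' R m w ρ ≤ C * ρ ^ (-θ) := by
  -- L(r) is the largest path loss of a far user.
  set κ := ((2 : ℝ) ^ R - 1) * pathLoss r₀ α r / (a' ^ 2 - a ^ 2 * ((2 : ℝ) ^ R - 1)) with hκ
  have hε : 0 < (2 : ℝ) ^ R - 1 := sub_pos.2 (Real.one_lt_rpow one_lt_two hR)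
  have hc : 0 < a' ^ 2 - a ^ 2 * ((2 : ℝ) ^ R - 1) := sub_pos.2 hcond
  have hLr := pathLoss_pos (α := α) hr₀ r
  have hκp : 0 < κ := by positivity
  have hl := hS.hasLaw_pairs h₁ hr
  let Wf : Measure Plane → ℝ≥0∞ := fun ν =>
    2 + ENNReal.ofReal (2 * δ) * ∫⁻ y, interferenceBound r₀ α ρI r y ∂ν
  have hWf : Measurable Wf := measurable_const.add ((Measure.measurable_lintegral
    (measurable_interferenceBound ρI r)).const_mul _)
  let W : Ω → ℝ≥0∞ := fun ω => Wf (points (S.Ψ ω))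
  have hWm : Measurable W := hWf.comp hS.poisson.measurable
  let Z : Ω → ℝ≥0∞ := fun ω => ENNReal.ofReal (pairsDiag U m (S.pairs ω)) ^ θ
  have hZf : Measurable fun y : Fin M → PairData M N => ENNReal.ofReal (pairsDiag U m y) ^ θ :=
    (measurable_pairsDiag hU m).ennreal_ofReal.pow_const _
  have hZm : AEMeasurable Z μ := hZf.comp_aemeasurable hl.aemeasurable
  have hZfin : ∫⁻ ω, Z ω ∂μ < ∞ := by
    rw [hl.lintegral_comp (f := fun y => ENNReal.ofReal (pairsDiag U m y) ^ θ) hZf.aemeasurable]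
    exact lintegral_pairsDiag_rpow_lt_top hMN hU m h0 h1
  have hWfin : ∫⁻ ω, W ω ∂μ < ∞ := by
    have hm : Measurable fun ω => ∫⁻ y, interferenceBound r₀ α ρI r y ∂points (S.Ψ ω) :=
      (Measure.measurable_lintegral (measurable_interferenceBound ρI r)).comp
        hS.poisson.measurable
    simp only [W, Wf]
    rw [lintegral_add_left measurable_const, lintegral_const_mul _ hm]
    refine ENNReal.add_lt_top.2 ⟨by simp, ENNReal.mul_lt_top ENNReal.ofReal_lt_top ?_⟩
    exact hS.poisson.lintegral_interferenceBound_lt_top hr₀ hρI (h₁.trans hr).le hαI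
  -- Z is a function of the cell and W of the point process alone.
  have hind : IndepFun Z W μ := by
    have hcp := (measurePreserving_cellPairs (M := M) (N := N) h₁ hr).measurable
    exact hS.indep.comp (hZf.comp hcp) hWf
  have hprod : ∫⁻ ω, Z ω * W ω ∂μ < ∞ := by
    have := lintegral_mul_eq_lintegral_mul_lintegral_of_indepFun'' hZm hWm.aemeasurable hind
    rw [this]
    exact ENNReal.mul_lt_top hZfin hWfin
  refine ⟨(ENNReal.ofReal κ ^ θ * ∫⁻ ω, Z ω * W ω ∂μ).toReal, fun ρ hρ => ?_⟩
  have hsub : ∀ᵐ ω ∂μ, Real.logb 2 (1 + sinr a a' ρ (S.farChannel U r₀ α m ω) (w ω)) < R →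
      1 ≤ ENNReal.ofReal (κ / ρ) ^ θ * (Z ω * W ω) := by
    filter_upwards [hw0, hw, hS.ae_det_ne_zero hMN h₁ hr hU, hS.ae_norm_far_le h₁ hr m]
      with ω hω0 hω hdet hp hout
    set z := pairsDiag U m (S.pairs ω) with hz
    have hzp : 0 < z := (pairsDiag_nonneg U m _).lt_of_ne' (pairsDiag_ne_zero hdet)
    rw [Downlink.farChannel_eq] at hout
    have hle := le_of_outage hr₀ hρ hzp hω0 hout
    have hL : pathLoss r₀ α (dist (S.p' ω m) 0) ≤ pathLoss r₀ α r :=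
      pathLoss_mono hr₀ hα (by rwa [dist_zero_right])
    have hone : 1 ≤ κ / ρ * z * w ω := by
      have h2 : ρ * (a' ^ 2 - a ^ 2 * ((2 : ℝ) ^ R - 1)) ≤
          ((2 : ℝ) ^ R - 1) * w ω * (pathLoss r₀ α r * z) := hle.trans (by gcongr)
      have h3 : κ / ρ * z * w ω = ((2 : ℝ) ^ R - 1) * w ω * (pathLoss r₀ α r * z) /
          (ρ * (a' ^ 2 - a ^ 2 * ((2 : ℝ) ^ R - 1))) := by
        rw [hκ]
        field_simp
      rw [h3, one_le_div (by positivity)]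
      exact h2
    have hWω : ENNReal.ofReal (w ω) ≤ W ω := by
      have hI : 0 ≤ S.farInterference r₀ α ρI m ω := ENNReal.toReal_nonneg
      refine (ENNReal.ofReal_le_ofReal hω).trans ?_
      rw [ENNReal.ofReal_add (by norm_num) (by positivity), ENNReal.ofReal_mul (by positivity)]
      refine add_le_add (by simp) (mul_le_mul_right ?_ _)
      -- An infinite interference has real value 0, so the bound needs no finiteness.
      exact ENNReal.ofReal_toReal_le.trans (interference_le hr₀ hα hρI _ hp)
    -- W ≥ 1 allows W^θ to be replaced by W, so a first moment of the interference is enough.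
    have hW1 : 1 ≤ W ω := le_trans (by norm_num) (le_self_add : (2 : ℝ≥0∞) ≤ W ω)
    have hone' : 1 ≤ ENNReal.ofReal (κ / ρ) * (ENNReal.ofReal z * ENNReal.ofReal (w ω)) := by
      rw [← ENNReal.ofReal_mul hzp.le, ← ENNReal.ofReal_mul (by positivity), ← mul_assoc]
      exact ENNReal.one_le_ofReal.2 hone
    calc (1 : ℝ≥0∞) ≤ (ENNReal.ofReal (κ / ρ) *
          (ENNReal.ofReal z * ENNReal.ofReal (w ω))) ^ θ := ENNReal.one_le_rpow hone' h0
      _ = ENNReal.ofReal (κ / ρ) ^ θ * (Z ω * ENNReal.ofReal (w ω) ^ θ) := by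
        rw [ENNReal.mul_rpow_of_nonneg _ _ h0.le, ENNReal.mul_rpow_of_nonneg _ _ h0.le]
      _ ≤ ENNReal.ofReal (κ / ρ) ^ θ * (Z ω * W ω) := by
        gcongr
        calc ENNReal.ofReal (w ω) ^ θ ≤ W ω ^ θ := ENNReal.rpow_le_rpow hWω h0.le
          _ ≤ W ω ^ (1 : ℝ) := ENNReal.rpow_le_rpow_of_exponent_le hW1 h1.le
          _ = W ω := ENNReal.rpow_one _
  have hmark : μ {ω | Real.logb 2 (1 + sinr a a' ρ (S.farChannel U r₀ α m ω) (w ω)) < R} ≤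
      ENNReal.ofReal (κ / ρ) ^ θ * ∫⁻ ω, Z ω * W ω ∂μ := by
    calc _ ≤ μ {ω | 1 ≤ ENNReal.ofReal (κ / ρ) ^ θ * (Z ω * W ω)} := measure_mono_ae hsub
      _ ≤ (∫⁻ ω, ENNReal.ofReal (κ / ρ) ^ θ * (Z ω * W ω) ∂μ) / 1 :=
        meas_ge_le_lintegral_div ((hZm.mul hWm.aemeasurable).const_mul _) one_ne_zero
          ENNReal.one_ne_top
      _ = _ := by
        rw [div_one]
        exact lintegral_const_mul'' _ (hZm.mul hWm.aemeasurable)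
  have hfin : ENNReal.ofReal κ ^ θ * ∫⁻ ω, Z ω * W ω ∂μ ≠ ∞ :=
    (ENNReal.mul_lt_top (ENNReal.rpow_lt_top_of_nonneg h0.le ENNReal.ofReal_ne_top) hprod).ne
  have heq : ENNReal.ofReal (κ / ρ) ^ θ * ∫⁻ ω, Z ω * W ω ∂μ =
      (ENNReal.ofReal κ ^ θ * ∫⁻ ω, Z ω * W ω ∂μ) * ENNReal.ofReal (ρ ^ (-θ)) := by
    rw [ENNReal.ofReal_rpow_of_pos (by positivity), ENNReal.ofReal_rpow_of_pos hκp,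
      Real.div_rpow hκp.le hρ.le, div_eq_mul_inv, ← Real.rpow_neg hρ.le,
      ENNReal.ofReal_mul (by positivity)]
    ring
  rw [heq] at hmark
  have := ENNReal.toReal_mono (ENNReal.mul_ne_top hfin ENNReal.ofReal_ne_top) hmark
  rwa [ENNReal.toReal_mul, ENNReal.toReal_ofReal (by positivity)] at this

/-- The outage probability has diversity order one for every noise power between the squared norm
of the detection vector and an affine function of the interference. -/
theorem Downlink.IsModel.hasDiversityOrder_outageProb [IsProbabilityMeasure μ]
    (hS : S.IsModel μ r₁ r lam) (hMN : M < 2 * N) (hr₀ : 0 < r₀) (h₁ : 0 < r₁) (hr : r₁ < r)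
    (hα : 0 < α) (hρI : 0 ≤ ρI) (hαI : 0 < ρI → 2 < α) (hU : ∀ i, IsAlignment (U i)) (m : Fin M)
    (hR : 0 < R) (hcond : a ^ 2 * ((2 : ℝ) ^ R - 1) < a' ^ 2) {w : Ω → ℝ} {δ : ℝ} (hδ : 0 ≤ δ)
    (hlow : ∀ᵐ ω ∂μ, normSq (pairFar (U m) (S.pairs ω m)) ≤ w ω)
    (hup : ∀ᵐ ω ∂μ, w ω ≤ 2 + 2 * δ * S.farInterference r₀ α ρI m ω) :
    HasDiversityOrder (S.outageProb U μ r₀ α a a' R m w) 1 := by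
  obtain ⟨c, hc, h⟩ := hS.exists_le_outageProb hMN hr₀ h₁ hr hα hU m hR hcond hlow
  have hw0 : ∀ᵐ ω ∂μ, 0 < w ω := by
    filter_upwards [hlow, hS.ae_det_ne_zero hMN h₁ hr hU] with ω hω hdet
    exact (normSq_pos (pairFar_ne_zero hU hdet m)).trans_le hω
  exact hasDiversityOrder_one_of_bounds hc h fun θ h0 h1 =>
    hS.exists_outageProb_le hMN hr₀ h₁ hr hα hρI hαI hU m hR hcond hδ hw0 hup h0 h1

end FarUser

end MimoNoma

theorem corollary1 {Ω : Type*} [MeasurableSpace Ω] (μ : MeasureTheory.Measure Ω)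
    [MeasureTheory.IsProbabilityMeasure μ]
    {M N : ℕ} (hMN : M < 2 * N)
    (r₀ r₁ r α : ℝ) (hr₀ : 0 < r₀) (hr₀₁ : r₀ ≤ r₁) (hr₁ : r₁ < r) (hα : 0 < α)
    (lam : NNReal) (ρI : ℝ) (hρI : 0 ≤ ρI) (hαI : 0 < ρI → 2 < α)
    (U : Fin M → MimoNoma.Channel N M → MimoNoma.Channel N M →
      Matrix (Fin N ⊕ Fin N) (Fin (2 * N - M)) ℂ)
    (hU : ∀ i, MimoNoma.IsAlignment (U i))
    (S : MimoNoma.Downlink M N Ω) (hS : S.IsModel μ r₁ r lam)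
    (m : Fin M) (a a' R : ℝ) (hpow : a ^ 2 + a' ^ 2 = 1) (hR : 0 < R)
    (hcond : a ^ 2 * ((2 : ℝ) ^ R - 1) < a' ^ 2) :
    MimoNoma.HasDiversityOrder (S.farOutage U μ r₀ α ρI a a' R m) 1 ∧
      ∀ δ : ℝ, 0 ≤ δ →
        MimoNoma.HasDiversityOrder (S.farOutageMod U μ r₀ α ρI a a' R δ m) 1 := by
  have h₁ : 0 < r₁ := hr₀.trans_le hr₀₁
  have hfar := hS.ae_normSq_pairFar_le hMN h₁ hr₁ hU m
  have hI (ω : Ω) : 0 ≤ S.farInterference r₀ α ρI m ω := ENNReal.toReal_nonneg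
  refine ⟨?_, fun δ hδ => ?_⟩
  · refine hS.hasDiversityOrder_outageProb hMN hr₀ h₁ hr₁ hα hρI hαI hU m hR hcond
      -- By Cauchy–Schwarz |vᴴ1|² ≤ N|v|² ≤ 2N, so the true noise power is at most 2 + 2N I.
      (δ := N) (Nat.cast_nonneg N) (ae_of_all _ fun ω => ?_) ?_
    · exact le_add_of_nonneg_right (mul_nonneg (sq_nonneg _) (hI ω))
    · filter_upwards [hfar] with ω hω
      have h := MimoNoma.norm_sum_star_sq_le (S.farDetector U m ω)
      have h2 : ‖∑ n, star (S.farDetector U m ω n)‖ ^ 2 ≤ 2 * N :=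
        h.trans ((mul_le_mul_of_nonneg_left hω (Nat.cast_nonneg N)).trans (by linarith))
      exact add_le_add hω (mul_le_mul_of_nonneg_right h2 (hI ω))
  -- The upper bound on the noise is an equality here, and the lower one holds because |v_{m'}|² ≤
  -- |x|² = 2.
  · refine hS.hasDiversityOrder_outageProb hMN hr₀ h₁ hr₁ hα hρI hαI hU m hR hcond
      (δ := δ) hδ ?_ (ae_of_all _ fun ω => le_rfl)
    filter_upwards [hfar] with ω hω
    exact hω.trans (le_add_of_nonneg_right (mul_nonneg (by positivity) (hI ω)))
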